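/- Let $n,N\ge 1$, $T>0$, and let $\mathbb{R}^{1+n}$, with points $(t,x)$, carry the Minkowski metric $-dt^2+dx^2$. Let $\Omega\subset\mathbb{R}^n$ be a bounded set with $\operatorname{int}(\overline{\Omega})\subset\Omega$ (for instance a compact set, or a bounded open set with Lipschitz boundary). Let $A_0,\dots,A_n\in C^\infty(\mathbb{R}^{1+n};\mathbb{C}^{N\times N})$. For $Q\in C^\infty(\mathbb{R}^{1+n};\mathbb{C}^{N\times N})$ with $\operatorname{supp}Q\subset\mathbb{R}\times\Omega$ consider, with $\partial_0=\partial_t$ and $\partial_j=\partial_{x_j}$, $$\Box_{A,Q}u=\partial_t^2u-\Delta u+2\sum_{j=0}^nA_j\,\partial_ju+Qu ,\qquad u=(u_1,\dots,u_N)^T .$$ For a source $f\in C_0^\infty((0,T)\times(\mathbb{R}^n\setminus\Omega);\mathbb{C}^N)$ let $u\in C^\infty([0,T)\times\mathbb{R}^n;\mathbb{C}^N)$ be the solution of $$\Box_{A,Q}u=f\ \text{ in }(0,T)\times\mathbb{R}^n,\qquad u|_{t=0}=\partial_tu|_{t=0}=0 ,$$ and let $R_Qf$ be the restriction of $u$ to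 $(0,T)\times(\mathbb{R}^n\setminus\Omega)$; the map $R_Q$ is the source-to-solution map. Let $\ell>0$ and let $\gamma:[0,\ell]\to(0,T)\times\mathbb{R}^n$ be a null geodesic of the Minkowski metric such that the spatial components of $\gamma(0)$ and $\gamma(\ell)$ do not lie in $\Omega$. Put $A\cdot\dot\gamma=-A_0(\gamma)\,\dot\gamma^0+\sum_{i=1}^nA_i(\gamma)\,\dot\gamma^i$ and let $P_{A,\gamma}(s)\in\mathbb{C}^{N\times N}$ be the solution of $$\partial_sP_{A,\gamma}(s)=(A\cdot\dot\gamma)(s)\,P_{A,\gamma}(s)\ \text{ on }[0,\ell],\qquad P_{A,\gamma}(0)=\mathrm{Id}.$$ Then $R_Q$ (for given $n,N,T,\Omega,A,\gamma$) uniquely determines $$\int_0^\ell P_{A,\gamma}(s)^{-1}\,Q(\gamma(s))\,P_{A,\gamma}(s)\,ds ;$$ that is, if $Q_1,Q_2\in C^\infty(\mathbb{R}^{1+n};\mathbb{C}^{N\times N})$ are both supported in $\mathbb{R}\times\Omega$ and $R_{Q_1}=R_{Q_2}$, then $$\int_0^\ell P_{A,\gamma}(s)^{-1}\,Q_1(\gamma(s))\,P_{A,\gamma}(s)\,ds=\int_0^\ell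 P_{A,\gamma}(s)^{-1}\,Q_2(\gamma(s))\,P_{A,\gamma}(s)\,ds .$$ -/

import Mathlib

open Set
open scoped ContDiff

noncomputable section

namespace MinkowskiWave

/-- Minkowski space `ℝ^{1+n}`; a point is `(t, x)`. -/
abbrev Spacetime (n : ℕ) : Type := ℝ × EuclideanSpace ℝ (Fin n)

/-- The `j`-th coordinate vector of `ℝ^{1+n}`; index `0` is time. -/
def basisVec {n : ℕ} : Fin (n + 1) → Spacetime n :=
  Fin.cons (1, 0) (fun i => (0, EuclideanSpace.single i 1))

/-- The partial derivative `∂_j u`, with `∂_0 = ∂_t`. -/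
def pderiv {n N : ℕ} (j : Fin (n + 1)) (u : Spacetime n → Fin N → ℂ) :
    Spacetime n → Fin N → ℂ :=
  fun p => fderiv ℝ u p (basisVec j)

/-- The operator `□_{A,Q} u = ∂_t² u - Δ u + 2 ∑_{j=0}^n A_j ∂_j u + Q u`. -/
def waveOp {n N : ℕ} (A : Fin (n + 1) → Spacetime n → Matrix (Fin N) (Fin N) ℂ)
    (Q : Spacetime n → Matrix (Fin N) (Fin N) ℂ) (u : Spacetime n → Fin N → ℂ) :
    Spacetime n → Fin N → ℂ :=
  fun p =>
    pderiv 0 (pderiv 0 u) p - ∑ i : Fin n, pderiv i.succ (pderiv i.succ u) p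
      + (2 : ℂ) • ∑ j : Fin (n + 1), (A j p).mulVec (pderiv j u p)
      + (Q p).mulVec (u p)

/-- `u` is a solution, smooth up to the initial time, of `□_{A,Q} u = f` in `(0,T) × ℝⁿ` with
`u = ∂_t u = 0` at `t = 0`. -/
structure IsWaveSolution {n N : ℕ} (T : ℝ)
    (A : Fin (n + 1) → Spacetime n → Matrix (Fin N) (Fin N) ℂ)
    (Q : Spacetime n → Matrix (Fin N) (Fin N) ℂ)
    (f u : Spacetime n → Fin N → ℂ) : Prop where
  smooth : ContDiffOn ℝ ∞ u (Ico 0 T ×ˢ univ)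
  eqn : ∀ p ∈ Ioo 0 T ×ˢ (univ : Set (EuclideanSpace ℝ (Fin n))), waveOp A Q u p = f p
  initial_value : ∀ x, u (0, x) = 0
  initial_velocity : ∀ x, HasDerivWithinAt (fun t : ℝ => u (t, x)) 0 (Ici 0) 0

/-- The sources: `C_0^∞((0,T) × (ℝⁿ \ Ω); ℂ^N)`. -/
def Source (n N : ℕ) (T : ℝ) (Ω : Set (EuclideanSpace ℝ (Fin n))) : Type :=
  {f : Spacetime n → Fin N → ℂ //
    ContDiff ℝ ∞ f ∧ HasCompactSupport f ∧ tsupport f ⊆ Ioo 0 T ×ˢ Ωᶜ}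

open Classical in
/-- The solution with source `f` (the Cauchy problem being well posed for smooth `A`, `Q` and
`f` as in `Source`, the second branch never occurs for such data and the choice is unique for `0 ≤ t < T`). -/
def waveSolution {n N : ℕ} (T : ℝ)
    (A : Fin (n + 1) → Spacetime n → Matrix (Fin N) (Fin N) ℂ)
    (Q : Spacetime n → Matrix (Fin N) (Fin N) ℂ)
    (f : Spacetime n → Fin N → ℂ) : Spacetime n → Fin N → ℂ :=
  if h : ∃ u, IsWaveSolution T A Q f u then h.choose else 0

/-- The source-to-solution map `f ↦ u|_{x ∉ Ω}`, with `u` the solution in `(0,T) × ℝⁿ`. -/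
def sourceToSolution {n N : ℕ} (T : ℝ) (Ω : Set (EuclideanSpace ℝ (Fin n)))
    (A : Fin (n + 1) → Spacetime n → Matrix (Fin N) (Fin N) ℂ)
    (Q : Spacetime n → Matrix (Fin N) (Fin N) ℂ) :
    Source n N T Ω → ((Ioo 0 T ×ˢ Ωᶜ : Set (Spacetime n)) → Fin N → ℂ) :=
  fun f p => waveSolution T A Q f.1 p.1

/-- The Minkowski metric `-dt² + dx²`. -/
def minkowski {n : ℕ} (v w : Spacetime n) : ℝ :=
  -(v.1 * w.1) + ∑ i : Fin n, v.2 i * w.2 i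

/-- The velocity of a curve on `[0,ℓ]` (one-sided at the endpoints). -/
def velocity {n : ℕ} (ℓ : ℝ) (γ : ℝ → Spacetime n) : ℝ → Spacetime n :=
  derivWithin γ (Icc 0 ℓ)

/-- `γ` is a null geodesic on `[0,ℓ]`: the Christoffel symbols of the Minkowski metric vanish in
the coordinates `(t,x)`, so the geodesic equation is `γ'' = 0`. -/
structure IsNullGeodesic {n : ℕ} (ℓ : ℝ) (γ : ℝ → Spacetime n) : Prop where
  smooth : ContDiffOn ℝ ∞ γ (Icc 0 ℓ)
  geodesic : ∀ s ∈ Icc 0 ℓ, derivWithin (velocity ℓ γ) (Icc 0 ℓ) s = 0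
  velocity_ne_zero : ∀ s ∈ Icc 0 ℓ, velocity ℓ γ s ≠ 0
  null : ∀ s ∈ Icc 0 ℓ, minkowski (velocity ℓ γ s) (velocity ℓ γ s) = 0

/-- The contraction `A · w = -A_0 w^0 + ∑_{i=1}^n A_i w^i` of the coefficients `A_j` of the
first-order term `2 ∑_j A_j ∂_j` with a vector `w`, taken with the Minkowski metric. With this
sign the transport equation `∂_s a = (A · γ') a` along `γ(s) = (t₀ + s, x₀ + s v)`, `|v| = 1`, is
`(∂_t + v · ∇_x + ∑_j A_j ∂_j φ) a = 0` for the phase `φ = t - v · x`. -/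
def contract {n N : ℕ} (A : Fin (n + 1) → Spacetime n → Matrix (Fin N) (Fin N) ℂ)
    (p w : Spacetime n) : Matrix (Fin N) (Fin N) ℂ :=
  -((w.1 : ℂ) • A 0 p) + ∑ i : Fin n, (w.2 i : ℂ) • A i.succ p

/-- `P` is the normalized fundamental matrix solution of `∂_s u - (A · γ') u = 0` on `[0,ℓ]`:
`∂_s P = (A · γ') P` and `P(0) = Id`. -/
def IsFundamentalSolution {n N : ℕ} (ℓ : ℝ)
    (A : Fin (n + 1) → Spacetime n → Matrix (Fin N) (Fin N) ℂ) (γ : ℝ → Spacetime n)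
    (P : ℝ → Matrix (Fin N) (Fin N) ℂ) : Prop :=
  P 0 = 1 ∧ ∀ s ∈ Icc 0 ℓ, ∀ a b : Fin N,
    HasDerivWithinAt (fun r => P r a b) ((contract A (γ s) (velocity ℓ γ s) * P s) a b)
      (Icc 0 ℓ) s

open Classical in
/-- The matrix `P_{A,γ}` (which exists and is unique on `[0,ℓ]` as the equation is linear). -/
def transport {n N : ℕ} (ℓ : ℝ)
    (A : Fin (n + 1) → Spacetime n → Matrix (Fin N) (Fin N) ℂ) (γ : ℝ → Spacetime n) :
    ℝ → Matrix (Fin N) (Fin N) ℂ :=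
  if h : ∃ P, IsFundamentalSolution ℓ A γ P then h.choose else 1

/-- The matrix `∫_0^ℓ P_{A,γ}(s)⁻¹ Q(γ(s)) P_{A,γ}(s) ds`, computed entrywise. -/
def lightRayTransform {n N : ℕ} (ℓ : ℝ)
    (A : Fin (n + 1) → Spacetime n → Matrix (Fin N) (Fin N) ℂ) (γ : ℝ → Spacetime n)
    (Q : Spacetime n → Matrix (Fin N) (Fin N) ℂ) : Matrix (Fin N) (Fin N) ℂ :=
  Matrix.of fun a b =>
    ∫ s in (0 : ℝ)..ℓ, ((transport ℓ A γ s)⁻¹ * Q (γ s) * transport ℓ A γ s) a b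

end MinkowskiWave

end

set_option linter.unusedSectionVars false

/-! Suppose `R_{Q₁} = R_{Q₂}`. The difference of the two solutions is tested against geometric
optics waves concentrated near a null ray. For a unit vector `ν` and the phase `φ = t - ν·x`,
conjugation gives `e^{-iτφ} □_{A,Q} (e^{iτφ} z) = 2iτ (∂_t + ν·∇ - C) z + □_{A,Q} z` with `C = -A_0
+ ∑ ν_i A_i` (`waveOpCLM_wavePhase`). The amplitude `z₀ = θ(t) χ(x - tν) P c`, with `P` the
transport along rays, solves the transport equation except in the short time interval where `θ`
switches on. The terms containing derivatives of `θ` are taken as the source `f`; they live over the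
complement of `Ω` and do not involve `Q`. The solutions are then `u_i = e^{iτφ} z₀ + r_i` with
`□_{A,Q_i} r_i` bounded uniformly in `τ`, and an energy estimate bounds `r_i` and its first
derivatives locally, uniformly in `τ` but without decay.

The function `w = u₁ - u₂` vanishes over the complement of `Ω` and satisfies `□_{A,Q₁} w = (Q₂ - Q₁)
u₂`. Pair this with `e^{-iτφ} b`, where `b = ψ χ₂ P'` and `P'` is the inverse transport. The term of
order `τ` is exactly zero: `b` solves the adjoint transport equation except where `ψ' ≠ 0`, and
there `w = 0`. Every term containing a remainder is `O(1/τ)` after one integration by parts in time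
against the oscillating factor (`exists_oscillatory_bound`), so a single leading amplitude suffices.
Hence the `τ`-independent integral of `b (Q₂ - Q₁) z₀` vanishes (`integral_beam_eq_zero`), and
concentrating `χ` on the ray gives the weighted ray integral (`integral_ray_eq_zero`).

The tubes need room around the endpoints, so this covers endpoints in the interior of the
complement. The condition on `Ω` makes every point outside `Ω` a limit of such points, and the ray
integral is continuous in the endpoints because transport depends smoothly on the ray
(`exists_transport_integral_eq_zero`). An affine change of parameter and a change of normalisation
of `P` finish the proof.

The analytic inputs are proved from first principles. Solutions exist by Fourier series on a large
torus, where the equation splits into half-wave equations solved by a Dyson series; finite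
propagation speed brings the result back to `ℝⁿ`. The same series gives linear ordinary differential
equations smooth in parameters. The energy estimate uses a smooth weight supported in a light cone
instead of boundary integrals. -/

noncomputable section

namespace MinkowskiWave

/-! ### Lattice weights, and Fourier series of functions supported in a cube -/

/-- The Japanese-bracket type weight `1 + ‖k‖` on the lattice `ℤ^d`. -/
def bracket {d : ℕ} (k : Fin d → ℤ) : ℝ := 1 + ‖k‖

theorem one_le_bracket {d : ℕ} (k : Fin d → ℤ) : 1 ≤ bracket k := by
  unfold bracket; linarith [norm_nonneg k]

theorem bracket_pos {d : ℕ} (k : Fin d → ℤ) : 0 < bracket k :=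
  zero_lt_one.trans_le (one_le_bracket k)

/-- Peetre's inequality: the product exceeds the triangle inequality by nonnegative terms. It
distributes a power of the weight at `k` over the two factors of a convolution. -/
theorem bracket_le_mul {d : ℕ} (k l : Fin d → ℤ) : bracket k ≤ bracket (k - l) * bracket l := by
  unfold bracket
  have h1 : ‖k‖ ≤ ‖k - l‖ + ‖l‖ := by simpa using norm_add_le (k - l) l
  nlinarith [norm_nonneg (k - l), norm_nonneg l, mul_nonneg (norm_nonneg (k - l)) (norm_nonneg l)]

theorem abs_coord_le_bracket {d : ℕ} (k : Fin d → ℤ) (i : Fin d) : |(k i : ℝ)| ≤ bracket k := by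
  have h := norm_le_pi_norm k i
  rw [Int.norm_eq_abs] at h
  unfold bracket; linarith

theorem summable_one_add_abs_inv : Summable fun m : ℤ => ((1 + |(m : ℝ)|) ^ 2)⁻¹ := by
  have h2 : Summable fun m : ℤ => 1 / |(m : ℝ)| ^ (2 : ℝ) :=
    Real.summable_one_div_int_add_rpow 0 2 |>.mpr (by norm_num) |>.congr (by simp)
  refine Summable.of_norm_bounded_eventually (g := fun m : ℤ => 1 / |(m : ℝ)| ^ (2 : ℝ)) h2 ?_
  have : ∀ᶠ m : ℤ in Filter.cofinite, m ∉ ({0} : Set ℤ) :=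
    (finite_singleton (0 : ℤ)).compl_mem_cofinite
  filter_upwards [this] with m hm
  have hm' : (0 : ℝ) < |(m : ℝ)| := by
    have : m ≠ 0 := by simpa using hm
    positivity
  rw [Real.norm_of_nonneg (by positivity), Real.rpow_two, one_div]
  exact inv_anti₀ (by positivity) (by nlinarith)

theorem summable_prod_one_add_abs (d : ℕ) :
    Summable fun k : Fin d → ℤ => ∏ i, ((1 + |(k i : ℝ)|) ^ 2)⁻¹ := by
  induction d with
  | zero => exact (hasSum_fintype _).summable
  | succ d ih =>
    have h3 := summable_one_add_abs_inv.mul_of_nonneg ih (fun _ => by positivity) (fun _ => by positivity)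
    rw [← (Fin.consEquiv (fun _ : Fin (d + 1) => ℤ)).summable_iff]
    refine h3.congr fun x => ?_
    simp [Fin.prod_univ_succ, Fin.consEquiv, mul_comm]

/-- Each coordinate is dominated by the sup norm, so `bracket k ^ (2 * d)` is at least `∏ (1 + |k
i|) ^ 2`, and the inverse of that product sums as a product of one-dimensional series. The exponent
`2 * d` is the price of summation paid throughout. -/
theorem summable_bracket_inv (d : ℕ) : Summable fun k : Fin d → ℤ => (bracket k ^ (2 * d))⁻¹ := by
  refine (summable_prod_one_add_abs d).of_nonneg_of_le
    (fun k => by have := bracket_pos k; positivity) fun k => ?_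
  rw [Finset.prod_inv_distrib, Finset.prod_pow]
  refine inv_anti₀ (pow_pos (Finset.prod_pos fun i _ => by positivity) _) ?_
  rw [mul_comm, pow_mul]
  gcongr
  calc ∏ i, (1 + |(k i : ℝ)|) ≤ ∏ _i : Fin d, bracket k := by
        refine Finset.prod_le_prod (fun _ _ => by positivity) fun i _ => ?_
        have h := norm_le_pi_norm k i
        rw [Int.norm_eq_abs] at h
        unfold bracket; linarith
    _ = bracket k ^ d := by simp

/-- The Fourier character `z ↦ exp (2πi k·z)`. -/
def latticeChar {D : ℕ} (k : Fin D → ℤ) (z : Fin D → ℝ) : ℂ :=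
  Complex.exp (2 * Real.pi * Complex.I * ((∑ i, (k i : ℝ) * z i : ℝ) : ℂ))

theorem mFourier_coe_eq {D : ℕ} (k : Fin D → ℤ) (z : Fin D → ℝ) :
    UnitAddTorus.mFourier k (fun i => (z i : UnitAddCircle)) = latticeChar k z := by
  simp only [UnitAddTorus.mFourier, ContinuousMap.coe_mk, latticeChar]
  simp_rw [fourier_coe_apply]
  rw [← Complex.exp_sum]
  congr 1
  push_cast
  rw [Finset.mul_sum]
  exact Finset.sum_congr rfl fun i _ => by simp; ring

/-- A smooth function supported strictly inside the unit cube descends to a continuous function on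
the torus. Its Fourier coefficients are the values at lattice points of the Fourier transform of a
Schwartz function, which gives their rapid decay and hence pointwise convergence of the series. -/
theorem hasSum_fourier_cube {D : ℕ} (g : EuclideanSpace ℝ (Fin D) → ℂ) (hg : ContDiff ℝ ∞ g)
    (hs : tsupport g ⊆ {z | ∀ i, |z i| < 1 / 2}) :
    ∃ c : (Fin D → ℤ) → ℂ, (∀ s : ℕ, ∃ C, ∀ k, ‖c k‖ * bracket k ^ s ≤ C) ∧
      ∀ z : EuclideanSpace ℝ (Fin D), (∀ i, |z i| < 1 / 2) →
        HasSum (fun k => c k * latticeChar k z) (g z) := by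
  have hbd : Bornology.IsBounded {z : EuclideanSpace ℝ (Fin D) | ∀ i, |z i| < 1 / 2} := by
    refine (Metric.isBounded_iff_subset_closedBall 0).mpr ⟨Real.sqrt (∑ _i : Fin D, 1), ?_⟩
    intro z hz
    rw [mem_closedBall_zero_iff, EuclideanSpace.norm_eq]
    refine Real.sqrt_le_sqrt (Finset.sum_le_sum fun i _ => ?_)
    have := hz i
    rw [Real.norm_eq_abs]
    nlinarith [abs_nonneg (z i)]
  have hcs : HasCompactSupport g :=
    Metric.isCompact_of_isClosed_isBounded (isClosed_tsupport g) (hbd.subset hs)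
  set G := hcs.toSchwartzMap hg with hG
  have hGg : ∀ z, G z = g z := fun z => rfl
  -- Coordinatewise representative in `(-1/2, 1/2]`: a discontinuous section of the quotient map to
  -- the torus.
  let rep : UnitAddTorus (Fin D) → EuclideanSpace ℝ (Fin D) := fun x =>
    WithLp.toLp 2 fun i => ((AddCircle.equivIoc (1 : ℝ) (-(1 / 2)) (x i) : Ioc _ _) : ℝ)
  have hrep : ∀ z : EuclideanSpace ℝ (Fin D), (∀ i, z i ∈ Ioc (-(1 / 2) : ℝ) (-(1 / 2) + 1)) →
      rep (fun i => (z i : UnitAddCircle)) = z := by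
    intro z hz
    ext i
    simp only [rep]
    exact congrArg Subtype.val ((AddCircle.equivIoc (1 : ℝ) (-(1 / 2))).apply_symm_apply ⟨z i, hz i⟩)
  have hmk : ∀ x, (fun i => ((rep x i : ℝ) : UnitAddCircle)) = x := by
    intro x; ext i
    exact AddCircle.coe_equivIoc (p := (1 : ℝ)) (a := -(1 / 2)) (y := x i)
  -- If the representative lies in the support of `g` it is off the faces of the cube, where `rep`
  -- is continuous. Otherwise the image of the support is compact, hence closed, and the function
  -- vanishes near the point.
  have hcont : Continuous fun x => g (rep x) := by
    rw [continuous_iff_continuousAt]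
    intro x
    by_cases hx : rep x ∈ tsupport g
    · have h1 : ∀ i, rep x i ≠ 1 / 2 := fun i h => by
        have := hs hx i; rw [h] at this; norm_num at this
      have : ContinuousAt rep x := by
        refine (PiLp.continuous_toLp 2 _).continuousAt.comp ?_
        refine continuousAt_pi.2 fun i => continuous_subtype_val.continuousAt.comp
          (ContinuousAt.comp (f := fun x : UnitAddTorus (Fin D) => x i)
            (AddCircle.continuousAt_equivIoc (1 : ℝ) (-(1 / 2)) ?_) (continuous_apply i).continuousAt)
        intro h
        apply h1 i
        have h2 : x i = ((1 / 2 : ℝ) : UnitAddCircle) := by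
          rw [h, ← AddCircle.coe_add_period]
          norm_num
        simp only [rep, h2]
        exact congrArg Subtype.val ((AddCircle.equivIoc (1 : ℝ) (-(1 / 2))).apply_symm_apply
          ⟨1 / 2, by norm_num⟩)
      exact ContinuousAt.comp hg.continuous.continuousAt this
    · have hcl : IsClosed ((fun z : EuclideanSpace ℝ (Fin D) => fun i => ((z i : ℝ) : UnitAddCircle)) ''
          tsupport g) := by
        refine (hcs.isCompact.image ?_).isClosed
        exact continuous_pi fun i => (AddCircle.continuous_mk' 1).comp
          (EuclideanSpace.proj i).continuous
      have hxn : x ∉ (fun z : EuclideanSpace ℝ (Fin D) => fun i => ((z i : ℝ) : UnitAddCircle)) ''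
          tsupport g := by
        rintro ⟨z, hz, rfl⟩
        apply hx
        rw [hrep z fun i => ?_]
        · exact hz
        · have := abs_lt.1 (hs hz i)
          constructor <;> linarith [this.1, this.2]
      have : (fun x => g (rep x)) =ᶠ[nhds x] fun _ => 0 := by
        filter_upwards [hcl.isOpen_compl.mem_nhds hxn] with y hy
        by_contra h
        exact hy ⟨rep y, subset_tsupport _ h, hmk y⟩
      exact continuousAt_const.congr this.symm
  let f : C(UnitAddTorus (Fin D), ℂ) := ⟨fun x => g (rep x), hcont⟩
  have hcoef : ∀ k : Fin D → ℤ, UnitAddTorus.mFourierCoeff f k =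
      FourierTransform.fourier (G : EuclideanSpace ℝ (Fin D) → ℂ)
        (WithLp.toLp 2 fun i => (k i : ℝ)) := by
    intro k
    rw [UnitAddTorus.mFourierCoeff_eq_integral f k (fun _ => -(1 / 2)), Real.fourier_eq]
    rw [← (EuclideanSpace.volume_preserving_symm_measurableEquiv_toLp (Fin D)).symm.integral_comp
      (MeasurableEquiv.measurableEmbedding _)]
    rw [← MeasureTheory.integral_indicator]
    · congr 1
      ext z
      rw [indicator_apply]
      split_ifs with hz
      · have h1 := hrep (WithLp.toLp 2 z) hz
        simp only [f, ContinuousMap.coe_mk, hGg]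
        rw [mFourier_coe_eq]
        have h2 : g (rep fun i => (z i : UnitAddCircle)) = g (WithLp.toLp 2 z) := by
          rw [← h1]
        rw [h2]
        simp only [MeasurableEquiv.symm_symm, MeasurableEquiv.coe_toLp, Circle.smul_def,
          Real.fourierChar_apply, latticeChar, smul_eq_mul]
        congr 2
        simp [PiLp.inner_apply]
        ring_nf
      · have : g (WithLp.toLp 2 z) = 0 := by
          by_contra h
          apply hz
          intro i
          have := abs_lt.1 (hs (subset_tsupport _ h) i)
          simp only at this
          constructor <;> linarith [this.1, this.2]
        simp [hGg, this]
    · exact MeasurableSet.univ_pi' fun i => measurableSet_Ioc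
  have hdec : ∀ s : ℕ, ∃ C, ∀ k, ‖UnitAddTorus.mFourierCoeff f k‖ * bracket k ^ s ≤ C := by
    intro s
    obtain ⟨C0, -, hC0⟩ := (FourierTransform.fourier G).decay 0 0
    obtain ⟨C1, -, hC1⟩ := (FourierTransform.fourier G).decay s 0
    refine ⟨2 ^ s * (C0 + C1), fun k => ?_⟩
    have a0 := hC0 (WithLp.toLp 2 fun i => (k i : ℝ))
    have a1 := hC1 (WithLp.toLp 2 fun i => (k i : ℝ))
    rw [norm_iteratedFDeriv_zero, SchwartzMap.fourier_coe, ← hcoef] at a0 a1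
    rw [pow_zero, one_mul] at a0
    have hk : ‖k‖ ≤ ‖(WithLp.toLp 2 fun i => (k i : ℝ) : EuclideanSpace ℝ (Fin D))‖ := by
      refine (pi_norm_le_iff_of_nonneg (norm_nonneg _)).2 fun i => ?_
      have := PiLp.norm_apply_le (WithLp.toLp 2 fun i => (k i : ℝ) : EuclideanSpace ℝ (Fin D)) i
      simpa [Int.norm_eq_abs] using this
    set y := ‖(WithLp.toLp 2 fun i => (k i : ℝ) : EuclideanSpace ℝ (Fin D))‖
    set w := ‖UnitAddTorus.mFourierCoeff f k‖
    have h3 : bracket k ^ s ≤ 2 ^ s * (1 + y ^ s) := by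
      have h4 : bracket k ≤ 2 * max 1 y := by
        unfold bracket
        have := le_max_left 1 y
        have := le_max_right 1 y
        linarith
      calc bracket k ^ s ≤ (2 * max 1 y) ^ s := by
            have := bracket_pos k; gcongr
        _ = 2 ^ s * (max 1 y) ^ s := mul_pow _ _ _
        _ ≤ 2 ^ s * (1 + y ^ s) := by
            gcongr
            have hy : 0 ≤ y ^ s := by positivity
            rcases max_choice 1 y with h | h <;> rw [h]
            · simp [hy]
            · linarith
    calc w * bracket k ^ s ≤ w * (2 ^ s * (1 + y ^ s)) := by gcongr
      _ = 2 ^ s * (w + y ^ s * w) := by ring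
      _ ≤ 2 ^ s * (C0 + C1) := by gcongr
  refine ⟨_, hdec, fun z hz => ?_⟩
  have hsum : Summable (UnitAddTorus.mFourierCoeff f) := by
    obtain ⟨C, hC⟩ := hdec (2 * D)
    refine ((summable_bracket_inv D).mul_left C).of_norm_bounded fun k => ?_
    have := bracket_pos k
    rw [← div_eq_mul_inv, le_div_iff₀ (by positivity)]
    exact hC k
  have := UnitAddTorus.hasSum_mFourier_series_apply_of_summable hsum
    (fun i => (z i : UnitAddCircle))
  have hz' : f (fun i => (z i : UnitAddCircle)) = g z := by
    simp only [f, ContinuousMap.coe_mk]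
    rw [hrep]
    intro i
    have := abs_lt.1 (hz i)
    constructor <;> linarith [this.1, this.2]
  rw [hz'] at this
  simpa only [mFourier_coe_eq, smul_eq_mul] using this

/-! ### Rapidly decaying coefficient families and their convolution -/

section Rapid

variable {d : ℕ} {E E₁ E₂ : Type*} [NormedAddCommGroup E] [NormedSpace ℂ E]
  [NormedAddCommGroup E₁] [NormedSpace ℂ E₁] [NormedAddCommGroup E₂] [NormedSpace ℂ E₂]

/-- A family of functions of time indexed by `ℤ^d` that decays faster than any power of the index,
uniformly for times in `J`. -/
def RapidDecay (J : Set ℝ) (F : (Fin d → ℤ) → ℝ → E) : Prop :=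
  (∀ k, ContinuousOn (F k) J) ∧ ∀ s : ℕ, ∃ C, ∀ k, ∀ t ∈ J, ‖F k t‖ * bracket k ^ s ≤ C

/-- The family and its time derivatives up to order `m` decay rapidly. -/
def RapidSmooth (J : Set ℝ) : ℕ → ((Fin d → ℤ) → ℝ → E) → Prop
  | 0, F => RapidDecay J F
  | m + 1, F => RapidDecay J F ∧
      ∃ F', (∀ k, ∀ t ∈ J, HasDerivAt (F k) (F' k t) t) ∧ RapidSmooth J m F'

theorem RapidSmooth.decay {J : Set ℝ} {m : ℕ} {F : (Fin d → ℤ) → ℝ → E}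
    (h : RapidSmooth J m F) : RapidDecay J F := by
  cases m with
  | zero => exact h
  | succ m => exact h.1

theorem RapidSmooth.of_succ {J : Set ℝ} {m : ℕ} {F : (Fin d → ℤ) → ℝ → E}
    (h : RapidSmooth J (m + 1) F) : RapidSmooth J m F := by
  induction m generalizing F with
  | zero => exact h.1
  | succ m ih =>
    obtain ⟨h1, F', h2, h3⟩ := h
    exact ⟨h1, F', h2, ih h3⟩

theorem RapidDecay.mono {J J' : Set ℝ} (hJ : J' ⊆ J) {F : (Fin d → ℤ) → ℝ → E}
    (h : RapidDecay J F) : RapidDecay J' F :=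
  ⟨fun k => (h.1 k).mono hJ, fun s => (h.2 s).imp fun _ hC k t ht => hC k t (hJ ht)⟩

theorem RapidSmooth.mono {J J' : Set ℝ} (hJ : J' ⊆ J) {m : ℕ} {F : (Fin d → ℤ) → ℝ → E}
    (h : RapidSmooth J m F) : RapidSmooth J' m F := by
  induction m generalizing F with
  | zero => exact RapidDecay.mono hJ h
  | succ m ih =>
    obtain ⟨h1, F', h2, h3⟩ := h
    exact ⟨h1.mono hJ, F', fun k t ht => h2 k t (hJ ht), ih h3⟩

theorem RapidDecay.exists_nonneg {J : Set ℝ} {F : (Fin d → ℤ) → ℝ → E} (h : RapidDecay J F)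
    (s : ℕ) : ∃ C, 0 ≤ C ∧ ∀ k, ∀ t ∈ J, ‖F k t‖ * bracket k ^ s ≤ C := by
  obtain ⟨C, hC⟩ := h.2 s
  exact ⟨max C 0, le_max_right _ _, fun k t ht => (hC k t ht).trans (le_max_left _ _)⟩

theorem RapidDecay.norm_le {J : Set ℝ} {F : (Fin d → ℤ) → ℝ → E} (h : RapidDecay J F)
    (s : ℕ) : ∃ C, 0 ≤ C ∧ ∀ k, ∀ t ∈ J, ‖F k t‖ ≤ C * (bracket k ^ s)⁻¹ := by
  obtain ⟨C, h0, hC⟩ := h.exists_nonneg s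
  refine ⟨C, h0, fun k t ht => ?_⟩
  have := bracket_pos k
  rw [← div_eq_mul_inv, le_div_iff₀ (by positivity)]
  exact hC k t ht

theorem RapidDecay.add {J : Set ℝ} {F G : (Fin d → ℤ) → ℝ → E}
    (hF : RapidDecay J F) (hG : RapidDecay J G) : RapidDecay J (fun k t => F k t + G k t) := by
  refine ⟨fun k => (hF.1 k).add (hG.1 k), fun s => ?_⟩
  obtain ⟨C, hC⟩ := hF.2 s
  obtain ⟨C', hC'⟩ := hG.2 s
  refine ⟨C + C', fun k t ht => ?_⟩
  have := bracket_pos k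
  calc ‖F k t + G k t‖ * bracket k ^ s ≤ (‖F k t‖ + ‖G k t‖) * bracket k ^ s := by
        gcongr; exact norm_add_le _ _
    _ ≤ C + C' := by rw [add_mul]; exact add_le_add (hC k t ht) (hC' k t ht)

theorem RapidSmooth.add {J : Set ℝ} {m : ℕ} {F G : (Fin d → ℤ) → ℝ → E}
    (hF : RapidSmooth J m F) (hG : RapidSmooth J m G) :
    RapidSmooth J m (fun k t => F k t + G k t) := by
  induction m generalizing F G with
  | zero => exact RapidDecay.add hF hG
  | succ m ih =>
    obtain ⟨h1, F', h2, h3⟩ := hF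
    obtain ⟨g1, G', g2, g3⟩ := hG
    exact ⟨h1.add g1, _, fun k t ht => (h2 k t ht).add (g2 k t ht), ih h3 g3⟩

theorem RapidSmooth.zero {J : Set ℝ} {m : ℕ} :
    RapidSmooth J m (fun (_ : Fin d → ℤ) (_ : ℝ) => (0 : E)) := by
  have h0 : RapidDecay J (fun (_ : Fin d → ℤ) (_ : ℝ) => (0 : E)) :=
    ⟨fun _ => continuousOn_const, fun _ => ⟨0, by simp⟩⟩
  induction m with
  | zero => exact h0
  | succ m ih => exact ⟨h0, _, fun k t _ => hasDerivAt_const _ _, ih⟩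

theorem RapidSmooth.sum {J : Set ℝ} {m : ℕ} {α : Type*} (S : Finset α)
    {F : α → (Fin d → ℤ) → ℝ → E} (hF : ∀ a ∈ S, RapidSmooth J m (F a)) :
    RapidSmooth J m (fun k t => ∑ a ∈ S, F a k t) := by
  classical
  induction S using Finset.induction_on with
  | empty => simpa using RapidSmooth.zero
  | insert a S ha ih =>
    simp_rw [Finset.sum_insert ha]
    exact (hF a (Finset.mem_insert_self _ _)).add
      (ih fun b hb => hF b (Finset.mem_insert_of_mem hb))

/-- A Fourier multiplier of polynomial growth, with values in bounded operators. -/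
theorem RapidSmooth.multiplier {J : Set ℝ} {m : ℕ} {F : (Fin d → ℤ) → ℝ → E₁}
    (hF : RapidSmooth J m F) (μ : (Fin d → ℤ) → E₁ →L[ℂ] E₂) {C : ℝ} {q : ℕ}
    (hμ : ∀ k, ‖μ k‖ ≤ C * bracket k ^ q) : RapidSmooth J m (fun k t => μ k (F k t)) := by
  have key : ∀ {F : (Fin d → ℤ) → ℝ → E₁}, RapidDecay J F →
      RapidDecay J (fun k t => μ k (F k t)) := by
    intro F hF
    refine ⟨fun k => (μ k).continuous.comp_continuousOn (hF.1 k), fun s => ?_⟩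
    obtain ⟨M, hM⟩ := hF.2 (s + q)
    refine ⟨C * M, fun k t ht => ?_⟩
    have hb := bracket_pos k
    have hC : 0 ≤ C := by
      have := (norm_nonneg _).trans (hμ k)
      exact nonneg_of_mul_nonneg_left this (by positivity)
    calc ‖μ k (F k t)‖ * bracket k ^ s ≤ (C * bracket k ^ q * ‖F k t‖) * bracket k ^ s := by
          gcongr; exact (μ k).le_of_opNorm_le (hμ k) _
      _ = C * (‖F k t‖ * bracket k ^ (s + q)) := by ring
      _ ≤ C * M := by gcongr; exact hM k t ht
  induction m generalizing F with
  | zero => exact key hF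
  | succ m ih =>
    obtain ⟨h1, F', h2, h3⟩ := hF
    refine ⟨key h1, _, fun k t ht => ?_, ih h3⟩
    exact ((μ k).restrictScalars ℝ).hasFDerivAt.comp_hasDerivAt t (h2 k t ht)

theorem RapidSmooth.map {J : Set ℝ} {m : ℕ} {F : (Fin d → ℤ) → ℝ → E₁}
    (hF : RapidSmooth J m F) (A : E₁ →L[ℂ] E₂) : RapidSmooth J m (fun k t => A (F k t)) :=
  hF.multiplier (fun _ => A) (C := ‖A‖) (q := 0) (by simp)

theorem RapidSmooth.smul {J : Set ℝ} {m : ℕ} {F : (Fin d → ℤ) → ℝ → E}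
    (hF : RapidSmooth J m F) (c : (Fin d → ℤ) → ℂ) {C : ℝ} {q : ℕ}
    (hc : ∀ k, ‖c k‖ ≤ C * bracket k ^ q) : RapidSmooth J m (fun k t => c k • F k t) := by
  refine hF.multiplier (fun k => c k • ContinuousLinearMap.id ℂ E) (C := C) (q := q) fun k => ?_
  refine (ContinuousLinearMap.opNorm_le_bound _ ((norm_nonneg _).trans (hc k)) fun x => ?_)
  simp only [smul_apply, ContinuousLinearMap.id_apply, norm_smul]
  exact mul_le_mul_of_nonneg_right (hc k) (norm_nonneg _)

/-- Convolution of a family of operators with a family of vectors. -/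
def latticeConv (b : (Fin d → ℤ) → ℝ → E₁ →L[ℂ] E₂) (W : (Fin d → ℤ) → ℝ → E₁) :
    (Fin d → ℤ) → ℝ → E₂ :=
  fun k t => ∑' l, b (k - l) t (W l t)

/-- By Peetre's inequality `s` powers of the weight at `k` are paid by the decay of both factors; `2
* d` further powers of the decay of `W` make the bound summable in `l`, uniformly in `t`. -/
theorem exists_conv_term_bound {J : Set ℝ} {b : (Fin d → ℤ) → ℝ → E₁ →L[ℂ] E₂}
    {W : (Fin d → ℤ) → ℝ → E₁} (hb : RapidDecay J b) (hW : RapidDecay J W) (s : ℕ) :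
    ∃ C, 0 ≤ C ∧ ∀ k l, ∀ t ∈ J,
      ‖b (k - l) t (W l t)‖ ≤ (bracket k ^ s)⁻¹ * (C * (bracket l ^ (2 * d))⁻¹) := by
  obtain ⟨C, hC0, hC⟩ := hb.exists_nonneg s
  obtain ⟨C', hC0', hC'⟩ := hW.norm_le (2 * d + s)
  refine ⟨C * C', by positivity, fun k l t ht => ?_⟩
  have h1 := bracket_pos k
  have h2 := bracket_pos l
  have h3 := bracket_pos (k - l)
  rw [← div_eq_inv_mul, le_div_iff₀ (by positivity)]
  have hkl : bracket k ^ s ≤ bracket (k - l) ^ s * bracket l ^ s := by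
    rw [← mul_pow]; exact pow_le_pow_left₀ h1.le (bracket_le_mul k l) s
  calc ‖b (k - l) t (W l t)‖ * bracket k ^ s
      ≤ (‖b (k - l) t‖ * ‖W l t‖) * (bracket (k - l) ^ s * bracket l ^ s) := by
        gcongr; exact (b (k - l) t).le_opNorm _
    _ = (‖b (k - l) t‖ * bracket (k - l) ^ s) * (‖W l t‖ * bracket l ^ s) := by ring
    _ ≤ C * ((C' * (bracket l ^ (2 * d + s))⁻¹) * bracket l ^ s) := by
        gcongr
        · exact hC _ _ ht
        · exact hC' _ _ ht
    _ = C * C' * (bracket l ^ (2 * d))⁻¹ := by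
        rw [pow_add]; field_simp

theorem summable_conv_bound (s : ℕ) (C : ℝ) (k : Fin d → ℤ) :
    Summable fun l : Fin d → ℤ => (bracket k ^ s)⁻¹ * (C * (bracket l ^ (2 * d))⁻¹) :=
  ((summable_bracket_inv d).mul_left C).mul_left _

theorem summable_conv [CompleteSpace E₂] {J : Set ℝ} {b : (Fin d → ℤ) → ℝ → E₁ →L[ℂ] E₂}
    {W : (Fin d → ℤ) → ℝ → E₁} (hb : RapidDecay J b) (hW : RapidDecay J W) (k : Fin d → ℤ)
    {t : ℝ} (ht : t ∈ J) : Summable fun l => b (k - l) t (W l t) := by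
  obtain ⟨C, -, hC⟩ := exists_conv_term_bound hb hW 0
  exact (summable_conv_bound 0 C k).of_norm_bounded fun l => hC k l t ht

theorem RapidDecay.conv [CompleteSpace E₂] {J : Set ℝ} {b : (Fin d → ℤ) → ℝ → E₁ →L[ℂ] E₂}
    {W : (Fin d → ℤ) → ℝ → E₁} (hb : RapidDecay J b) (hW : RapidDecay J W) :
    RapidDecay J (latticeConv b W) := by
  refine ⟨fun k => ?_, fun s => ?_⟩
  · obtain ⟨C, -, hC⟩ := exists_conv_term_bound hb hW 0
    exact continuousOn_tsum (fun l => (hb.1 (k - l)).clm_apply (hW.1 l))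
      (summable_conv_bound 0 C k) fun l t ht => hC k l t ht
  · obtain ⟨C, hC0, hC⟩ := exists_conv_term_bound hb hW s
    refine ⟨∑' l : Fin d → ℤ, C * (bracket l ^ (2 * d))⁻¹, fun k t ht => ?_⟩
    have h1 := bracket_pos k
    rw [← le_div_iff₀ (by positivity), div_eq_inv_mul, ← tsum_mul_left]
    exact tsum_of_norm_bounded (summable_conv_bound s C k).hasSum fun l => hC k l t ht

theorem hasDerivAt_clm_apply_complex {b : ℝ → E₁ →L[ℂ] E₂} {b' : E₁ →L[ℂ] E₂} {w : ℝ → E₁} {w' : E₁}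
    {t : ℝ} (hb : HasDerivAt b b' t) (hw : HasDerivAt w w' t) :
    HasDerivAt (fun t => b t (w t)) (b' (w t) + b t w') t := by
  have h1 : HasDerivAt (fun t => (b t).restrictScalars ℝ) (b'.restrictScalars ℝ) t :=
    (ContinuousLinearMap.restrictScalarsL ℂ E₁ E₂ ℝ ℝ).hasFDerivAt.comp_hasDerivAt t hb
  exact h1.clm_apply hw

/-- Leibniz rule under the sum: the differentiated series has a summable majorant uniform in time,
and it is a sum of two convolutions of families with one time derivative fewer at their disposal, so
induction on the order applies. -/
theorem RapidSmooth.conv [CompleteSpace E₂] {J : Set ℝ} (hJo : IsOpen J) (hJ : IsPreconnected J)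
    {m : ℕ} {b : (Fin d → ℤ) → ℝ → E₁ →L[ℂ] E₂} {W : (Fin d → ℤ) → ℝ → E₁}
    (hb : RapidSmooth J m b) (hW : RapidSmooth J m W) : RapidSmooth J m (latticeConv b W) := by
  induction m generalizing b W with
  | zero => exact RapidDecay.conv hb hW
  | succ m ih =>
    obtain ⟨b', hb', hb'm⟩ := hb.2
    obtain ⟨W', hW', hW'm⟩ := hW.2
    refine ⟨hb.1.conv hW.1, fun k t => latticeConv b' W k t + latticeConv b W' k t, ?_,
      (ih hb'm hW.of_succ).add (ih hb.of_succ hW'm)⟩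
    intro k t ht
    obtain ⟨C, -, hC⟩ := exists_conv_term_bound hb'm.decay hW.1 0
    obtain ⟨C', -, hC'⟩ := exists_conv_term_bound hb.1 hW'm.decay 0
    unfold latticeConv
    beta_reduce
    rw [← (summable_conv hb'm.decay hW.1 k ht).tsum_add (summable_conv hb.1 hW'm.decay k ht)]
    refine hasDerivAt_tsum_of_isPreconnected
      ((summable_conv_bound 0 C k).add (summable_conv_bound 0 C' k)) hJo hJ
      (fun l y hy => hasDerivAt_clm_apply_complex (hb' (k - l) y hy) (hW' l y hy))
      (fun l y hy => (norm_add_le _ _).trans (add_le_add (hC k l y hy) (hC' k l y hy))) ht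
      (summable_conv hb.1 hW.1 k ht) ht

end Rapid

/-! ### Summation of Fourier series with time-dependent coefficients -/

section Synthesis

variable {d : ℕ} {E E₁ E₂ : Type*} [NormedAddCommGroup E] [NormedSpace ℂ E]
  [NormedAddCommGroup E₁] [NormedSpace ℂ E₁] [NormedAddCommGroup E₂] [NormedSpace ℂ E₂]

/-- The frequency functional `x ↦ 2π ε k·x`. -/
def freq (ε : ℝ) (k : Fin d → ℤ) : EuclideanSpace ℝ (Fin d) →L[ℝ] ℝ :=
  ∑ i, (2 * Real.pi * ε * k i) • EuclideanSpace.proj i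

theorem freq_apply (ε : ℝ) (k : Fin d → ℤ) (x : EuclideanSpace ℝ (Fin d)) :
    freq ε k x = ∑ i, 2 * Real.pi * ε * k i * x i := by
  simp [freq, sum_apply]

/-- The character `x ↦ exp (2πi ε k·x)` of period `1/ε`. -/
def torusChar (ε : ℝ) (k : Fin d → ℤ) (x : EuclideanSpace ℝ (Fin d)) : ℂ :=
  Complex.exp (Complex.I * (freq ε k x : ℝ))

theorem norm_torusChar (ε : ℝ) (k : Fin d → ℤ) (x : EuclideanSpace ℝ (Fin d)) :
    ‖torusChar ε k x‖ = 1 := by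
  rw [torusChar, mul_comm, Complex.norm_exp_ofReal_mul_I]

theorem torusChar_add (ε : ℝ) (k l : Fin d → ℤ) (x : EuclideanSpace ℝ (Fin d)) :
    torusChar ε (k + l) x = torusChar ε k x * torusChar ε l x := by
  rw [torusChar, torusChar, torusChar, ← Complex.exp_add]
  congr 1
  simp only [freq_apply, Pi.add_apply, Int.cast_add]
  rw [← mul_add, ← Complex.ofReal_add, ← Finset.sum_add_distrib]
  congr 3
  ext i; ring

theorem hasFDerivAt_torusChar (ε : ℝ) (k : Fin d → ℤ) (x : EuclideanSpace ℝ (Fin d)) :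
    HasFDerivAt (torusChar ε k) ((torusChar ε k x * Complex.I) •
      (Complex.ofRealCLM.comp (freq ε k))) x := by
  have h1 : HasFDerivAt (fun y => ((freq ε k y : ℝ) : ℂ)) (Complex.ofRealCLM.comp (freq ε k)) x :=
    (Complex.ofRealCLM.comp (freq ε k)).hasFDerivAt
  have h2 := (h1.const_mul Complex.I).cexp
  simpa [torusChar, smul_smul] using! h2

/-- The sum of the Fourier series with time dependent coefficients `F`. -/
def synth (ε : ℝ) (F : (Fin d → ℤ) → ℝ → E) (p : ℝ × EuclideanSpace ℝ (Fin d)) : E :=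
  ∑' k, torusChar ε k p.2 • F k p.1

theorem summable_synth [CompleteSpace E] (ε : ℝ) {J : Set ℝ} {F : (Fin d → ℤ) → ℝ → E}
    (hF : RapidDecay J F) {p : ℝ × EuclideanSpace ℝ (Fin d)} (hp : p.1 ∈ J) :
    Summable fun k => torusChar ε k p.2 • F k p.1 := by
  obtain ⟨C, -, hC⟩ := hF.norm_le (2 * d)
  refine ((summable_bracket_inv d).mul_left C).of_norm_bounded fun k => ?_
  rw [norm_smul, norm_torusChar, one_mul]
  exact hC k _ hp

/-- The coefficients of the `i`-th spatial derivative. -/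
def freqMul (ε : ℝ) (i : Fin d) (F : (Fin d → ℤ) → ℝ → E) : (Fin d → ℤ) → ℝ → E :=
  fun k t => (Complex.I * (2 * Real.pi * ε * k i : ℝ)) • F k t

theorem norm_freqMul_coeff_le (ε : ℝ) (i : Fin d) (k : Fin d → ℤ) :
    ‖Complex.I * ((2 * Real.pi * ε * k i : ℝ) : ℂ)‖ ≤ (2 * Real.pi * |ε|) * bracket k ^ 1 := by
  rw [norm_mul, Complex.norm_I, one_mul, Complex.norm_real, Real.norm_eq_abs, abs_mul, abs_mul,
    abs_of_pos Real.two_pi_pos, pow_one]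
  gcongr
  exact abs_coord_le_bracket k i

theorem RapidSmooth.freqMul {J : Set ℝ} {m : ℕ} (ε : ℝ) (i : Fin d) {F : (Fin d → ℤ) → ℝ → E}
    (hF : RapidSmooth J m F) : RapidSmooth J m (freqMul ε i F) :=
  hF.smul _ (norm_freqMul_coeff_le ε i)

/-- Termwise differentiation. A time derivative falls on the coefficients, a space derivative
multiplies them by `2πiεk_i`; rapid decay absorbs this factor and majorises the derived series
uniformly in `x`. -/
theorem hasFDerivAt_synth [CompleteSpace E] (ε : ℝ) {J : Set ℝ} (hJo : IsOpen J)
    (hJ : IsPreconnected J) {F F' : (Fin d → ℤ) → ℝ → E} (hF : RapidDecay J F)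
    (hF' : RapidDecay J F') (hder : ∀ k, ∀ t ∈ J, HasDerivAt (F k) (F' k t) t)
    {p : ℝ × EuclideanSpace ℝ (Fin d)} (hp : p.1 ∈ J) :
    HasFDerivAt (synth ε F)
      ((ContinuousLinearMap.fst ℝ ℝ (EuclideanSpace ℝ (Fin d))).smulRight (synth ε F' p) +
        ∑ i, ((EuclideanSpace.proj i : EuclideanSpace ℝ (Fin d) →L[ℝ] ℝ).comp
          (ContinuousLinearMap.snd ℝ ℝ (EuclideanSpace ℝ (Fin d)))).smulRight
            (synth ε (freqMul ε i F) p)) p := by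
  have hfm : ∀ i, RapidDecay J (freqMul ε i F) := fun i =>
    RapidSmooth.freqMul (m := 0) ε i hF
  let D : (Fin d → ℤ) → ℝ × EuclideanSpace ℝ (Fin d) → (ℝ × EuclideanSpace ℝ (Fin d) →L[ℝ] E) :=
    fun k p => (ContinuousLinearMap.fst ℝ ℝ (EuclideanSpace ℝ (Fin d))).smulRight
        (torusChar ε k p.2 • F' k p.1) +
      ∑ i, ((EuclideanSpace.proj i : EuclideanSpace ℝ (Fin d) →L[ℝ] ℝ).comp
          (ContinuousLinearMap.snd ℝ ℝ (EuclideanSpace ℝ (Fin d)))).smulRight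
            (torusChar ε k p.2 • freqMul ε i F k p.1)
  have hD : ∀ k, ∀ p ∈ J ×ˢ (univ : Set (EuclideanSpace ℝ (Fin d))),
      HasFDerivAt (fun p : ℝ × EuclideanSpace ℝ (Fin d) => torusChar ε k p.2 • F k p.1) (D k p) p := by
    intro k p hp
    have h1 := (hasFDerivAt_torusChar ε k p.2).comp p hasFDerivAt_snd
    have h2 := (hder k p.1 hp.1).hasFDerivAt.comp p hasFDerivAt_fst
    have h3 := h1.smul h2
    refine h3.congr_fderiv ?_
    ext v
    · simp [D]
    · simp [D, freqMul, freq_apply, sum_apply, smul_smul, Finset.mul_sum,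
        Finset.sum_smul]
      refine Finset.sum_congr rfl fun i _ => ?_
      rw [← Complex.coe_smul (v.ofLp i), smul_smul]
      congr 1
      ring
  obtain ⟨C', -, hC'⟩ := hF'.norm_le (2 * d)
  choose C _ hC using fun i => (hfm i).norm_le (2 * d)
  have hproj : ∀ i, ‖((EuclideanSpace.proj i : EuclideanSpace ℝ (Fin d) →L[ℝ] ℝ).comp
          (ContinuousLinearMap.snd ℝ ℝ (EuclideanSpace ℝ (Fin d))))‖ ≤ 1 := fun i =>
    ContinuousLinearMap.opNorm_le_bound _ zero_le_one fun v => by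
      simpa using (PiLp.norm_apply_le v.2 i).trans (norm_snd_le v)
  have hbound : ∀ k, ∀ p ∈ J ×ˢ (univ : Set (EuclideanSpace ℝ (Fin d))),
      ‖D k p‖ ≤ (C' + ∑ i, C i) * (bracket k ^ (2 * d))⁻¹ := by
    intro k p hp
    refine (norm_add_le _ _).trans ?_
    rw [add_mul, Finset.sum_mul]
    refine add_le_add ?_ ((norm_sum_le _ _).trans (Finset.sum_le_sum fun i _ => ?_))
    · rw [ContinuousLinearMap.norm_smulRight_apply, norm_smul, norm_torusChar, one_mul]
      exact (mul_le_of_le_one_left (norm_nonneg _) (ContinuousLinearMap.norm_fst_le ..)).trans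
        (hC' k _ hp.1)
    · rw [ContinuousLinearMap.norm_smulRight_apply, norm_smul, norm_torusChar, one_mul]
      exact (mul_le_of_le_one_left (norm_nonneg _) (hproj i)).trans (hC i k _ hp.1)
  have hsum := (summable_bracket_inv d).mul_left (C' + ∑ i, C i)
  have hpm : p ∈ J ×ˢ (univ : Set (EuclideanSpace ℝ (Fin d))) := ⟨hp, mem_univ _⟩
  have main := hasFDerivAt_tsum_of_isPreconnected hsum (hJo.prod isOpen_univ)
    (hJ.prod isPreconnected_univ) hD hbound hpm (summable_synth ε hF hp) hpm
  refine main.congr_fderiv ?_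
  have hsD : Summable fun k => D k p := hsum.of_norm_bounded fun k => hbound k p hpm
  refine ContinuousLinearMap.ext fun v => ?_
  have e1 : (∑' k, D k p) v = ∑' k, D k p v :=
    (ContinuousLinearMap.apply ℝ E v).map_tsum hsD
  rw [e1]
  simp only [D, add_apply, ContinuousLinearMap.smulRight_apply,
    sum_apply]
  have s1 := (summable_synth ε hF' hp).const_smul v.1
  have s2 := fun i => (summable_synth ε (hfm i) hp).const_smul (v.2 i)
  have := (s1.hasSum.add (hasSum_sum (s := Finset.univ) fun i _ => (s2 i).hasSum)).tsum_eq
  simp only [synth]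
  refine Eq.trans ?_ (this.trans ?_)
  · rfl
  · rw [Summable.tsum_const_smul _ (summable_synth ε hF' hp)]
    simp_rw [Summable.tsum_const_smul _ (summable_synth ε (hfm _) hp)]
    rfl

theorem continuousOn_synth [CompleteSpace E] (ε : ℝ) {J : Set ℝ}
    {F : (Fin d → ℤ) → ℝ → E} (hF : RapidDecay J F) :
    ContinuousOn (synth ε F) (J ×ˢ univ) := by
  obtain ⟨C, -, hC⟩ := hF.norm_le (2 * d)
  refine continuousOn_tsum (fun k => ?_) ((summable_bracket_inv d).mul_left C) fun k p hp => ?_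
  · refine ContinuousOn.smul (Continuous.continuousOn ?_)
      ((hF.1 k).comp continuousOn_fst fun p hp => hp.1)
    exact (continuous_iff_continuousAt.2 fun x => (hasFDerivAt_torusChar ε k x).continuousAt).comp
      continuous_snd
  · rw [norm_smul, norm_torusChar, one_mul]
    exact hC k _ hp.1

theorem contDiffOn_synth [CompleteSpace E] (ε : ℝ) {J : Set ℝ} (hJo : IsOpen J)
    (hJ : IsPreconnected J) (m : ℕ) {F : (Fin d → ℤ) → ℝ → E} (hF : RapidSmooth J m F) :
    ContDiffOn ℝ m (synth ε F) (J ×ˢ univ) := by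
  induction m generalizing F with
  | zero => exact contDiffOn_zero.2 (continuousOn_synth ε hF)
  | succ m ih =>
    obtain ⟨h0, F', hder, hF'⟩ := hF
    have hfd : ∀ p ∈ J ×ˢ (univ : Set (EuclideanSpace ℝ (Fin d))), _ := fun p hp =>
      hasFDerivAt_synth ε hJo hJ h0 hF'.decay hder (p := p) hp.1
    rw [Nat.cast_succ, contDiffOn_succ_iff_fderiv_of_isOpen (hJo.prod isOpen_univ)]
    refine ⟨fun p hp => (hfd p hp).differentiableAt.differentiableWithinAt, by simp, ?_⟩
    refine ContDiffOn.congr ?_ fun p hp => (hfd p hp).fderiv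
    have hF0 : RapidSmooth J m F := RapidSmooth.of_succ ⟨h0, F', hder, hF'⟩
    refine ContDiffOn.add ?_ (ContDiffOn.sum fun i _ => ?_)
    · exact contDiffOn_const.smulRight (ih hF')
    · exact contDiffOn_const.smulRight (ih (hF0.freqMul ε i))

/-- The product of two absolutely convergent Fourier series: Fubini for the double sum, then the
shift `k ↦ k + l` and multiplicativity of the characters. -/
theorem synth_conv [CompleteSpace E₁] [CompleteSpace E₂] (ε : ℝ) {J : Set ℝ}
    {b : (Fin d → ℤ) → ℝ → E₁ →L[ℂ] E₂} {W : (Fin d → ℤ) → ℝ → E₁}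
    (hb : RapidDecay J b) (hW : RapidDecay J W) {p : ℝ × EuclideanSpace ℝ (Fin d)} (hp : p.1 ∈ J) :
    synth ε (latticeConv b W) p = synth ε b p (synth ε W p) := by
  obtain ⟨C, hC0, hC⟩ := exists_conv_term_bound hb hW (2 * d)
  -- Decay of order `2 * d` in the output index `k`, on top of that in `l`, makes the double family
  -- summable.
  have hprod : Summable fun q : (Fin d → ℤ) × (Fin d → ℤ) =>
      torusChar ε q.1 p.2 • b (q.1 - q.2) p.1 (W q.2 p.1) := by
    have h1 := (summable_bracket_inv d).mul_of_nonneg ((summable_bracket_inv d).mul_left C)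
      (fun k => by have := bracket_pos k; positivity)
      (fun k => by have := bracket_pos k; positivity)
    refine h1.of_norm_bounded fun q => ?_
    rw [norm_smul, norm_torusChar, one_mul]
    exact hC _ _ _ hp
  have hA := summable_synth ε hb hp
  have hB := summable_synth ε hW hp
  unfold synth latticeConv
  calc ∑' k, torusChar ε k p.2 • ∑' l, b (k - l) p.1 (W l p.1)
      = ∑' k, ∑' l, torusChar ε k p.2 • b (k - l) p.1 (W l p.1) := by
        refine tsum_congr fun k => ?_
        rw [Summable.tsum_const_smul _ (summable_conv hb hW k hp)]
    _ = ∑' l, ∑' k, torusChar ε k p.2 • b (k - l) p.1 (W l p.1) := by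
        rw [← Summable.tsum_comm (f := fun k l => torusChar ε k p.2 • b (k - l) p.1 (W l p.1)) hprod]
    _ = ∑' l, (∑' k, torusChar ε k p.2 • b k p.1) (torusChar ε l p.2 • W l p.1) := by
        refine tsum_congr fun l => ?_
        have e1 : (∑' k, torusChar ε k p.2 • b k p.1) (torusChar ε l p.2 • W l p.1) =
            ∑' k, (torusChar ε k p.2 • b k p.1) (torusChar ε l p.2 • W l p.1) :=
          (ContinuousLinearMap.apply ℂ E₂ (torusChar ε l p.2 • W l p.1)).map_tsum hA
        rw [e1, ← (Equiv.addRight l).tsum_eq]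
        refine tsum_congr fun k => ?_
        simp only [Equiv.coe_addRight, add_sub_cancel_right, smul_apply, map_smul, smul_smul]
        rw [torusChar_add, mul_comm]
    _ = _ := ((∑' k, torusChar ε k p.2 • b k p.1).map_tsum hB).symm

end Synthesis

/-! ### Fourier expansion of compactly supported functions of space and time -/

section Expansion

variable {d : ℕ}

theorem bracket_le_bracket_cons (m : ℤ) (k : Fin d → ℤ) :
    bracket k ≤ bracket (Fin.cons m k : Fin (d + 1) → ℤ) := by
  unfold bracket
  gcongr
  refine (pi_norm_le_iff_of_nonneg (norm_nonneg _)).2 fun i => ?_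
  simpa using norm_le_pi_norm (Fin.cons m k : Fin (d + 1) → ℤ) i.succ

theorem one_add_abs_le_bracket_cons (m : ℤ) (k : Fin d → ℤ) :
    1 + |(m : ℝ)| ≤ bracket (Fin.cons m k : Fin (d + 1) → ℤ) := by
  unfold bracket
  gcongr
  simpa [Int.norm_eq_abs] using norm_le_pi_norm (Fin.cons m k : Fin (d + 1) → ℤ) 0

/-- The partial sum in the time frequency of a space-time Fourier series. -/
def timeSeries (ε : ℝ) (c : (Fin (d + 1) → ℤ) → ℂ) (k : Fin d → ℤ) (t : ℝ) : ℂ :=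
  ∑' m : ℤ, Complex.exp (Complex.I * (2 * Real.pi * ε * m : ℝ) * t) * c (Fin.cons m k)

theorem norm_exp_I_mul_real_mul (a t : ℝ) : ‖Complex.exp (Complex.I * (a : ℂ) * t)‖ = 1 := by
  rw [mul_assoc, ← Complex.ofReal_mul, mul_comm, Complex.norm_exp_ofReal_mul_I]

theorem hasDerivAt_exp_I_mul_real_mul (a t : ℝ) :
    HasDerivAt (fun t : ℝ => Complex.exp (Complex.I * (a : ℂ) * t))
      (Complex.I * a * Complex.exp (Complex.I * (a : ℂ) * t)) t := by
  have h1 : HasDerivAt (fun t : ℝ => (t : ℂ)) 1 t := Complex.ofRealCLM.hasDerivAt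
  have h2 := (h1.const_mul (Complex.I * (a : ℂ))).cexp
  simpa [mul_comm] using h2

/-- The weight of the joint frequency dominates both `bracket k` and `1 + |m|`; two of the `s + 2`
powers are spent on the sum over the time frequency. -/
theorem exists_timeSeries_bound {c : (Fin (d + 1) → ℤ) → ℂ}
    (hc : ∀ s : ℕ, ∃ C, ∀ k, ‖c k‖ * bracket k ^ s ≤ C) (s : ℕ) :
    ∃ C, 0 ≤ C ∧ ∀ (k : Fin d → ℤ) (m : ℤ),
      ‖c (Fin.cons m k)‖ ≤ (bracket k ^ s)⁻¹ * (C * ((1 + |(m : ℝ)|) ^ 2)⁻¹) := by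
  obtain ⟨C, hC⟩ := hc (s + 2)
  have hC0 : 0 ≤ C := (by
    have := bracket_pos (0 : Fin (d + 1) → ℤ)
    positivity : 0 ≤ ‖c 0‖ * bracket 0 ^ (s + 2)).trans (hC 0)
  refine ⟨C, hC0, fun k m => ?_⟩
  have h1 := bracket_pos k
  have h2 := bracket_le_bracket_cons m k
  have h3 := one_add_abs_le_bracket_cons m k
  have h4 : 0 < 1 + |(m : ℝ)| := by positivity
  rw [← mul_assoc, mul_right_comm, ← mul_inv, ← div_eq_inv_mul, le_div_iff₀ (by positivity)]
  refine le_trans ?_ (hC (Fin.cons m k))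
  have h5 := h1.trans_le h2
  rw [pow_add]
  gcongr

theorem rapidSmooth_timeSeries (ε : ℝ) (M : ℕ) {c : (Fin (d + 1) → ℤ) → ℂ}
    (hc : ∀ s : ℕ, ∃ C, ∀ k, ‖c k‖ * bracket k ^ s ≤ C) :
    RapidSmooth univ M (timeSeries ε c) := by
  have hsum : ∀ (s : ℕ) (C : ℝ) (k : Fin d → ℤ), Summable fun m : ℤ =>
      (bracket k ^ s)⁻¹ * (C * ((1 + |(m : ℝ)|) ^ 2)⁻¹) := fun s C k =>
    (summable_one_add_abs_inv.mul_left C).mul_left _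
  have key : ∀ {c : (Fin (d + 1) → ℤ) → ℂ}, (∀ s : ℕ, ∃ C, ∀ k, ‖c k‖ * bracket k ^ s ≤ C) →
      RapidDecay univ (timeSeries ε c) := by
    intro c hc
    refine ⟨fun k => ?_, fun s => ?_⟩
    · obtain ⟨C, -, hC⟩ := exists_timeSeries_bound hc 0
      refine continuousOn_tsum (fun m => by fun_prop) (hsum 0 C k) fun m t _ => ?_
      rw [norm_mul, norm_exp_I_mul_real_mul, one_mul]
      exact hC k m
    · obtain ⟨C, hC0, hC⟩ := exists_timeSeries_bound hc s
      refine ⟨∑' m : ℤ, C * ((1 + |(m : ℝ)|) ^ 2)⁻¹, fun k t _ => ?_⟩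
      have h1 := bracket_pos k
      rw [← le_div_iff₀ (by positivity), div_eq_inv_mul, ← tsum_mul_left]
      refine tsum_of_norm_bounded (hsum s C k).hasSum fun m => ?_
      rw [norm_mul, norm_exp_I_mul_real_mul, one_mul]
      exact hC k m
  induction M generalizing c with
  | zero => exact key hc
  | succ M ih =>
    have hc' : ∀ s : ℕ, ∃ C, ∀ k, ‖Complex.I * (2 * Real.pi * ε * k 0 : ℝ) * c k‖ * bracket k ^ s
        ≤ C := by
      intro s
      obtain ⟨C, hC⟩ := hc (s + 1)
      refine ⟨(2 * Real.pi * |ε|) * C, fun k => ?_⟩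
      have hb := bracket_pos k
      calc _ ≤ ((2 * Real.pi * |ε|) * bracket k ^ 1) * ‖c k‖ * bracket k ^ s := by
            rw [norm_mul]
            gcongr
            exact norm_freqMul_coeff_le ε 0 k
        _ = (2 * Real.pi * |ε|) * (‖c k‖ * bracket k ^ (s + 1)) := by ring
        _ ≤ _ := by have := Real.pi_pos; gcongr; exact hC k
    refine ⟨key hc, _, fun k t _ => ?_, ih hc'⟩
    obtain ⟨C, -, hC⟩ := exists_timeSeries_bound hc' 0
    obtain ⟨C', -, hC'⟩ := exists_timeSeries_bound hc 0
    refine hasDerivAt_tsum (𝕜 := ℝ) (F := ℂ)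
      (g := fun (m : ℤ) t => Complex.exp (Complex.I * (2 * Real.pi * ε * m : ℝ) * t) * c (Fin.cons m k))
      (g' := fun (m : ℤ) t => Complex.exp (Complex.I * (2 * Real.pi * ε * m : ℝ) * t) *
        (Complex.I * (2 * Real.pi * ε * ((Fin.cons m k : Fin (d + 1) → ℤ) 0 : ℤ) : ℝ) *
          c (Fin.cons m k)))
      (hsum 0 C k) (y₀ := t) (fun m y => ?_) (fun m y => ?_) ?_ t
    · refine ((hasDerivAt_exp_I_mul_real_mul _ y).mul_const (c (Fin.cons m k))).congr_deriv ?_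
      rw [Fin.cons_zero]; ring
    · rw [norm_mul, norm_exp_I_mul_real_mul, one_mul]
      exact hC k m
    · refine (hsum 0 C' k).of_norm_bounded fun m => ?_
      rw [norm_mul, norm_exp_I_mul_real_mul, one_mul]
      exact hC' k m

/-- Dilation by `2 * R` maps the unit cube to the box, and the expansion is taken in space and time
together. Summing over the time frequency first leaves a spatial series whose coefficients are
smooth in time. Agreement holds only in the box, as the series is periodic in space. -/
theorem exists_synth_eq_scalar {f : ℝ × EuclideanSpace ℝ (Fin d) → ℂ} (hf : ContDiff ℝ ∞ f) {R : ℝ}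
    (hR : 0 < R) (hs : tsupport f ⊆ {p | |p.1| < R ∧ ∀ i, |p.2 i| < R}) :
    ∃ b : (Fin d → ℤ) → ℝ → ℂ, (∀ m, RapidSmooth univ m b) ∧
      ∀ p, |p.1| < R → (∀ i, |p.2 i| < R) → synth (1 / (2 * R)) b p = f p := by
  let A : EuclideanSpace ℝ (Fin (d + 1)) → ℝ × EuclideanSpace ℝ (Fin d) := fun z =>
    (2 * R * z 0, WithLp.toLp 2 fun i => 2 * R * z i.succ)
  have hA : ContDiff ℝ ∞ A := by
    refine ContDiff.prodMk (by fun_prop) ?_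
    exact (PiLp.contDiff_toLp).comp (contDiff_pi.2 fun i => by fun_prop)
  have hlt : ∀ a : ℝ, |2 * R * a| < R → |a| < 1 / 2 := fun a h => by
    rw [abs_mul, abs_of_pos (by positivity : 0 < 2 * R)] at h
    nlinarith
  obtain ⟨c, hc, hcs⟩ := hasSum_fourier_cube (f ∘ A) (hf.comp hA) (by
    refine (tsupport_comp_subset_preimage f hA.continuous).trans fun z hz i => ?_
    have := hs hz
    refine Fin.cases (hlt _ this.1) (fun j => hlt _ (this.2 j)) i)
  set ε := 1 / (2 * R) with hε
  refine ⟨timeSeries ε c, fun m => rapidSmooth_timeSeries ε m hc, fun p hp1 hp2 => ?_⟩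
  let z : EuclideanSpace ℝ (Fin (d + 1)) :=
    WithLp.toLp 2 (Fin.cons (ε * p.1) fun i => ε * p.2 i)
  have hAz : A z = p := by
    have h2 : 2 * R * ε = 1 := by rw [hε]; field_simp
    refine Prod.ext ?_ ?_
    · simp only [A, z, Fin.cons_zero]
      rw [← mul_assoc, h2, one_mul]
    · ext i
      simp only [A, z, Fin.cons_succ]
      rw [← mul_assoc, h2, one_mul]
  have hz : ∀ i, |z i| < 1 / 2 := by
    have h3 : ∀ i, z i = Fin.cons (α := fun _ => ℝ) (ε * p.1) (fun i => ε * p.2 i) i := fun i => rfl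
    have h4 : ∀ a : ℝ, |a| < R → |ε * a| < 1 / 2 := fun a ha => hlt _ (by
      rw [← mul_assoc, (by rw [hε]; field_simp : 2 * R * ε = 1), one_mul]; exact ha)
    intro i
    rw [h3]
    refine Fin.cases ?_ (fun j => ?_) i
    · simpa using h4 _ hp1
    · simpa using h4 _ (hp2 j)
  have h := hcs z hz
  rw [Function.comp_apply, hAz] at h
  rw [← (Fin.consEquiv (fun _ : Fin (d + 1) => ℤ)).hasSum_iff,
    ← (Equiv.prodComm _ _).hasSum_iff] at h
  have hterm : ∀ (k : Fin d → ℤ) (m : ℤ), c (Fin.cons m k) * latticeChar (Fin.cons m k) z =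
      torusChar ε k p.2 * (Complex.exp (Complex.I * (2 * Real.pi * ε * m : ℝ) * p.1) *
        c (Fin.cons m k)) := by
    intro k m
    have : latticeChar (Fin.cons m k) z =
        torusChar ε k p.2 * Complex.exp (Complex.I * (2 * Real.pi * ε * m : ℝ) * p.1) := by
      rw [latticeChar, torusChar, ← Complex.exp_add]
      congr 1
      rw [freq_apply, Fin.sum_univ_succ]
      simp only [z, Fin.cons_zero, Fin.cons_succ]
      push_cast
      rw [mul_add, Finset.mul_sum, Finset.mul_sum, add_comm]
      congr 1
      · exact Finset.sum_congr rfl fun i _ => by ring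
      · ring
    rw [this]; ring
  have h5 := h.prod_fiberwise fun k => (h.summable.prod_factor k).hasSum
  refine Eq.trans ?_ h5.tsum_eq
  refine tsum_congr fun k => ?_
  rw [timeSeries, smul_eq_mul, ← tsum_mul_left]
  refine tsum_congr fun m => ?_
  rw [← hterm]
  rfl

theorem exists_synth_eq {V : Type*} [NormedAddCommGroup V] [NormedSpace ℂ V]
    [FiniteDimensional ℂ V] {f : ℝ × EuclideanSpace ℝ (Fin d) → V} (hf : ContDiff ℝ ∞ f) {R : ℝ}
    (hR : 0 < R) (hs : tsupport f ⊆ {p | |p.1| < R ∧ ∀ i, |p.2 i| < R}) :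
    ∃ b : (Fin d → ℤ) → ℝ → V, (∀ m, RapidSmooth univ m b) ∧
      ∀ p, |p.1| < R → (∀ i, |p.2 i| < R) → synth (1 / (2 * R)) b p = f p := by
  have : CompleteSpace V := FiniteDimensional.complete ℂ V
  let e := Module.finBasis ℂ V
  let φ : Fin (Module.finrank ℂ V) → V →L[ℂ] ℂ := fun j => LinearMap.toContinuousLinearMap (e.coord j)
  have hφ : ∀ v, ∑ j, φ j v • e j = v := fun v => e.sum_repr v
  choose b hb hbs using fun j => exists_synth_eq_scalar (f := fun p => φ j (f p))
    (((φ j).restrictScalars ℝ).contDiff.comp hf) hR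
    ((closure_mono fun p hp => by
      rw [Function.mem_support] at hp ⊢
      intro h
      exact hp (by rw [h, map_zero])).trans hs)
  have hsm : ∀ j m, RapidSmooth univ m fun k t => b j k t • e j := fun j m =>
    (hb j m).map ((ContinuousLinearMap.id ℂ ℂ).smulRight (e j))
  refine ⟨fun k t => ∑ j, b j k t • e j, fun m => RapidSmooth.sum _ fun j _ => hsm j m,
    fun p h1 h2 => ?_⟩
  rw [← hφ (f p)]
  simp_rw [← hbs _ p h1 h2]
  unfold synth
  simp_rw [Finset.smul_sum]
  rw [Summable.tsum_finsetSum fun j _ => summable_synth _ (hsm j 0).decay (mem_univ _)]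
  refine Finset.sum_congr rfl fun j _ => ?_
  rw [← Summable.tsum_smul_const (summable_synth _ (hb j 0).decay (mem_univ _))]
  simp_rw [smul_assoc]

end Expansion

/-! ### Dyson series for infinite linear systems -/

section Dyson

/-- The factor `1 / (n + 1)` gained by integrating a power produces the factorials of the Dyson
series; negative times are reduced to positive ones by reflection. -/
theorem norm_integral_le_of_norm_le_abs_pow {H : Type*} [NormedAddCommGroup H] [NormedSpace ℝ H]
    {f : ℝ → H} {A : ℝ} {n : ℕ} (hf : ∀ r, ‖f r‖ ≤ A * |r| ^ n) (t : ℝ) :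
    ‖∫ r in (0 : ℝ)..t, f r‖ ≤ A * |t| ^ (n + 1) / (n + 1) := by
  have key : ∀ {f : ℝ → H}, (∀ r, ‖f r‖ ≤ A * |r| ^ n) → ∀ t, 0 ≤ t →
      ‖∫ r in (0 : ℝ)..t, f r‖ ≤ A * |t| ^ (n + 1) / (n + 1) := by
    intro f hf t ht
    have h1 := intervalIntegral.norm_integral_le_of_norm_le (f := f) (g := fun r => A * r ^ n)
      (μ := MeasureTheory.volume) ht (Filter.Eventually.of_forall fun r hr => by
        simpa [abs_of_pos hr.1] using hf r) ((by fun_prop : Continuous fun r : ℝ => A * r ^ n).intervalIntegrable _ _)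
    rw [intervalIntegral.integral_const_mul, integral_pow] at h1
    rw [abs_of_nonneg ht]
    refine h1.trans (le_of_eq ?_)
    simp; ring
  rcases le_total 0 t with ht | ht
  · exact key hf t ht
  · have h1 := key (f := fun r => f (-r)) (fun r => by simpa using hf (-r)) (-t) (by linarith)
    rw [intervalIntegral.integral_comp_neg, neg_zero, neg_neg, intervalIntegral.integral_symm,
      norm_neg, abs_neg] at h1
    exact h1

variable {ι H : Type*} [NormedAddCommGroup H] [NormedSpace ℂ H]

/-- The terms of the Dyson series of `V_i' = ∑_j K_ij V_j + g_i`, `V(0) = 0`. -/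
def dysonTerm (K : ι → ι → ℝ → H →L[ℂ] H) (g : ι → ℝ → H) : ℕ → ι → ℝ → H
  | 0 => fun i t => ∫ r in (0 : ℝ)..t, g i r
  | n + 1 => fun i t => ∫ r in (0 : ℝ)..t, ∑' j, K i j r (dysonTerm K g n j r)

/-- Picard iteration. The hypothesis `hS` is a Schur test saying that the kernel preserves decay of
every order `s`, so the `n`-th term is at most `M C^n |t|^(n+1) / (n+1)!` times `(ρ i ^ s)⁻¹`. The
series therefore converges for all times, and its sum decays in every weight. -/
theorem exists_solution_infinite_system [CompleteSpace H] {ρ : ι → ℝ} (hρ : ∀ i, 1 ≤ ρ i)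
    {K : ι → ι → ℝ → H →L[ℂ] H} {g : ι → ℝ → H} (hK : ∀ i j, Continuous (K i j))
    (hg : ∀ i, Continuous (g i)) {κ : ι → ι → ℝ} (hκ : ∀ i j t, ‖K i j t‖ ≤ κ i j)
    (hS : ∀ s : ℕ, ∃ C, 0 ≤ C ∧ ∀ i, Summable (fun j => κ i j * (ρ j ^ s)⁻¹) ∧
      ∑' j, κ i j * (ρ j ^ s)⁻¹ ≤ C * (ρ i ^ s)⁻¹)
    (hgs : ∀ s : ℕ, ∃ M, 0 ≤ M ∧ ∀ i t, ‖g i t‖ ≤ M * (ρ i ^ s)⁻¹) :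
    ∃ V : ι → ℝ → H, (∀ i, V i 0 = 0) ∧
      (∀ i t, HasDerivAt (V i) (∑' j, K i j t (V j t) + g i t) t) ∧
      ∀ (s : ℕ) (τ : ℝ), ∃ C, 0 ≤ C ∧ ∀ i t, |t| ≤ τ → ‖V i t‖ ≤ C * (ρ i ^ s)⁻¹ := by
  set Vn := dysonTerm K g with hVn
  have hκ0 : ∀ i j, 0 ≤ κ i j := fun i j => (norm_nonneg _).trans (hκ i j 0)
  have hρ0 : ∀ i, 0 < ρ i := fun i => zero_lt_one.trans_le (hρ i)
  -- bounds of the terms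
  have hbd : ∀ s : ℕ, ∃ M C, 0 ≤ M ∧ 0 ≤ C ∧ (∀ i, Summable (fun j => κ i j * (ρ j ^ s)⁻¹) ∧
      ∑' j, κ i j * (ρ j ^ s)⁻¹ ≤ C * (ρ i ^ s)⁻¹) ∧ ∀ n i t,
      ‖Vn n i t‖ ≤ M * C ^ n * |t| ^ (n + 1) / (n + 1).factorial * (ρ i ^ s)⁻¹ := by
    intro s
    obtain ⟨C, hC0, hC⟩ := hS s
    obtain ⟨M, hM0, hM⟩ := hgs s
    refine ⟨M, C, hM0, hC0, hC, fun n => ?_⟩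
    induction n with
    | zero =>
      intro i t
      have := norm_integral_le_of_norm_le_abs_pow (f := g i) (n := 0) (A := M * (ρ i ^ s)⁻¹)
        (fun r => by simpa using hM i r) t
      refine this.trans (le_of_eq ?_)
      simp; ring
    | succ n ih =>
      intro i t
      have := norm_integral_le_of_norm_le_abs_pow (f := fun r => ∑' j, K i j r (Vn n j r))
        (n := n + 1) (A := M * C ^ (n + 1) / (n + 1).factorial * (ρ i ^ s)⁻¹)
        (fun r => ?_) t
      · refine this.trans (le_of_eq ?_)
        rw [Nat.factorial_succ (n + 1)]
        push_cast
        field_simp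
      · set a := M * C ^ n * |r| ^ (n + 1) / (n + 1).factorial with ha
        have ha0 : 0 ≤ a := by positivity
        calc ‖∑' j, K i j r (Vn n j r)‖ ≤ ∑' j, a * (κ i j * (ρ j ^ s)⁻¹) := by
              refine tsum_of_norm_bounded ((hC i).1.mul_left a).hasSum fun j => ?_
              calc ‖K i j r (Vn n j r)‖ ≤ κ i j * (a * (ρ j ^ s)⁻¹) :=
                    (ContinuousLinearMap.le_opNorm _ _).trans
                      (mul_le_mul (hκ i j r) (ih j r) (norm_nonneg _) (hκ0 i j))
                _ = _ := by ring
          _ ≤ a * (C * (ρ i ^ s)⁻¹) := by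
              rw [tsum_mul_left]
              exact mul_le_mul_of_nonneg_left (hC i).2 ha0
          _ = _ := by rw [ha]; ring
  -- simpler bounds for bounded times
  have hbd' : ∀ (s : ℕ) (τ : ℝ), 0 ≤ τ → ∃ a : ℕ → ℝ, (∀ n, 0 ≤ a n) ∧ Summable a ∧ ∀ n i t,
      |t| ≤ τ → ‖Vn n i t‖ ≤ a n * (ρ i ^ s)⁻¹ := by
    intro s τ hτ
    obtain ⟨M, C, hM, hC, -, h⟩ := hbd s
    refine ⟨fun n => M * τ * ((C * τ) ^ n / n.factorial), fun n => by positivity,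
      (Real.summable_pow_div_factorial _).mul_left _, fun n i t ht => (h n i t).trans ?_⟩
    have := hρ0 i
    gcongr
    calc M * C ^ n * |t| ^ (n + 1) / (n + 1).factorial
        ≤ M * C ^ n * τ ^ (n + 1) / n.factorial := by
          gcongr
          exact Nat.le_succ n
      _ = M * τ * ((C * τ) ^ n / n.factorial) := by rw [mul_pow]; ring
  have hstep : ∀ n, (∀ i, Continuous (Vn n i)) →
      ∀ i, Continuous fun r => ∑' j, K i j r (Vn n j r) := by
    intro n hcont i
    rw [continuous_iff_continuousAt]
    intro t
    obtain ⟨a, -, -, h⟩ := hbd' 0 (|t| + 1) (by positivity)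
    obtain ⟨C, -, hC⟩ := hS 0
    have hco : ContinuousOn (fun r => ∑' j, K i j r (Vn n j r)) (Icc (-(|t| + 1)) (|t| + 1)) := by
      refine continuousOn_tsum (fun j => ((hK i j).clm_apply (hcont j)).continuousOn)
        ((hC i).1.mul_left (a n)) fun j r hr => ?_
      calc ‖K i j r (Vn n j r)‖ ≤ κ i j * (a n * (ρ j ^ 0)⁻¹) :=
            (ContinuousLinearMap.le_opNorm _ _).trans
              (mul_le_mul (hκ i j r) (h n j r (abs_le.2 hr)) (norm_nonneg _) (hκ0 i j))
        _ = _ := by ring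
    refine hco.continuousAt (Icc_mem_nhds ?_ ?_)
    · linarith [neg_abs_le t]
    · linarith [le_abs_self t]
  have hcont : ∀ n i, Continuous (Vn n i) := by
    intro n
    induction n with
    | zero =>
      intro i
      exact intervalIntegral.continuous_primitive (fun a b => (hg i).intervalIntegrable a b) 0
    | succ n ih =>
      intro i
      exact intervalIntegral.continuous_primitive (fun a b => (hstep n ih i).intervalIntegrable a b) 0
  have hcontS := fun n => hstep n (hcont n)
  have hsumV : ∀ i t, Summable fun n => Vn n i t := by
    intro i t
    obtain ⟨a, -, hs, h⟩ := hbd' 0 |t| (abs_nonneg t)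
    exact (hs.mul_right _).of_norm_bounded fun n => h n i t le_rfl
  refine ⟨fun i t => ∑' n, Vn n i t, fun i => ?_, fun i t => ?_, fun s τ => ?_⟩
  · have : ∀ n, Vn n i 0 = 0 := fun n => by cases n <;> simp [hVn, dysonTerm]
    simp [this]
  -- The term of index `n + 1` has as derivative the kernel applied to the term of index `n`, so
  -- differentiating the series reproduces the kernel applied to the whole sum; the term of index
  -- `0` contributes `g`.
  · have hsplit : (fun t => ∑' n, Vn n i t) = fun t => Vn 0 i t + ∑' n, Vn (n + 1) i t := by
      ext t; exact (hsumV i t).tsum_eq_zero_add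
    have h0 : HasDerivAt (Vn 0 i) (g i t) t :=
      intervalIntegral.integral_hasDerivAt_right ((hg i).intervalIntegrable _ _)
        ((hg i).stronglyMeasurableAtFilter _ _) (hg i).continuousAt
    obtain ⟨a, ha0, hs, h⟩ := hbd' 0 (|t| + 1) (by positivity)
    obtain ⟨C, hC0, hC⟩ := hS 0
    have hterm : ∀ n j r, |r| ≤ |t| + 1 → ‖K i j r (Vn n j r)‖ ≤ a n * (κ i j * (ρ j ^ 0)⁻¹) := by
      intro n j r hr
      calc ‖K i j r (Vn n j r)‖ ≤ κ i j * (a n * (ρ j ^ 0)⁻¹) :=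
            (ContinuousLinearMap.le_opNorm _ _).trans
              (mul_le_mul (hκ i j r) (h n j r hr) (norm_nonneg _) (hκ0 i j))
        _ = _ := by ring
    have h1 : HasDerivAt (fun t => ∑' n, Vn (n + 1) i t) (∑' n, ∑' j, K i j t (Vn n j t)) t := by
      have ht : t ∈ Ioo (-(|t| + 1)) (|t| + 1) :=
        ⟨by linarith [neg_abs_le t], by linarith [le_abs_self t]⟩
      refine hasDerivAt_tsum_of_isPreconnected (u := fun n => a n * (C * (ρ i ^ 0)⁻¹))
        (g' := fun n t => ∑' j, K i j t (Vn n j t)) (hs.mul_right _) isOpen_Ioo isPreconnected_Ioo (fun n r _ => ?_) (fun n r hr => ?_) ht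
        ((summable_nat_add_iff 1).2 (hsumV i t)) ht
      · exact intervalIntegral.integral_hasDerivAt_right ((hcontS n i).intervalIntegrable _ _)
          ((hcontS n i).stronglyMeasurableAtFilter _ _) (hcontS n i).continuousAt
      · refine (tsum_of_norm_bounded ((hC i).1.mul_left (a n)).hasSum fun j =>
          hterm n j r (abs_lt.2 hr).le).trans ?_
        rw [tsum_mul_left]
        exact mul_le_mul_of_nonneg_left (hC i).2 (ha0 n)
    have h2 : ∑' n, ∑' j, K i j t (Vn n j t) = ∑' j, K i j t (∑' n, Vn n j t) := by
      have hpr : Summable (Function.uncurry fun n j => K i j t (Vn n j t)) := by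
        refine (hs.mul_of_nonneg (hC i).1 ha0 fun j => ?_).of_norm_bounded fun q =>
          hterm q.1 q.2 t (by linarith)
        have := hρ0 j
        exact mul_nonneg (hκ0 i j) (by positivity)
      refine (Summable.tsum_comm (f := fun n j => K i j t (Vn n j t)) hpr).symm.trans ?_
      exact tsum_congr fun j => ((K i j t).map_tsum (hsumV j t)).symm
    have h3 : HasDerivAt (fun t => ∑' n, Vn n i t)
        (g i t + ∑' n, ∑' j, K i j t (Vn n j t)) t := by
      rw [hsplit]; exact h0.add h1
    refine h3.congr_deriv ?_
    rw [h2, add_comm]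
  · obtain ⟨a, ha0, hs, h⟩ := hbd' s |τ| (abs_nonneg τ)
    refine ⟨∑' n, a n, tsum_nonneg ha0, fun i t ht => ?_⟩
    rw [← tsum_mul_right]
    exact tsum_of_norm_bounded (hs.mul_right _).hasSum fun n =>
      h n i t (ht.trans (le_abs_self τ))

end Dyson

/-! ### First order systems in Fourier variables -/

section System

variable {d : ℕ} {σ α H : Type*} [Fintype σ] [Fintype α]
  [NormedAddCommGroup H] [NormedSpace ℂ H] [CompleteSpace H]

theorem RapidSmooth.continuous {E : Type*} [NormedAddCommGroup E] [NormedSpace ℂ E] {m : ℕ}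
    {F : (Fin d → ℤ) → ℝ → E} (h : RapidSmooth univ m F) (k : Fin d → ℤ) : Continuous (F k) :=
  continuousOn_univ.1 (h.decay.1 k)

/-- A kernel `B (k - l)` with rapidly decaying `B` satisfies the Schur condition in all weights. -/
theorem schur_of_rapid {B : (Fin d → ℤ) → ℝ} (hB0 : ∀ k, 0 ≤ B k)
    (hB : ∀ s : ℕ, ∃ C, ∀ k, B k * bracket k ^ s ≤ C) (s : ℕ) :
    ∃ C, 0 ≤ C ∧ ∀ k : Fin d → ℤ,
      Summable (fun j : σ × (Fin d → ℤ) => B (k - j.2) * (bracket j.2 ^ s)⁻¹) ∧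
      ∑' j : σ × (Fin d → ℤ), B (k - j.2) * (bracket j.2 ^ s)⁻¹ ≤ C * (bracket k ^ s)⁻¹ := by
  obtain ⟨C, hC⟩ := hB (2 * d + s)
  have hC0 : 0 ≤ C := by
    have := bracket_pos (0 : Fin d → ℤ)
    exact (mul_nonneg (hB0 0) (by positivity)).trans (hC 0)
  let Z : σ × (Fin d → ℤ) → ℝ := fun j => (bracket j.2 ^ (2 * d))⁻¹
  have hZ : Summable Z := by
    have h1 : Summable fun _ : σ => (1 : ℝ) := (hasSum_fintype _).summable
    refine (h1.mul_of_nonneg (summable_bracket_inv d) (fun _ => zero_le_one) fun k => ?_).congr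
      fun j => ?_
    · have := bracket_pos k; positivity
    · simp [Z]
  have hZ0 : ∀ j, 0 ≤ Z j := fun j => by
    have := bracket_pos j.2
    simp only [Z]; positivity
  refine ⟨C * ∑' j, Z j, mul_nonneg hC0 (tsum_nonneg hZ0), fun k => ?_⟩
  -- The bijection `l ↦ k - l` of the lattice turns the dominating sum into one that does not depend
  -- on `k`.
  let e : σ × (Fin d → ℤ) ≃ σ × (Fin d → ℤ) :=
    Equiv.prodCongr (Equiv.refl σ) (Equiv.subLeft k)
  have hZe : Summable fun j => Z (e j) := e.summable_iff.2 hZ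
  have hle : ∀ j : σ × (Fin d → ℤ), B (k - j.2) * (bracket j.2 ^ s)⁻¹ ≤
      (C * (bracket k ^ s)⁻¹) * Z (e j) := by
    intro j
    have h1 := bracket_pos k
    have h2 := bracket_pos j.2
    have h3 := bracket_pos (k - j.2)
    have h4 : bracket k ^ s ≤ bracket (k - j.2) ^ s * bracket j.2 ^ s := by
      rw [← mul_pow]; exact pow_le_pow_left₀ h1.le (bracket_le_mul k j.2) s
    have h5 : Z (e j) = (bracket (k - j.2) ^ (2 * d))⁻¹ := rfl
    have h6 := hC (k - j.2)
    have h7 := hB0 (k - j.2)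
    rw [h5, mul_assoc, ← mul_inv, ← div_eq_mul_inv, ← div_eq_mul_inv,
      div_le_div_iff₀ (by positivity) (by positivity)]
    calc B (k - j.2) * (bracket k ^ s * bracket (k - j.2) ^ (2 * d))
        ≤ B (k - j.2) * ((bracket (k - j.2) ^ s * bracket j.2 ^ s) *
            bracket (k - j.2) ^ (2 * d)) := by gcongr
      _ = (B (k - j.2) * bracket (k - j.2) ^ (2 * d + s)) * bracket j.2 ^ s := by ring
      _ ≤ C * bracket j.2 ^ s := by gcongr
  have hs : Summable (fun j : σ × (Fin d → ℤ) => B (k - j.2) * (bracket j.2 ^ s)⁻¹) :=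
    (hZe.mul_left _).of_nonneg_of_le (fun j => by
      have h2 := bracket_pos j.2
      exact mul_nonneg (hB0 _) (by positivity)) hle
  refine ⟨hs, (hs.tsum_le_tsum hle (hZe.mul_left _)).trans (le_of_eq ?_)⟩
  rw [tsum_mul_left, e.tsum_eq Z]
  ring

/-- The Dyson argument needs kernel bounds free of time; the supremum over all times provides them
without loss of decay. -/
theorem exists_sup_bound {E : Type*} [NormedAddCommGroup E] [NormedSpace ℂ E]
    {F : (Fin d → ℤ) → ℝ → E} (hF : RapidDecay univ F) :
    ∃ β : (Fin d → ℤ) → ℝ, (∀ k t, ‖F k t‖ ≤ β k) ∧ ∀ s : ℕ, ∃ C, ∀ k, β k * bracket k ^ s ≤ C := by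
  refine ⟨fun k => ⨆ t, ‖F k t‖, fun k t => ?_, fun s => ?_⟩
  · obtain ⟨C, hC⟩ := hF.2 0
    exact le_ciSup (f := fun t => ‖F k t‖) ⟨C, by
      rintro _ ⟨t, rfl⟩; simpa using hC k t (mem_univ _)⟩ t
  · obtain ⟨C, hC⟩ := hF.2 s
    refine ⟨C, fun k => ?_⟩
    have := bracket_pos k
    rw [← le_div_iff₀ (by positivity)]
    refine ciSup_le fun t => ?_
    rw [le_div_iff₀ (by positivity)]
    exact hC k t (mem_univ _)

/-- Smooth rapidly decaying solutions of the Fourier transformed first order systems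
`W_s' = iλ_s W_s + ∑_a b_a ⋆ (∑_{s'} c_{a,s'} W_{s'}) + g`, `W(0) = 0`. -/
theorem exists_rapidSmooth_solution {lam : σ → (Fin d → ℤ) → ℝ} {Cl : ℝ}
    (hlam : ∀ s k, |lam s k| ≤ Cl * bracket k ^ 1) {c : α → σ → (Fin d → ℤ) → ℂ} {Cc : ℝ}
    (hc : ∀ a s k, ‖c a s k‖ ≤ Cc) {b : α → (Fin d → ℤ) → ℝ → H →L[ℂ] H}
    (hb : ∀ a m, RapidSmooth univ m (b a)) {g : (Fin d → ℤ) → ℝ → H}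
    (hg : ∀ m, RapidSmooth univ m g) (τ : ℝ) :
    ∃ W : σ → (Fin d → ℤ) → ℝ → H, (∀ s k, W s k 0 = 0) ∧
      (∀ s m, RapidSmooth (Ioo (-τ) τ) m (W s)) ∧
      ∀ s k, ∀ t ∈ Ioo (-τ) τ, HasDerivAt (W s k) ((Complex.I * (lam s k : ℂ)) • W s k t +
        (∑ a, latticeConv (b a) (fun l t => ∑ s', c a s' l • W s' l t) k t + g k t)) t := by
  choose β hβ hβr using fun a => exists_sup_bound (hb a 0).decay
  -- Interaction picture: writing `W = exp(iλt) V` removes the diagonal term, which is unbounded in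
  -- `k`, at the cost of unimodular factors in the kernel that do not change its bounds.
  let ph : σ → (Fin d → ℤ) → ℝ → ℂ := fun s k t => Complex.exp (Complex.I * (lam s k : ℂ) * t)
  have hph : ∀ s k t, ‖ph s k t‖ = 1 := fun s k t => norm_exp_I_mul_real_mul _ _
  have hph_inv : ∀ s k t, ph s k t * ph s k (-t) = 1 := fun s k t => by
    simp only [ph]; rw [← Complex.exp_add]; simp
  have hphc : ∀ s k, Continuous (ph s k) := fun s k => by fun_prop
  let T : σ → (Fin d → ℤ) → (Fin d → ℤ) → ℝ → H →L[ℂ] H := fun s' k l t =>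
    ∑ a, c a s' l • b a (k - l) t
  let K : σ × (Fin d → ℤ) → σ × (Fin d → ℤ) → ℝ → H →L[ℂ] H := fun i j t =>
    (ph i.1 i.2 (-t) * ph j.1 j.2 t) • T j.1 i.2 j.2 t
  let B : (Fin d → ℤ) → ℝ := fun k => ∑ a, |Cc| * β a k
  have hβ0 : ∀ a k, 0 ≤ β a k := fun a k => (norm_nonneg _).trans (hβ a k 0)
  have hB0 : ∀ k, 0 ≤ B k := fun k =>
    Finset.sum_nonneg fun a _ => mul_nonneg (abs_nonneg _) (hβ0 a k)
  have hBr : ∀ s : ℕ, ∃ C, ∀ k, B k * bracket k ^ s ≤ C := by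
    intro s
    choose C hC using fun a => hβr a s
    refine ⟨∑ a, |Cc| * C a, fun k => ?_⟩
    rw [Finset.sum_mul]
    refine Finset.sum_le_sum fun a _ => ?_
    rw [mul_assoc]
    exact mul_le_mul_of_nonneg_left (hC a k) (abs_nonneg _)
  have hT : ∀ s' k l t, ‖T s' k l t‖ ≤ B (k - l) := fun s' k l t => by
    refine (norm_sum_le _ _).trans (Finset.sum_le_sum fun a _ => ?_)
    rw [norm_smul]
    exact mul_le_mul ((hc a s' l).trans (le_abs_self _)) (hβ a _ t) (norm_nonneg _) (abs_nonneg _)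
  have hK : ∀ i j t, ‖K i j t‖ ≤ B (i.2 - j.2) := fun i j t => by
    rw [norm_smul, norm_mul, hph, hph, one_mul, one_mul]
    exact hT _ _ _ _
  have hKc : ∀ i j, Continuous (K i j) := fun i j => by
    refine Continuous.smul (((hphc _ _).comp continuous_neg).mul (hphc _ _)) ?_
    refine continuous_finsetSum _ fun a _ => ?_
    have h := ((hb a 0).continuous (i.2 - j.2)).const_smul (c a j.1 j.2)
    exact h
  have hgd := (hg 0).decay
  obtain ⟨V, hV0, hVd, hVb⟩ := exists_solution_infinite_system
    (ρ := fun i : σ × (Fin d → ℤ) => bracket i.2) (fun i => one_le_bracket i.2) (K := K)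
    (g := fun i t => ph i.1 i.2 (-t) • g i.2 t) hKc
    (fun i => ((hphc _ _).comp continuous_neg).smul ((hg 0).continuous _))
    (κ := fun i j => B (i.2 - j.2)) hK
    (fun s => by
      obtain ⟨C, h0, h⟩ := schur_of_rapid (σ := σ) hB0 hBr s
      exact ⟨C, h0, fun i => h i.2⟩)
    (fun s => by
      obtain ⟨C, h0, h⟩ := hgd.norm_le s
      refine ⟨C, h0, fun i t => ?_⟩
      rw [norm_smul, hph, one_mul]
      exact h _ _ (mem_univ _))
  let W : σ → (Fin d → ℤ) → ℝ → H := fun s k t => ph s k t • V (s, k) t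
  have hVc : ∀ i, Continuous (V i) := fun i =>
    continuous_iff_continuousAt.2 fun t => (hVd i t).continuousAt
  have hWd : ∀ s, RapidDecay (Ioo (-τ) τ) (W s) := fun s => by
    refine ⟨fun k => ((hphc s k).smul (hVc _)).continuousOn, fun q => ?_⟩
    obtain ⟨C, -, hC⟩ := hVb q τ
    refine ⟨C, fun k t ht => ?_⟩
    have := bracket_pos k
    rw [norm_smul, hph, one_mul, ← le_div_iff₀ (by positivity), div_eq_mul_inv]
    exact hC (s, k) t (abs_lt.2 ht).le
  have hder : ∀ s k, ∀ t ∈ Ioo (-τ) τ, HasDerivAt (W s k) ((Complex.I * (lam s k : ℂ)) • W s k t +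
        (∑ a, latticeConv (b a) (fun l t => ∑ s', c a s' l • W s' l t) k t + g k t)) t := by
    intro s k t ht
    have h1 : HasDerivAt (ph s k) (Complex.I * lam s k * ph s k t) t :=
      hasDerivAt_exp_I_mul_real_mul _ t
    refine (h1.smul (hVd (s, k) t)).congr_deriv ?_
    have hterm : ∀ j : σ × (Fin d → ℤ), ph s k t • K (s, k) j t (V j t) =
        T j.1 k j.2 t (W j.1 j.2 t) := by
      intro j
      simp only [K, W, smul_apply, map_smul, smul_smul]
      rw [← mul_assoc, hph_inv, one_mul]
    have hsm : Summable fun j : σ × (Fin d → ℤ) => K (s, k) j t (V j t) := by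
      obtain ⟨C, -, hC⟩ := hVb 0 τ
      obtain ⟨C', -, h⟩ := schur_of_rapid (σ := σ) hB0 hBr 0
      refine ((h k).1.mul_left C).of_norm_bounded fun j => ?_
      calc ‖K (s, k) j t (V j t)‖ ≤ B (k - j.2) * (C * (bracket j.2 ^ 0)⁻¹) :=
            (ContinuousLinearMap.le_opNorm _ _).trans
              (mul_le_mul (hK _ j t) (hC j t (abs_lt.2 ht).le) (norm_nonneg _) (hB0 _))
        _ = _ := by ring
    have hsm' : ∀ a s', Summable fun l => b a (k - l) t (c a s' l • W s' l t) := fun a s' => by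
      have h2 : RapidDecay (Ioo (-τ) τ) fun l t => c a s' l • W s' l t :=
        RapidSmooth.smul (m := 0) (hWd s') (c a s') (C := Cc) (q := 0) (by simpa using hc a s')
      exact summable_conv ((hb a 0).decay.mono (subset_univ _)) h2 k ht
    have hconv : ph s k t • ∑' j, K (s, k) j t (V j t) =
        ∑ a, latticeConv (b a) (fun l t => ∑ s', c a s' l • W s' l t) k t := by
      have hsmT : Summable fun j : σ × (Fin d → ℤ) => T j.1 k j.2 t (W j.1 j.2 t) :=
        (hsm.const_smul (ph s k t)).congr fun j => hterm j
      rw [← Summable.tsum_const_smul _ hsm]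
      simp_rw [hterm]
      rw [hsmT.tsum_prod, tsum_fintype]
      simp only [T, latticeConv, sum_apply, smul_apply, map_sum]
      have e1 : ∀ s', ∑' l, ∑ a, c a s' l • (b a (k - l) t) (W s' l t) =
          ∑ a, ∑' l, b a (k - l) t (c a s' l • W s' l t) := fun s' => by
        rw [← Summable.tsum_finsetSum fun a _ => hsm' a s']
        simp_rw [map_smul]
      simp_rw [e1]
      rw [Finset.sum_comm]
      refine Finset.sum_congr rfl fun a _ => ?_
      rw [Summable.tsum_finsetSum fun s' _ => hsm' a s']
    rw [smul_add, hconv, smul_smul, hph_inv, one_smul, add_comm]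
    simp only [W, smul_smul]
  refine ⟨W, fun s k => by simp [W, hV0], fun s m => ?_, hder⟩
  -- Time regularity is read off the equation: `W'` is expressed through `W`, a convolution and the
  -- data, and the factor `λ` costs only one power of the weight.
  induction m generalizing s with
  | zero => exact hWd s
  | succ m ih =>
    refine ⟨hWd s, _, hder s, ?_⟩
    refine RapidSmooth.add ?_ (RapidSmooth.add (RapidSmooth.sum _ fun a _ => ?_)
      ((hg m).mono (subset_univ _)))
    · refine (ih s).smul (fun k => Complex.I * (lam s k : ℂ)) (C := Cl) (q := 1) fun k => ?_
      rw [norm_mul, Complex.norm_I, one_mul, Complex.norm_real]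
      exact hlam s k
    · refine RapidSmooth.conv isOpen_Ioo isPreconnected_Ioo ((hb a m).mono (subset_univ _)) ?_
      exact RapidSmooth.sum _ fun s' _ =>
        (ih s').smul (c a s') (C := Cc) (q := 0) (by simpa using hc a s')

end System

/-! ### Linear operations on Fourier series -/

section SynthAlgebra

variable {d : ℕ} {E E₁ : Type*} [NormedAddCommGroup E] [NormedSpace ℂ E] [CompleteSpace E]
  [NormedAddCommGroup E₁] [NormedSpace ℂ E₁] [CompleteSpace E₁]

theorem synth_add (ε : ℝ) {J : Set ℝ} {F G : (Fin d → ℤ) → ℝ → E} (hF : RapidDecay J F)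
    (hG : RapidDecay J G) {p : ℝ × EuclideanSpace ℝ (Fin d)} (hp : p.1 ∈ J) :
    synth ε (fun k t => F k t + G k t) p = synth ε F p + synth ε G p := by
  unfold synth
  rw [← (summable_synth ε hF hp).tsum_add (summable_synth ε hG hp)]
  simp_rw [smul_add]

theorem synth_sum (ε : ℝ) {J : Set ℝ} {α : Type*} (S : Finset α) {F : α → (Fin d → ℤ) → ℝ → E}
    (hF : ∀ a ∈ S, RapidDecay J (F a)) {p : ℝ × EuclideanSpace ℝ (Fin d)} (hp : p.1 ∈ J) :
    synth ε (fun k t => ∑ a ∈ S, F a k t) p = ∑ a ∈ S, synth ε (F a) p := by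
  unfold synth
  rw [← Summable.tsum_finsetSum fun a ha => summable_synth ε (hF a ha) hp]
  simp_rw [Finset.smul_sum]

theorem synth_map (ε : ℝ) {J : Set ℝ} {F : (Fin d → ℤ) → ℝ → E} (hF : RapidDecay J F)
    (A : E →L[ℂ] E₁) {p : ℝ × EuclideanSpace ℝ (Fin d)} (hp : p.1 ∈ J) :
    synth ε (fun k t => A (F k t)) p = A (synth ε F p) := by
  unfold synth
  rw [A.map_tsum (summable_synth ε hF hp)]
  simp_rw [map_smul]

theorem synth_time_deriv (ε : ℝ) {J : Set ℝ} (hJo : IsOpen J) (hJ : IsPreconnected J)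
    {F F' : (Fin d → ℤ) → ℝ → E} (hF : RapidDecay J F)
    (hF' : RapidDecay J F') (hder : ∀ k, ∀ t ∈ J, HasDerivAt (F k) (F' k t) t)
    {p : ℝ × EuclideanSpace ℝ (Fin d)} (hp : p.1 ∈ J) :
    fderiv ℝ (synth ε F) p (1, 0) = synth ε F' p := by
  rw [(hasFDerivAt_synth ε hJo hJ hF hF' hder hp).fderiv]
  simp

theorem synth_space_deriv (ε : ℝ) {J : Set ℝ} (hJo : IsOpen J) (hJ : IsPreconnected J)
    {F F' : (Fin d → ℤ) → ℝ → E} (hF : RapidDecay J F)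
    (hF' : RapidDecay J F') (hder : ∀ k, ∀ t ∈ J, HasDerivAt (F k) (F' k t) t)
    {p : ℝ × EuclideanSpace ℝ (Fin d)} (hp : p.1 ∈ J) (i : Fin d) :
    fderiv ℝ (synth ε F) p (0, EuclideanSpace.single i 1) = synth ε (freqMul ε i F) p := by
  rw [(hasFDerivAt_synth ε hJo hJ hF hF' hder hp).fderiv]
  simp [sum_apply]

/-- The Fourier coefficients of a constant. -/
theorem exists_synth_const (ε : ℝ) (v : E) :
    ∃ b : (Fin d → ℤ) → ℝ → E, (∀ m, RapidSmooth univ m b) ∧ ∀ p, synth ε b p = v := by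
  classical
  let b : (Fin d → ℤ) → ℝ → E := fun k _ => if k = 0 then v else 0
  have key : ∀ w : E, RapidDecay univ fun (k : Fin d → ℤ) (_ : ℝ) => if k = 0 then w else 0 := by
    refine fun w => ⟨fun k => continuousOn_const, fun s => ⟨‖w‖, fun k t _ => ?_⟩⟩
    beta_reduce
    split_ifs with h
    · simp [h, bracket]
    · simp
  refine ⟨b, fun m => ?_, fun p => ?_⟩
  · have : ∀ w : E, RapidSmooth univ m fun (k : Fin d → ℤ) (_ : ℝ) => if k = 0 then w else 0 := by
      induction m with
      | zero => exact key
      | succ m ih =>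
        exact fun w => ⟨key w, fun k _ => if k = 0 then (0 : E) else 0,
          fun k t _ => by simpa using hasDerivAt_const _ _, ih 0⟩
    exact this v
  · unfold synth
    rw [tsum_eq_single 0 fun k hk => by simp [b, hk]]
    simp [b, torusChar, freq_apply]

end SynthAlgebra

/-! ### Linear ordinary differential equations with a spatial parameter -/

section ParametricODE

variable {d : ℕ}

/-- A smooth cutoff on space-time. -/
theorem exists_cutoff {X : Type*} [NormedAddCommGroup X] [NormedSpace ℝ X] [FiniteDimensional ℝ X]
    {R : ℝ} (hR : 0 < R) : ∃ ζ : X → ℝ, ContDiff ℝ ∞ ζ ∧ (∀ p, ‖p‖ ≤ R → ζ p = 1) ∧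
      tsupport ζ ⊆ Metric.closedBall 0 (2 * R) ∧ ∀ p, 0 ≤ ζ p := by
  let ζ : ContDiffBump (0 : X) := ⟨R, 2 * R, hR, by linarith⟩
  refine ⟨ζ, ζ.contDiff, fun p hp => ζ.one_of_mem_closedBall (by simpa using hp), ?_, fun p => ζ.nonneg⟩
  rw [ζ.tsupport_eq]

theorem tsupport_subset_box {E : Type*} [Zero E] [TopologicalSpace E] {R : ℝ} (hR : 0 < R)
    {f : ℝ × EuclideanSpace ℝ (Fin d) → E} (hf : tsupport f ⊆ Metric.closedBall 0 (2 * R)) :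
    tsupport f ⊆ {p | |p.1| < 3 * R ∧ ∀ i, |p.2 i| < 3 * R} := by
  intro p hp
  have h1 : ‖p‖ ≤ 2 * R := by simpa using hf hp
  have h2 : |p.1| ≤ 2 * R := (norm_fst_le p).trans h1
  refine ⟨by linarith, fun i => ?_⟩
  have h3 := (PiLp.norm_apply_le p.2 i).trans ((norm_snd_le p).trans h1)
  rw [Real.norm_eq_abs] at h3
  linarith

variable {H : Type*} [NormedAddCommGroup H] [NormedSpace ℂ H] [FiniteDimensional ℂ H]

/-- The parameter plays the role of the space variable. After a cutoff the coefficient is a Fourier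
series in `x`, and `Y - v₀` solves an infinite system with zero frequencies, zero initial value and
source `M v₀`; smoothness in `(t, x)` comes from summing the series. The equation holds where the
cutoff equals `1`. -/
theorem exists_smooth_parametric_ode {M : ℝ × EuclideanSpace ℝ (Fin d) → H →L[ℂ] H}
    (hM : ContDiff ℝ ∞ M) (v₀ : H) {R : ℝ} (hR : 0 < R) :
    ∃ Y : ℝ × EuclideanSpace ℝ (Fin d) → H, ContDiffOn ℝ ∞ Y (Ioo (-R) R ×ˢ univ) ∧
      (∀ x, Y (0, x) = v₀) ∧ ∀ t x, |t| < R → ‖x‖ < R →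
        HasDerivAt (fun t => Y (t, x)) (M (t, x) (Y (t, x))) t := by
  have : CompleteSpace H := FiniteDimensional.complete ℂ H
  obtain ⟨ζ, hζ, hζ1, hζs, -⟩ := exists_cutoff (X := ℝ × EuclideanSpace ℝ (Fin d)) hR
  obtain ⟨b, hb, hbs⟩ := exists_synth_eq (f := fun p => ζ p • M p) (hζ.smul hM)
    (R := 3 * R) (by positivity)
    (tsupport_subset_box hR ((tsupport_smul_subset_left ζ M).trans hζs))
  set ε := 1 / (2 * (3 * R))
  have hg : ∀ m, RapidSmooth univ m fun k t => b k t v₀ := fun m =>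
    (hb m).map (ContinuousLinearMap.apply ℂ H v₀)
  obtain ⟨W, hW0, hWr, hWd⟩ := exists_rapidSmooth_solution (σ := Unit) (α := Unit)
    (lam := fun _ _ => 0) (Cl := 0) (by simp) (c := fun _ _ _ => 1) (Cc := 1) (by simp)
    (b := fun _ => b) (fun _ => hb) hg R
  set w := W () with hw
  let G : (Fin d → ℤ) → ℝ → H := fun k t => latticeConv b w k t + b k t v₀
  have hwd : ∀ k, ∀ t ∈ Ioo (-R) R, HasDerivAt (w k) (G k t) t := by
    intro k t ht
    refine (hWd () k t ht).congr_deriv ?_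
    simp [G, hw, latticeConv]
  have hG1 : RapidDecay (Ioo (-R) R) (latticeConv b w) :=
    ((hb 0).decay.mono (subset_univ _)).conv (hWr () 0).decay
  have hG2 : RapidDecay (Ioo (-R) R) fun k t => b k t v₀ := (hg 0).decay.mono (subset_univ _)
  refine ⟨fun p => v₀ + synth ε w p, ?_, fun x => ?_, fun t x ht hx => ?_⟩
  · refine contDiffOn_const.add (contDiffOn_infty.2 fun m => ?_)
    exact contDiffOn_synth ε isOpen_Ioo isPreconnected_Ioo m (hWr () m)
  · simp [synth, hw, hW0]
  · have htI : t ∈ Ioo (-R) R := abs_lt.1 ht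
    have h1 := hasFDerivAt_synth ε isOpen_Ioo isPreconnected_Ioo (hWr () 0).decay (hG1.add hG2) hwd
      (p := (t, x)) htI
    have h2 : HasDerivAt (fun t : ℝ => (t, x)) ((1 : ℝ), (0 : EuclideanSpace ℝ (Fin d))) t :=
      (hasDerivAt_id t).prodMk (hasDerivAt_const t x)
    refine ((h1.comp_hasDerivAt t h2).const_add v₀).congr_deriv ?_
    simp only [add_apply, sum_apply, ContinuousLinearMap.smulRight_apply,
      ContinuousLinearMap.comp_apply, ContinuousLinearMap.coe_fst', ContinuousLinearMap.coe_snd',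
      map_zero, zero_smul, Finset.sum_const_zero, add_zero, one_smul]
    have hsum := synth_add ε hG1 hG2 (p := (t, x)) htI
    rw [hsum, synth_conv ε ((hb 0).decay.mono (subset_univ _)) (hWr () 0).decay htI]
    have h3 : synth ε (fun k t => b k t v₀) (t, x) = synth ε b (t, x) v₀ :=
      synth_map ε (hb 0).decay (ContinuousLinearMap.apply ℂ H v₀) (mem_univ _)
    have h4 : synth ε b (t, x) = M (t, x) := by
      rw [hbs (t, x) (by simp; linarith) fun i => ?_, hζ1 _ ?_, one_smul]
      · exact (max_le ht.le hx.le)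
      · have := PiLp.norm_apply_le x i
        rw [Real.norm_eq_abs] at this
        simp only; linarith
    rw [h3, h4, ← map_add, add_comm]

end ParametricODE

/-! ### The wave equation on a torus -/

section TorusWave

variable {n N : ℕ}

/-- The wave operator with coefficients in the continuous endomorphisms. -/
def waveOpCLM (A : Fin (n + 1) → Spacetime n → (Fin N → ℂ) →L[ℂ] (Fin N → ℂ))
    (Q : Spacetime n → (Fin N → ℂ) →L[ℂ] (Fin N → ℂ)) (u : Spacetime n → Fin N → ℂ) :
    Spacetime n → Fin N → ℂ :=
  fun p =>
    pderiv 0 (pderiv 0 u) p - ∑ i : Fin n, pderiv i.succ (pderiv i.succ u) p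
      + (2 : ℂ) • ∑ j : Fin (n + 1), A j p (pderiv j u p) + Q p (u p)

theorem basisVec_zero : (basisVec 0 : Spacetime n) = (1, 0) := rfl

theorem basisVec_succ (i : Fin n) : (basisVec i.succ : Spacetime n) = (0, EuclideanSpace.single i 1) :=
  rfl

/-- The frequency `Λ_k = (1 + |2π ε k|²)^{1/2}`. -/
def waveFreq (ε : ℝ) (k : Fin n → ℤ) : ℝ := Real.sqrt (1 + ∑ i, (2 * Real.pi * ε * k i) ^ 2)

theorem waveFreq_sq (ε : ℝ) (k : Fin n → ℤ) :
    waveFreq ε k ^ 2 = 1 + ∑ i, (2 * Real.pi * ε * k i) ^ 2 :=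
  Real.sq_sqrt (by have : 0 ≤ ∑ i, (2 * Real.pi * ε * k i) ^ 2 := Finset.sum_nonneg fun i _ => sq_nonneg _
                   linarith)

theorem one_le_waveFreq (ε : ℝ) (k : Fin n → ℤ) : 1 ≤ waveFreq ε k :=
  Real.one_le_sqrt.2 (by have : 0 ≤ ∑ i, (2 * Real.pi * ε * k i) ^ 2 := Finset.sum_nonneg fun i _ => sq_nonneg _
                         linarith)

theorem abs_le_waveFreq (ε : ℝ) (k : Fin n → ℤ) (i : Fin n) :
    |2 * Real.pi * ε * k i| ≤ waveFreq ε k := by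
  refine Real.abs_le_sqrt ?_
  have := Finset.single_le_sum (f := fun i => (2 * Real.pi * ε * k i) ^ 2)
    (fun i _ => sq_nonneg _) (Finset.mem_univ i)
  linarith

theorem waveFreq_le (ε : ℝ) (k : Fin n → ℤ) :
    waveFreq ε k ≤ (1 + n * (2 * Real.pi * ε) ^ 2) * bracket k ^ 1 := by
  have hb := one_le_bracket k
  set C := 1 + n * (2 * Real.pi * ε) ^ 2 with hC
  have hC1 : 1 ≤ C := by rw [hC]; have : 0 ≤ n * (2 * Real.pi * ε) ^ 2 := by positivity
                         linarith
  refine Real.sqrt_le_iff.2 ⟨by positivity, ?_⟩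
  calc 1 + ∑ i, (2 * Real.pi * ε * k i) ^ 2
      ≤ bracket k ^ 2 + ∑ _i : Fin n, (2 * Real.pi * ε) ^ 2 * bracket k ^ 2 := by
        gcongr with i
        · exact one_le_pow₀ hb
        · have h : (k i : ℝ) ^ 2 ≤ bracket k ^ 2 := sq_le_sq'
            (by linarith [neg_abs_le (k i : ℝ), abs_coord_le_bracket k i])
            ((le_abs_self _).trans (abs_coord_le_bracket k i))
          have h2 := mul_le_mul_of_nonneg_left h (sq_nonneg (2 * Real.pi * ε))
          linarith [mul_pow (2 * Real.pi * ε) (k i : ℝ) 2]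
    _ = C * bracket k ^ 2 := by rw [Finset.sum_const, Finset.card_univ, Fintype.card_fin, hC]; simp; ring
    _ ≤ C ^ 2 * bracket k ^ 2 := by gcongr; nlinarith
    _ = _ := by ring

/-- Solutions of the wave equation with periodic coefficients, given by Fourier series. -/
theorem exists_periodic_wave {A : Fin (n + 1) → Spacetime n → (Fin N → ℂ) →L[ℂ] (Fin N → ℂ)}
    {Q : Spacetime n → (Fin N → ℂ) →L[ℂ] (Fin N → ℂ)} {f : Spacetime n → Fin N → ℂ}
    (hA : ∀ j, ContDiff ℝ ∞ (A j)) (hQ : ContDiff ℝ ∞ Q) (hf : ContDiff ℝ ∞ f) {R : ℝ} (hR : 0 < R)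
    (hAs : ∀ j, tsupport (A j) ⊆ {p | |p.1| < R ∧ ∀ i, |p.2 i| < R})
    (hQs : tsupport Q ⊆ {p | |p.1| < R ∧ ∀ i, |p.2 i| < R})
    (hfs : tsupport f ⊆ {p | |p.1| < R ∧ ∀ i, |p.2 i| < R}) :
    ∃ u : Spacetime n → Fin N → ℂ, ContDiffOn ℝ ∞ u (Ioo (-R) R ×ˢ univ) ∧
      (∀ x, u (0, x) = 0) ∧ (∀ x, HasDerivAt (fun t : ℝ => u (t, x)) 0 0) ∧
      ∀ p, |p.1| < R → (∀ i, |p.2 i| < R) → waveOpCLM A Q u p = f p := by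
  set ε := 1 / (2 * R)
  choose bA hbA hbAs using fun j => exists_synth_eq (hA j) hR (hAs j)
  obtain ⟨bQ, hbQ, hbQs⟩ := exists_synth_eq hQ hR hQs
  obtain ⟨g, hg, hgs⟩ := exists_synth_eq hf hR hfs
  obtain ⟨b1, hb1, hb1s⟩ := exists_synth_const (d := n) ε
    (ContinuousLinearMap.id ℂ (Fin N → ℂ))
  let Λ : (Fin n → ℤ) → ℝ := waveFreq ε
  have hΛ1 : ∀ k, 1 ≤ Λ k := one_le_waveFreq ε
  have hΛ0 : ∀ k, (Λ k : ℂ) ≠ 0 := fun k => by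
    have := hΛ1 k
    exact_mod_cast (by linarith : 0 < Λ k).ne'
  let sg : Bool → ℝ := fun s => if s then 1 else -1
  -- Half-wave unknowns: `W_± = ∂_t u ± iΛu` have frequencies `±Λ`, so `u = (W_+ - W_-) / (2iΛ)` and
  -- `∂_t u = (W_+ + W_-) / 2`. The summand `1` in `Λ²` keeps `Λ` invertible at `k = 0`.
  let cu : Bool → (Fin n → ℤ) → ℂ := fun s k => sg s * (2 * Complex.I * Λ k)⁻¹
  have hsg : ∀ s, |sg s| = 1 := fun s => by cases s <;> simp [sg]
  have hcu : ∀ s k, ‖cu s k‖ = (2 * Λ k)⁻¹ := fun s k => by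
    have := hΛ1 k
    simp only [cu, norm_mul, norm_inv, Complex.norm_I, Complex.norm_real, Real.norm_eq_abs, hsg,
      Complex.norm_ofNat]
    rw [abs_of_nonneg (by linarith : 0 ≤ Λ k)]
    simp
  -- Index `none` yields `u`, `some 0` its time derivative, and `some i.succ` its `i`-th space
  -- derivative. All are bounded multipliers of `W_±`, the last because `|2πεk_i| ≤ Λ`.
  let c : Option (Fin (n + 1)) → Bool → (Fin n → ℤ) → ℂ := fun a s k =>
    match a with
    | none => cu s k
    | some j => Fin.cases (1 / 2 : ℂ) (fun i => Complex.I * (2 * Real.pi * ε * k i : ℝ) * cu s k) j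
  have hc : ∀ a s k, ‖c a s k‖ ≤ 1 := by
    have h2 : ∀ k, (2 * Λ k)⁻¹ ≤ 1 := fun k => inv_le_one_of_one_le₀ (by linarith [hΛ1 k])
    intro a s k
    rcases a with _ | j
    · simp only [c, hcu]; exact h2 k
    · refine Fin.cases ?_ (fun i => ?_) j
      · simp only [c, Fin.cases_zero]; norm_num
      · simp only [c, Fin.cases_succ]
        rw [norm_mul, hcu, norm_mul, Complex.norm_I, one_mul, Complex.norm_real, Real.norm_eq_abs,
          ← div_eq_mul_inv, div_le_one (by linarith [hΛ1 k])]
        linarith [abs_le_waveFreq ε k i, hΛ1 k]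
  -- The forcing is `f + u - Qu - 2 ∑ A_j ∂_j u`; the extra `u`, carried by `b1`, compensates the
  -- summand `1` in `Λ²`.
  let b : Option (Fin (n + 1)) → (Fin n → ℤ) → ℝ → (Fin N → ℂ) →L[ℂ] (Fin N → ℂ) := fun a =>
    match a with
    | none => fun k t => b1 k t + (-1 : ℂ) • bQ k t
    | some j => fun k t => (-2 : ℂ) • bA j k t
  have hsm : ∀ (z : ℂ) {B : (Fin n → ℤ) → ℝ → (Fin N → ℂ) →L[ℂ] (Fin N → ℂ)} (m : ℕ),
      RapidSmooth univ m B → RapidSmooth univ m fun k t => z • B k t := fun z B m h =>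
    h.smul (fun _ => z) (C := ‖z‖) (q := 0) (by simp)
  have hb : ∀ a m, RapidSmooth univ m (b a) := by
    rintro (_ | j) m
    · exact (hb1 m).add (hsm _ m (hbQ m))
    · exact hsm _ m (hbA j m)
  obtain ⟨W, hW0, hWr, hWd⟩ := exists_rapidSmooth_solution (σ := Bool)
    (lam := fun s k => sg s * Λ k) (Cl := 1 + n * (2 * Real.pi * ε) ^ 2) (fun s k => by
      rw [abs_mul, hsg, one_mul, abs_of_nonneg (by linarith [hΛ1 k])]
      exact waveFreq_le ε k) (c := c) (Cc := 1) hc hb hg R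
  let uF : (Fin n → ℤ) → ℝ → Fin N → ℂ := fun k t => ∑ s, cu s k • W s k t
  let vF : (Fin n → ℤ) → ℝ → Fin N → ℂ := fun k t => ∑ s, (1 / 2 : ℂ) • W s k t
  let D : Option (Fin (n + 1)) → (Fin n → ℤ) → ℝ → Fin N → ℂ := fun a l t =>
    ∑ s, c a s l • W s l t
  let G : (Fin n → ℤ) → ℝ → Fin N → ℂ := fun k t => ∑ a, latticeConv (b a) (D a) k t + g k t
  have huF : ∀ m, RapidSmooth (Ioo (-R) R) m uF := fun m => RapidSmooth.sum _ fun s _ =>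
    (hWr s m).smul (cu s) (C := 1) (q := 0) fun k => by simpa using hc none s k
  have hvF : ∀ m, RapidSmooth (Ioo (-R) R) m vF := fun m => RapidSmooth.sum _ fun s _ =>
    (hWr s m).smul (fun _ => 1 / 2) (C := 1 / 2) (q := 0) fun k => by simp
  have hD : ∀ a m, RapidSmooth (Ioo (-R) R) m (D a) := fun a m => RapidSmooth.sum _ fun s _ =>
    (hWr s m).smul (c a s) (C := 1) (q := 0) fun k => by simpa using hc a s k
  have hconv : ∀ a m, RapidSmooth (Ioo (-R) R) m (latticeConv (b a) (D a)) := fun a m =>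
    RapidSmooth.conv isOpen_Ioo isPreconnected_Ioo ((hb a m).mono (subset_univ _)) (hD a m)
  have hG : ∀ m, RapidSmooth (Ioo (-R) R) m G := fun m =>
    (RapidSmooth.sum _ fun a _ => hconv a m).add ((hg m).mono (subset_univ _))
  let lapF : (Fin n → ℤ) → ℝ → Fin N → ℂ := fun k t => ∑ i, freqMul ε i (freqMul ε i uF) k t
  have hlapF : ∀ m, RapidSmooth (Ioo (-R) R) m lapF := fun m => RapidSmooth.sum _ fun i _ =>
    ((huF m).freqMul ε i).freqMul ε i
  let v'F : (Fin n → ℤ) → ℝ → Fin N → ℂ := fun k t => lapF k t + ((-1 : ℂ) • uF k t + G k t)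
  have hnegu : ∀ m, RapidSmooth (Ioo (-R) R) m fun k t => (-1 : ℂ) • uF k t := fun m =>
    (huF m).smul (fun _ => -1) (C := 1) (q := 0) (by simp)
  have hv'F : ∀ m, RapidSmooth (Ioo (-R) R) m v'F := fun m =>
    (hlapF m).add ((hnegu m).add (hG m))
  have huv : ∀ k, ∀ t ∈ Ioo (-R) R, HasDerivAt (uF k) (vF k t) t := by
    intro k t ht
    have h1 := fun s => (hWd s k t ht).const_smul (cu s k)
    refine (HasDerivAt.fun_sum fun s (_ : s ∈ (Finset.univ : Finset Bool)) => h1 s).congr_deriv ?_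
    simp only [vF, Fintype.sum_bool, cu, sg]
    have := hΛ0 k
    simp only [if_true, Bool.false_eq_true, if_false, smul_add, smul_smul]
    have e1 : ((1 : ℝ) : ℂ) * (2 * Complex.I * (Λ k : ℂ))⁻¹ *
      (Complex.I * ((1 * Λ k : ℝ) : ℂ)) = 1 / 2 := by
      push_cast; field_simp
    have e2 : ((-1 : ℝ) : ℂ) * (2 * Complex.I * (Λ k : ℂ))⁻¹ *
      (Complex.I * ((-1 * Λ k : ℝ) : ℂ)) = 1 / 2 := by
      push_cast; field_simp
    rw [e1, e2]
    push_cast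
    module
  have hvv : ∀ k, ∀ t ∈ Ioo (-R) R, HasDerivAt (vF k) (v'F k t) t := by
    intro k t ht
    have h1 := fun s => (hWd s k t ht).const_smul (1 / 2 : ℂ)
    refine (HasDerivAt.fun_sum fun s (_ : s ∈ (Finset.univ : Finset Bool)) => h1 s).congr_deriv ?_
    have hlap : lapF k t = (1 - (Λ k : ℂ) ^ 2) • uF k t := by
      simp only [lapF, freqMul, smul_smul]
      rw [← Finset.sum_smul]
      congr 1
      have h2 : (Λ k : ℂ) ^ 2 = ((1 + ∑ i, (2 * Real.pi * ε * k i) ^ 2 : ℝ) : ℂ) := by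
        rw [← waveFreq_sq]; push_cast; rfl
      rw [h2]
      push_cast
      rw [sub_add_cancel_left, ← Finset.sum_neg_distrib]
      refine Finset.sum_congr rfl fun i _ => ?_
      linear_combination (2 * (Real.pi : ℂ) * ε * k i) ^ 2 * Complex.I_sq
    simp only [v'F, hlap]
    have hGk : G k t = ∑ a, latticeConv (b a) (fun l t => ∑ s', c a s' l • W s' l t) k t + g k t := rfl
    rw [← hGk]
    simp only [uF, Fintype.sum_bool, cu, sg]
    have := hΛ0 k
    simp only [if_true, Bool.false_eq_true, if_false, smul_add, smul_smul]
    have e1 : (1 - (Λ k : ℂ) ^ 2) * (((1 : ℝ) : ℂ) * (2 * Complex.I * (Λ k : ℂ))⁻¹) =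
        ((1 : ℝ) : ℂ) * (2 * Complex.I * (Λ k : ℂ))⁻¹ + Complex.I / 2 * Λ k := by
      push_cast; field_simp
      linear_combination (-(Λ k : ℂ) ^ 2) * Complex.I_sq
    have e2 : (1 - (Λ k : ℂ) ^ 2) * (((-1 : ℝ) : ℂ) * (2 * Complex.I * (Λ k : ℂ))⁻¹) =
        ((-1 : ℝ) : ℂ) * (2 * Complex.I * (Λ k : ℂ))⁻¹ - Complex.I / 2 * Λ k := by
      push_cast; field_simp
      linear_combination ((Λ k : ℂ) ^ 2) * Complex.I_sq
    rw [e1, e2]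
    push_cast
    module
  have hJo : IsOpen (Ioo (-R) R) := isOpen_Ioo
  have hJ : IsPreconnected (Ioo (-R) R) := isPreconnected_Ioo
  have hut : ∀ p : Spacetime n, p.1 ∈ Ioo (-R) R → pderiv 0 (synth ε uF) p = synth ε vF p :=
    fun p hp => synth_time_deriv ε hJo hJ (huF 0).decay (hvF 0).decay huv hp
  have hui : ∀ (i : Fin n) (p : Spacetime n), p.1 ∈ Ioo (-R) R →
      pderiv i.succ (synth ε uF) p = synth ε (freqMul ε i uF) p := fun i p hp =>
    synth_space_deriv ε hJo hJ (huF 0).decay (hvF 0).decay huv hp i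
  have hfder : ∀ i k, ∀ t ∈ Ioo (-R) R,
      HasDerivAt (freqMul ε i uF k) (freqMul ε i vF k t) t := fun i k t ht => by
    have h := (huv k t ht).const_smul (Complex.I * ((2 * Real.pi * ε * k i : ℝ) : ℂ))
    exact h
  have hloc : ∀ {F F' : Spacetime n → Fin N → ℂ} (j : Fin (n + 1)) (p : Spacetime n),
      p.1 ∈ Ioo (-R) R → (∀ q : Spacetime n, q.1 ∈ Ioo (-R) R → F q = F' q) →
      pderiv j F p = pderiv j F' p := by
    intro F F' j p hp h
    have : F =ᶠ[nhds p] F' := by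
      filter_upwards [(hJo.preimage continuous_fst).mem_nhds hp] with q hq using h q hq
    unfold pderiv
    rw [this.fderiv_eq]
  refine ⟨synth ε uF, contDiffOn_infty.2 fun m => contDiffOn_synth ε hJo hJ m (huF m), ?_, ?_, ?_⟩
  · intro x; simp [synth, uF, hW0]
  · intro x
    have h0 : (0 : ℝ) ∈ Ioo (-R) R := ⟨by linarith, hR⟩
    have h1 := hasFDerivAt_synth ε hJo hJ (huF 0).decay (hvF 0).decay huv (p := (0, x)) h0
    have h2 : HasDerivAt (fun t : ℝ => (t, x)) ((1 : ℝ), (0 : EuclideanSpace ℝ (Fin n))) 0 :=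
      (hasDerivAt_id 0).prodMk (hasDerivAt_const 0 x)
    refine (h1.comp_hasDerivAt 0 h2).congr_deriv ?_
    have h3 : synth ε vF (0, x) = 0 := by simp [synth, vF, hW0]
    simp [sum_apply, h3]
  · intro p hp1 hp2
    have hp : p.1 ∈ Ioo (-R) R := abs_lt.1 hp1
    have htt : pderiv 0 (pderiv 0 (synth ε uF)) p = synth ε v'F p := by
      rw [hloc 0 p hp hut]
      exact synth_time_deriv ε hJo hJ (hvF 0).decay (hv'F 0).decay hvv hp
    have hii : ∀ i : Fin n, pderiv i.succ (pderiv i.succ (synth ε uF)) p =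
        synth ε (freqMul ε i (freqMul ε i uF)) p := fun i => by
      rw [hloc i.succ p hp (hui i)]
      exact synth_space_deriv ε hJo hJ ((huF 0).freqMul ε i).decay ((hvF 0).freqMul ε i).decay
        (hfder i) hp i
    have hlap : synth ε lapF p = ∑ i, synth ε (freqMul ε i (freqMul ε i uF)) p :=
      synth_sum ε _ (fun i _ => (((huF 0).freqMul ε i).freqMul ε i).decay) hp
    have hv' : synth ε v'F p = synth ε lapF p + (-(synth ε uF p) +
        (∑ a, synth ε (b a) p (synth ε (D a) p) + f p)) := by
      have e1 : synth ε v'F p = synth ε lapF p + synth ε (fun k t => (-1 : ℂ) • uF k t + G k t) p :=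
        synth_add ε (hlapF 0).decay ((hnegu 0).add (hG 0)).decay hp
      have e2 : synth ε (fun k t => (-1 : ℂ) • uF k t + G k t) p =
          synth ε (fun k t => (-1 : ℂ) • uF k t) p + synth ε G p :=
        synth_add ε (hnegu 0).decay (hG 0).decay hp
      have e3 : synth ε (fun k t => (-1 : ℂ) • uF k t) p = -(synth ε uF p) := by
        have := synth_map ε (huF 0).decay ((-1 : ℂ) • ContinuousLinearMap.id ℂ (Fin N → ℂ)) hp
        simpa using this
      have e4 : synth ε G p = synth ε (fun k t => ∑ a, latticeConv (b a) (D a) k t) p +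
          synth ε g p :=
        synth_add ε (RapidSmooth.sum Finset.univ fun a _ => hconv a 0).decay
          ((hg 0).decay.mono (subset_univ _)) hp
      have e5 : synth ε (fun k t => ∑ a, latticeConv (b a) (D a) k t) p =
          ∑ a, synth ε (latticeConv (b a) (D a)) p :=
        synth_sum ε Finset.univ (fun a _ => (hconv a 0).decay) hp
      rw [e1, e2, e3, e4, e5, hgs p hp1 hp2]
      congr 3
      refine Finset.sum_congr rfl fun a _ => ?_
      exact synth_conv ε ((hb a 0).decay.mono (subset_univ _)) (hD a 0).decay hp
    have hDn : synth ε (D none) p = synth ε uF p := rfl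
    have hD0 : synth ε (D (some 0)) p = pderiv 0 (synth ε uF) p := by rw [hut p hp]; rfl
    have hDi : ∀ i : Fin n, synth ε (D (some i.succ)) p = pderiv i.succ (synth ε uF) p := by
      intro i
      rw [hui i p hp]
      congr 1
      ext k t a
      simp [D, c, freqMul, uF, mul_assoc, mul_add]
    have hDj : ∀ j : Fin (n + 1), synth ε (D (some j)) p = pderiv j (synth ε uF) p := fun j =>
      Fin.cases hD0 hDi j
    have hbn : synth ε (b none) p = ContinuousLinearMap.id ℂ (Fin N → ℂ) - Q p := by
      have e1 : synth ε (b none) p = synth ε b1 p + synth ε (fun k t => (-1 : ℂ) • bQ k t) p :=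
        synth_add ε (hb1 0).decay (hsm (-1) 0 (hbQ 0)).decay (mem_univ _)
      have e2 : synth ε (fun k t => (-1 : ℂ) • bQ k t) p = -(synth ε bQ p) := by
        have := synth_map ε (hbQ 0).decay
          ((-1 : ℂ) • ContinuousLinearMap.id ℂ ((Fin N → ℂ) →L[ℂ] (Fin N → ℂ))) (p := p) (mem_univ _)
        exact this.trans (neg_one_smul ℂ (synth ε bQ p))
      rw [e1, e2, hb1s, hbQs p hp1 hp2, sub_eq_add_neg]
    have hbj : ∀ j : Fin (n + 1), synth ε (b (some j)) p = (-2 : ℂ) • A j p := by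
      intro j
      have := synth_map ε (hbA j 0).decay
        ((-2 : ℂ) • ContinuousLinearMap.id ℂ ((Fin N → ℂ) →L[ℂ] (Fin N → ℂ))) (p := p) (mem_univ _)
      rw [← hbAs j p hp1 hp2]
      exact this
    unfold waveOpCLM
    rw [htt, Finset.sum_congr rfl fun i _ => hii i, ← hlap, hv', Fintype.sum_option, hDn, hbn,
      Finset.sum_congr rfl fun j _ => by rw [hDj j, hbj j, smul_apply], ← Finset.smul_sum,
      sub_apply, ContinuousLinearMap.id_apply]
    module

end TorusWave

/-! ### Extension by zero from a time slab, and integration by parts -/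

section Glue

variable {n : ℕ} {V : Type*} [NormedAddCommGroup V] [NormedSpace ℝ V]

/-- The `j`-th partial derivative of a function on space-time with values in any normed space. -/
def dpart (j : Fin (n + 1)) (u : Spacetime n → V) : Spacetime n → V :=
  fun p => fderiv ℝ u p (basisVec j)

/-- The time slab `[0,T) × ℝⁿ`. -/
def slab (n : ℕ) (T : ℝ) : Set (Spacetime n) := Ico 0 T ×ˢ univ

theorem uniqueDiffOn_slab {T : ℝ} : UniqueDiffOn ℝ (slab n T) :=
  (uniqueDiffOn_Ico 0 T).prod uniqueDiffOn_univ

theorem slab_mem_nhds {T : ℝ} {p : Spacetime n} (h0 : 0 < p.1) (hT : p.1 < T) :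
    slab n T ∈ nhds p :=
  prod_mem_nhds (Ico_mem_nhds h0 hT) Filter.univ_mem

open Classical in
/-- Extension by zero from the slab. -/
def extendZero (T : ℝ) (v : Spacetime n → V) : Spacetime n → V :=
  fun p => if p ∈ slab n T then v p else 0

theorem mem_slab {T : ℝ} {p : Spacetime n} : p ∈ slab n T ↔ 0 ≤ p.1 ∧ p.1 < T := by
  simp [slab]

/-- Solutions are smooth only up to `t = 0` from one side, whereas integration by parts wants a `C¹`
function on all of space-time. Vanishing of the value and of the full differential at `t = 0`, and
vanishing of the function from time `T'` on, glue it to zero in a `C¹` manner. -/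
theorem contDiff_extendZero {T T' : ℝ} (hT' : T' < T) {v : Spacetime n → V}
    (hv : ContDiffOn ℝ 1 v (slab n T)) (h0 : ∀ x, v (0, x) = 0)
    (h1 : ∀ x, fderivWithin ℝ v (slab n T) (0, x) = 0)
    (h2 : ∀ p ∈ slab n T, T' ≤ p.1 → v p = 0) :
    (∀ p, HasFDerivAt (extendZero T v)
      (extendZero T (fun p => fderivWithin ℝ v (slab n T) p) p) p) ∧
    Continuous (extendZero T (fun p => fderivWithin ℝ v (slab n T) p)) := by
  set D := fun p => fderivWithin ℝ v (slab n T) p with hD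
  have hDc : ContinuousOn D (slab n T) := hv.continuousOn_fderivWithin uniqueDiffOn_slab le_rfl
  have hneg : ∀ {W : Type _} [NormedAddCommGroup W] (w : Spacetime n → W) (p : Spacetime n), p.1 < 0 →
      extendZero T w =ᶠ[nhds p] fun _ => 0 := by
    intro W _ w p hp
    filter_upwards [continuous_fst.continuousAt.eventually (gt_mem_nhds hp)] with q hq
    exact if_neg fun h => (mem_slab.1 h).1.not_gt hq
  have hpos : ∀ {W : Type _} [NormedAddCommGroup W] (w : Spacetime n → W),
      (∀ p ∈ slab n T, T' < p.1 → w p = 0) → ∀ p : Spacetime n, T' < p.1 →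
      extendZero T w =ᶠ[nhds p] fun _ => 0 := by
    intro W _ w hw p hp
    filter_upwards [continuous_fst.continuousAt.eventually (lt_mem_nhds hp)] with q hq
    unfold extendZero
    split_ifs with h
    · exact hw q h hq
    · rfl
  have hD2 : ∀ p ∈ slab n T, T' < p.1 → D p = 0 := by
    intro p hp hpT
    have : v =ᶠ[nhdsWithin p (slab n T)] fun _ => 0 := by
      filter_upwards [self_mem_nhdsWithin, mem_nhdsWithin_of_mem_nhds
        (continuous_fst.continuousAt.eventually (lt_mem_nhds hpT))] with q hq hq2
      exact h2 q hq (le_of_lt hq2)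
    simp only [hD]
    rw [this.fderivWithin_eq (h2 p hp hpT.le), fderivWithin_const_apply]
  have hin : ∀ {W : Type _} [NormedAddCommGroup W] (w : Spacetime n → W) (p : Spacetime n),
      0 < p.1 → p.1 < T → extendZero T w =ᶠ[nhds p] w := by
    intro W _ w p h0 hT
    filter_upwards [slab_mem_nhds h0 hT] with q hq
    exact if_pos hq
  have hval : ∀ {W : Type _} [NormedAddCommGroup W] (w : Spacetime n → W) (p : Spacetime n),
      p ∈ slab n T → extendZero T w p = w p := fun w p hp => if_pos hp
  have hcover : ∀ p : Spacetime n, p.1 = 0 → p.1 < T →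
      slab n T ∪ {q | q.1 ≤ 0} ∈ nhds p := by
    intro p hp hpT
    filter_upwards [continuous_fst.continuousAt.eventually (gt_mem_nhds hpT)] with q hq
    rcases le_total 0 q.1 with h | h
    · exact Or.inl (mem_slab.2 ⟨h, hq⟩)
    · exact Or.inr h
  refine ⟨fun p => ?_, continuous_iff_continuousAt.2 fun p => ?_⟩
  · rcases lt_trichotomy p.1 0 with hp | hp | hp
    · rw [(hneg D p hp).eq_of_nhds]
      exact (hasFDerivAt_const 0 p).congr_of_eventuallyEq (hneg v p hp)
    · by_cases hpT : p.1 < T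
      · have hps : p ∈ slab n T := mem_slab.2 ⟨hp.ge, hpT⟩
        have hp0 : p = (0, p.2) := Prod.ext hp rfl
        have hDp : D p = 0 := by rw [hp0]; exact h1 p.2
        have hvp : v p = 0 := by rw [hp0]; exact h0 p.2
        rw [hval D p hps, hDp]
        -- At `t = 0` the differential is zero both within the slab and within `t ≤ 0`, and these
        -- two sets cover a neighbourhood.
        have a1 : HasFDerivWithinAt (extendZero T v) (0 : Spacetime n →L[ℝ] V) (slab n T) p := by
          have := (hv.differentiableOn one_ne_zero p hps).hasFDerivWithinAt
          rw [show fderivWithin ℝ v (slab n T) p = 0 from hDp] at this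
          exact this.congr (fun q hq => hval v q hq) (hval v p hps)
        have a2 : HasFDerivWithinAt (extendZero T v) (0 : Spacetime n →L[ℝ] V) {q | q.1 ≤ 0} p := by
          refine (hasFDerivWithinAt_const (0 : V) p _).congr (fun q hq => ?_) ?_
          · unfold extendZero
            split_ifs with h
            · have hq0 : q = (0, q.2) := Prod.ext (le_antisymm hq (mem_slab.1 h).1) rfl
              rw [hq0]; exact h0 _
            · rfl
          · rw [hval v p hps, hvp]
        exact (a1.union a2).hasFDerivAt (hcover p hp hpT)
      · have hpT' : T' < p.1 := by linarith
        rw [(hpos D hD2 p hpT').eq_of_nhds]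
        exact (hasFDerivAt_const 0 p).congr_of_eventuallyEq
          (hpos v (fun q hq h => h2 q hq h.le) p hpT')
    · by_cases hpT : p.1 < T
      · have hps : p ∈ slab n T := mem_slab.2 ⟨hp.le, hpT⟩
        rw [hval D p hps]
        exact ((hv.differentiableOn one_ne_zero p hps).hasFDerivWithinAt.hasFDerivAt
          (slab_mem_nhds hp hpT)).congr_of_eventuallyEq (hin v p hp hpT)
      · have hpT' : T' < p.1 := by linarith
        rw [(hpos D hD2 p hpT').eq_of_nhds]
        exact (hasFDerivAt_const 0 p).congr_of_eventuallyEq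
          (hpos v (fun q hq h => h2 q hq h.le) p hpT')
  · rcases lt_or_ge T' p.1 with hpT' | hpT'
    · exact continuousAt_const.congr (hpos D hD2 p hpT').symm
    have hpT : p.1 < T := by linarith
    rcases lt_trichotomy p.1 0 with hp | hp | hp
    · exact continuousAt_const.congr (hneg D p hp).symm
    · have hps : p ∈ slab n T := mem_slab.2 ⟨hp.ge, hpT⟩
      have hp0 : p = (0, p.2) := Prod.ext hp rfl
      have hDp : D p = 0 := by rw [hp0]; exact h1 p.2
      have a1 : ContinuousWithinAt (extendZero T D) (slab n T) p :=
        (hDc p hps).congr (fun q hq => hval D q hq) (hval D p hps)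
      have a2 : ContinuousWithinAt (extendZero T D) {q | q.1 ≤ 0} p := by
        refine (continuousWithinAt_const (b := (0 : Spacetime n →L[ℝ] V))).congr (fun q hq => ?_) ?_
        · unfold extendZero
          split_ifs with h
          · have hq0 : q = (0, q.2) := Prod.ext (le_antisymm hq (mem_slab.1 h).1) rfl
            rw [hq0]; exact h1 _
          · rfl
        · rw [hval D p hps, hDp]
      exact (a1.union a2).continuousAt (hcover p hp hpT)
    · exact (hDc.continuousAt (slab_mem_nhds hp hpT)).congr (hin D p hp hpT).symm

instance : (MeasureTheory.volume : MeasureTheory.Measure (Spacetime n)).IsAddHaarMeasure :=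
  inferInstanceAs ((MeasureTheory.volume.prod MeasureTheory.volume).IsAddHaarMeasure)

/-- The divergence theorem for one component, as integration by parts against the constant `1`. It
asks only for the `C¹` regularity that extension by zero supplies. -/
theorem integral_fderiv_apply_eq_zero {f : Spacetime n → ℝ} {f' : Spacetime n → Spacetime n →L[ℝ] ℝ}
    (hf : ∀ p, HasFDerivAt f (f' p) p) (hf' : Continuous f') (hcs : HasCompactSupport f)
    (v : Spacetime n) : MeasureTheory.Integrable (fun p => f' p v) ∧ ∫ p, f' p v = 0 := by
  have hfd : ∀ p, fderiv ℝ f p = f' p := fun p => (hf p).fderiv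
  have hfd' : fderiv ℝ f = f' := funext hfd
  have hfc : Continuous f := continuous_iff_continuousAt.2 fun p => (hf p).continuousAt
  have hcs' : HasCompactSupport f' := hfd' ▸ hcs.fderiv (𝕜 := ℝ)
  have hi' : MeasureTheory.Integrable (fun p => f' p v) :=
    (by fun_prop : Continuous fun p => f' p v).integrable_of_hasCompactSupport
      (hcs'.comp_left (g := fun L : Spacetime n →L[ℝ] ℝ => L v) rfl)
  refine ⟨hi', ?_⟩
  have h := integral_mul_fderiv_eq_neg_fderiv_mul_of_integrable (μ := MeasureTheory.volume)
    (f := fun _ : Spacetime n => (1 : ℝ)) (g := f) (v := v) (by simp)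
    (by simpa [hfd] using hi') (by simpa using hfc.integrable_of_hasCompactSupport hcs)
    (fun _ _ => differentiableAt_const _) (fun p _ => (hf p).differentiableAt)
  simpa [hfd] using h

end Glue

/-! ### A smooth weight on the backward light cone -/

section Weight

variable {n : ℕ}

/-- `(ρ - t)² - |x - x₀|²`, positive inside the light cone with vertex `(ρ, x₀)`. -/
def coneFun (ρ : ℝ) (x₀ : EuclideanSpace ℝ (Fin n)) (p : Spacetime n) : ℝ :=
  (ρ - p.1) ^ 2 - ‖p.2 - x₀‖ ^ 2

/-- The weight of the energy estimate. -/
def coneWeight (lam T' ρ : ℝ) (x₀ : EuclideanSpace ℝ (Fin n)) (p : Spacetime n) : ℝ :=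
  Real.exp (-lam * p.1) * expNegInvGlue (T' - p.1) * expNegInvGlue (coneFun ρ x₀ p)

/-- `expNegInvGlue` is flat at `0`, so the weight is smooth across the cone and across `T'`, and no
boundary terms arise. `coneFun` is also positive beyond the vertex, in the forward cone; when `T' ≤
ρ` the factor in `T' - t` removes that part. -/
theorem contDiff_coneWeight (lam T' ρ : ℝ) (x₀ : EuclideanSpace ℝ (Fin n)) :
    ContDiff ℝ ∞ (coneWeight lam T' ρ x₀) := by
  unfold coneWeight coneFun
  have h1 : ContDiff ℝ ∞ fun p : Spacetime n => (ρ - p.1) ^ 2 - ‖p.2 - x₀‖ ^ 2 :=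
    ((contDiff_const.sub contDiff_fst).pow 2).sub ((contDiff_snd.sub contDiff_const).norm_sq ℝ)
  exact ((contDiff_const.mul contDiff_fst).exp.mul
    (expNegInvGlue.contDiff.comp (contDiff_const.sub contDiff_fst))).mul
    (expNegInvGlue.contDiff.comp h1)

theorem coneWeight_nonneg (lam T' ρ : ℝ) (x₀ : EuclideanSpace ℝ (Fin n)) (p : Spacetime n) :
    0 ≤ coneWeight lam T' ρ x₀ p :=
  mul_nonneg (mul_nonneg (Real.exp_pos _).le (expNegInvGlue.nonneg _)) (expNegInvGlue.nonneg _)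

theorem coneWeight_pos {lam T' ρ : ℝ} {x₀ : EuclideanSpace ℝ (Fin n)} {p : Spacetime n}
    (h1 : p.1 < T') (h2 : ‖p.2 - x₀‖ < ρ - p.1) : 0 < coneWeight lam T' ρ x₀ p := by
  refine mul_pos (mul_pos (Real.exp_pos _) (expNegInvGlue.pos_of_pos (by linarith)))
    (expNegInvGlue.pos_of_pos ?_)
  unfold coneFun
  nlinarith [norm_nonneg (p.2 - x₀)]

theorem coneWeight_eq_zero_of_le {lam T' ρ : ℝ} {x₀ : EuclideanSpace ℝ (Fin n)} {p : Spacetime n}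
    (h : T' ≤ p.1) : coneWeight lam T' ρ x₀ p = 0 := by
  unfold coneWeight
  rw [expNegInvGlue.zero_of_nonpos (by linarith : T' - p.1 ≤ 0)]; simp

theorem coneWeight_eq_zero_of_cone {lam T' ρ : ℝ} {x₀ : EuclideanSpace ℝ (Fin n)} {p : Spacetime n}
    (h : coneFun ρ x₀ p ≤ 0) : coneWeight lam T' ρ x₀ p = 0 := by
  unfold coneWeight
  rw [expNegInvGlue.zero_of_nonpos h]; simp

theorem deriv_expNegInvGlue_nonneg (y : ℝ) : 0 ≤ deriv expNegInvGlue y :=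
  expNegInvGlue.monotone.deriv_nonneg

theorem deriv_expNegInvGlue_of_nonpos {y : ℝ} (hy : y ≤ 0) : deriv expNegInvGlue y = 0 := by
  have hmin : IsLocalMin expNegInvGlue y := Filter.Eventually.of_forall fun z => by
    rw [expNegInvGlue.zero_of_nonpos hy]; exact expNegInvGlue.nonneg z
  exact hmin.deriv_eq_zero

/-- The derivatives of the weight: `∂_t W ≤ -λ W - B (ρ - t)` and `∂_i W = -B (x - x₀)_i`
with `B ≥ 0` vanishing outside of the cone. -/
theorem exists_coneWeight_deriv (lam T' ρ : ℝ) (x₀ : EuclideanSpace ℝ (Fin n)) (p : Spacetime n) :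
    ∃ B : ℝ, 0 ≤ B ∧ (coneFun ρ x₀ p ≤ 0 → B = 0) ∧
      dpart 0 (coneWeight lam T' ρ x₀) p ≤ -lam * coneWeight lam T' ρ x₀ p - B * (ρ - p.1) ∧
      ∀ i : Fin n, dpart i.succ (coneWeight lam T' ρ x₀) p = -(B * (p.2 i - x₀ i)) := by
  set E := Real.exp (-lam * p.1)
  set η := expNegInvGlue
  have hη : ∀ y, HasDerivAt η (deriv η y) y := fun y =>
    ((expNegInvGlue.contDiff (n := 1)).differentiable one_ne_zero y).hasDerivAt
  have hf1 : HasFDerivAt (fun q : Spacetime n => q.1) (ContinuousLinearMap.fst ℝ ℝ _) p := hasFDerivAt_fst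
  have hf2 : HasFDerivAt (fun q : Spacetime n => q.2) (ContinuousLinearMap.snd ℝ ℝ _) p := hasFDerivAt_snd
  have h1 : HasFDerivAt (fun q : Spacetime n => Real.exp (-lam * q.1)) _ p := (hf1.const_mul (-lam)).exp
  have h2 := (hη (T' - p.1)).comp_hasFDerivAt p (hf1.const_sub T')
  have h3 : HasFDerivAt (coneFun ρ x₀) _ p :=
    ((hf1.const_sub ρ).pow 2).sub ((hf2.sub_const x₀).norm_sq)
  have h4 := (hη (coneFun ρ x₀ p)).comp_hasFDerivAt p h3
  have h5 : HasFDerivAt (coneWeight lam T' ρ x₀) _ p := (h1.mul h2).mul h4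
  refine ⟨2 * (E * η (T' - p.1) * deriv η (coneFun ρ x₀ p)), ?_, ?_, ?_, ?_⟩
  · have := deriv_expNegInvGlue_nonneg (coneFun ρ x₀ p)
    have := expNegInvGlue.nonneg (T' - p.1)
    have := Real.exp_pos (-lam * p.1)
    positivity
  · intro h
    rw [show deriv η (coneFun ρ x₀ p) = 0 from deriv_expNegInvGlue_of_nonpos h]; simp
  -- The last term, coming from the cutoff at `T'`, has a favourable sign and is dropped. The factor
  -- `2` in the witness for `B` comes from differentiating the squares in `coneFun`.
  · have e : dpart 0 (coneWeight lam T' ρ x₀) p = -lam * coneWeight lam T' ρ x₀ p -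
        2 * (E * η (T' - p.1) * deriv η (coneFun ρ x₀ p)) * (ρ - p.1) -
        E * deriv η (T' - p.1) * η (coneFun ρ x₀ p) := by
      unfold dpart
      rw [h5.fderiv, basisVec_zero]
      simp [coneWeight, E]
      ring
    rw [e]
    have := deriv_expNegInvGlue_nonneg (T' - p.1)
    have := expNegInvGlue.nonneg (coneFun ρ x₀ p)
    have := Real.exp_pos (-lam * p.1)
    have : 0 ≤ E * deriv η (T' - p.1) * η (coneFun ρ x₀ p) := by positivity
    linarith
  · intro i
    unfold dpart
    rw [h5.fderiv, basisVec_succ]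
    simp [E, EuclideanSpace.inner_single_right]
    ring

end Weight

/-! ### The weighted energy estimate -/

section Energy

variable {n : ℕ} {H : Type*} [NormedAddCommGroup H] [InnerProductSpace ℝ H]

/-- The d'Alembertian `∂_t² - Δ`. -/
def dalembert {V : Type*} [NormedAddCommGroup V] [NormedSpace ℝ V] (u : Spacetime n → V) :
    Spacetime n → V :=
  fun p => dpart 0 (dpart 0 u) p - ∑ i : Fin n, dpart i.succ (dpart i.succ u) p

/-- The energy density. -/
def energyDensity {V : Type*} [NormedAddCommGroup V] [NormedSpace ℝ V] (u : Spacetime n → V)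
    (p : Spacetime n) : ℝ :=
  (∑ j : Fin (n + 1), ‖dpart j u p‖ ^ 2 + ‖u p‖ ^ 2) / 2

/-- The first order size `|u| + ∑_j |∂_j u|`. -/
def firstOrder {V : Type*} [NormedAddCommGroup V] [NormedSpace ℝ V] (u : Spacetime n → V)
    (p : Spacetime n) : ℝ :=
  ‖u p‖ + ∑ j : Fin (n + 1), ‖dpart j u p‖

theorem firstOrder_sq_le (u : Spacetime n → H) (p : Spacetime n) :
    firstOrder u p ^ 2 ≤ (n + 2) * (2 * energyDensity u p) := by
  unfold firstOrder energyDensity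
  have h := sq_sum_le_card_mul_sum_sq (s := (Finset.univ : Finset (Option (Fin (n + 1)))))
    (f := fun a => Option.elim a ‖u p‖ fun j => ‖dpart j u p‖)
  simp only [Fintype.sum_option, Option.elim, Finset.card_univ, Fintype.card_option,
    Fintype.card_fin] at h
  push_cast at h
  linarith

theorem energyDensity_nonneg (u : Spacetime n → H) (p : Spacetime n) : 0 ≤ energyDensity u p := by
  unfold energyDensity; positivity

/-- The pointwise inequality behind the energy estimate: the flux term is absorbed by the decay
of the weight along the cone. -/
theorem energy_flux_inequality {M g w w0 B s lam : ℝ} {X : Fin n → ℝ} {wi : Fin n → ℝ}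
    {r bx : H} {R : Fin (n + 1) → H} (hM : 0 ≤ M) (hw : 0 ≤ w) (hB : 0 ≤ B)
    (hX : B ≠ 0 → ∑ i, X i ^ 2 ≤ s ^ 2 ∧ 0 ≤ s)
    (hw0 : w0 ≤ -lam * w - B * s) (hwi : ∀ i, wi i = -(B * X i))
    (hbx : w ≠ 0 → ‖bx‖ ≤ M * (‖r‖ + ∑ j, ‖R j‖) + g)
    (hlam : lam = M * (n + 3) + 3) :
    w0 * ((∑ j, ‖R j‖ ^ 2 + ‖r‖ ^ 2) / 2) - ∑ i, wi i * inner ℝ (R i.succ) (R 0) +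
      w * inner ℝ (R 0) (bx + r) ≤
      -(w * ((∑ j, ‖R j‖ ^ 2 + ‖r‖ ^ 2) / 2)) + w * g ^ 2 / 2 := by
  set e := (∑ j, ‖R j‖ ^ 2 + ‖r‖ ^ 2) / 2 with he
  have hsum : ∑ j, ‖R j‖ ^ 2 = ‖R 0‖ ^ 2 + ∑ i : Fin n, ‖R i.succ‖ ^ 2 := Fin.sum_univ_succ _
  have hS0 : 0 ≤ ∑ i : Fin n, ‖R i.succ‖ ^ 2 := Finset.sum_nonneg fun i _ => sq_nonneg _
  have he0 : 0 ≤ e := by positivity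
  -- Cauchy–Schwarz bounds the flux by `B |X| |∇r| |∂_t r|`. As `|X| ≤ s` where `B ≠ 0`, this is
  -- absorbed by the term `-B * s` in the decay of the weight.
  have hflux : -∑ i, wi i * inner ℝ (R i.succ) (R 0) ≤ B * s * e := by
    by_cases hB0 : B = 0
    · simp [hwi, hB0]
    obtain ⟨hX1, hs⟩ := hX hB0
    have h1 : -∑ i, wi i * inner ℝ (R i.succ) (R 0) = B * inner ℝ (∑ i, X i • R i.succ) (R 0) := by
      rw [sum_inner, Finset.mul_sum, ← Finset.sum_neg_distrib]
      refine Finset.sum_congr rfl fun i _ => ?_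
      rw [hwi, real_inner_smul_left]; ring
    have h2 : ‖∑ i, X i • R i.succ‖ ≤ s * Real.sqrt (∑ i : Fin n, ‖R i.succ‖ ^ 2) := by
      calc ‖∑ i, X i • R i.succ‖ ≤ ∑ i, |X i| * ‖R i.succ‖ := by
            refine (norm_sum_le _ _).trans (le_of_eq ?_)
            simp_rw [norm_smul, Real.norm_eq_abs]
        _ ≤ Real.sqrt (∑ i, |X i| ^ 2) * Real.sqrt (∑ i : Fin n, ‖R i.succ‖ ^ 2) :=
            Real.sum_mul_le_sqrt_mul_sqrt _ _ _
        _ ≤ _ := by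
            gcongr
            simp_rw [sq_abs]
            exact Real.sqrt_le_iff.2 ⟨hs, hX1⟩
    set y := Real.sqrt (∑ i : Fin n, ‖R i.succ‖ ^ 2) with hy
    have hy2 : y ^ 2 = ∑ i : Fin n, ‖R i.succ‖ ^ 2 := Real.sq_sqrt hS0
    have hy0 : 0 ≤ y := Real.sqrt_nonneg _
    rw [h1, mul_assoc]
    refine mul_le_mul_of_nonneg_left ?_ hB
    calc inner ℝ (∑ i, X i • R i.succ) (R 0) ≤ ‖∑ i, X i • R i.succ‖ * ‖R 0‖ := real_inner_le_norm _ _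
      _ ≤ s * y * ‖R 0‖ := by gcongr
      _ = s * (y * ‖R 0‖) := by ring
      _ ≤ s * e := by
          gcongr
          rw [he, hsum, ← hy2]
          nlinarith [sq_nonneg (y - ‖R 0‖), sq_nonneg ‖r‖]
  -- The make-up of `lam`: `M * (n + 3)` pays for the lower order terms through `‖R 0‖ * b ≤ (n + 3)
  -- * e`, `2` pays for the products of `‖R 0‖` with `g` and with `‖r‖`, and the last `1` is the
  -- gain kept in the conclusion.
  have hmain : w * inner ℝ (R 0) (bx + r) ≤ w * ((lam - 1) * e + g ^ 2 / 2) := by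
    by_cases hw' : w = 0
    · simp [hw']
    refine mul_le_mul_of_nonneg_left ?_ hw
    set b := ‖r‖ + ∑ j, ‖R j‖ with hb
    have hb2 : b ^ 2 ≤ (n + 2) * (2 * e) := by
      have h := sq_sum_le_card_mul_sum_sq (s := (Finset.univ : Finset (Option (Fin (n + 1)))))
        (f := fun a => Option.elim a ‖r‖ fun j => ‖R j‖)
      simp only [Fintype.sum_option, Option.elim, Finset.card_univ, Fintype.card_option,
        Fintype.card_fin] at h
      push_cast at h
      rw [hb, he]
      linarith
    have ha2 : ‖R 0‖ ^ 2 + ‖r‖ ^ 2 ≤ 2 * e := by rw [he, hsum]; linarith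
    have h1 : ‖R 0‖ * b ≤ (n + 3) * e := by
      nlinarith [sq_nonneg (‖R 0‖ - b), sq_nonneg ‖r‖]
    calc inner ℝ (R 0) (bx + r) ≤ ‖R 0‖ * (‖bx‖ + ‖r‖) :=
          (real_inner_le_norm _ _).trans (by gcongr; exact norm_add_le _ _)
      _ ≤ ‖R 0‖ * (M * b + g + ‖r‖) := by gcongr; exact hbx hw'
      _ = M * (‖R 0‖ * b) + ‖R 0‖ * g + ‖R 0‖ * ‖r‖ := by ring
      _ ≤ M * ((n + 3) * e) + (e + g ^ 2 / 2) + e := by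
          gcongr
          · nlinarith [sq_nonneg (‖R 0‖ - g), sq_nonneg ‖r‖]
          · nlinarith [sq_nonneg (‖R 0‖ - ‖r‖)]
      _ = (lam - 1) * e + g ^ 2 / 2 := by rw [hlam]; ring
  have h3 : w0 * e ≤ (-lam * w - B * s) * e := mul_le_mul_of_nonneg_right hw0 he0
  linarith [h3, hflux, hmain]

theorem hasFDerivWithinAt_mul_zero {S : Set (Spacetime n)} {W q : Spacetime n → ℝ} {p : Spacetime n}
    (hW : DifferentiableAt ℝ W p) (hq : HasFDerivWithinAt q (0 : Spacetime n →L[ℝ] ℝ) S p)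
    (hq0 : q p = 0) : HasFDerivWithinAt (fun p => W p * q p) (0 : Spacetime n →L[ℝ] ℝ) S p := by
  refine (hW.hasFDerivAt.hasFDerivWithinAt.mul hq).congr_fderiv ?_
  simp [hq0]

theorem hasFDerivWithinAt_inner_zero {S : Set (Spacetime n)} {a b : Spacetime n → H} {p : Spacetime n}
    (ha : DifferentiableWithinAt ℝ a S p) (hb : DifferentiableWithinAt ℝ b S p) (ha0 : a p = 0)
    (hb0 : b p = 0) :
    HasFDerivWithinAt (fun p => inner ℝ (a p) (b p)) (0 : Spacetime n →L[ℝ] ℝ) S p := by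
  refine (ha.hasFDerivWithinAt.inner ℝ hb.hasFDerivWithinAt).congr_fderiv ?_
  ext v <;> simp [ha0, hb0]

/-- The time component vanishes by the velocity datum, the space components because the initial
value is zero for all `x`. The time derivative is one-sided, hence the appeal to unique
differentiability of `[0, T)`. -/
theorem fderivWithin_slab_zero {V : Type*} [NormedAddCommGroup V] [NormedSpace ℝ V] {T : ℝ}
    (hT : 0 < T) {u : Spacetime n → V} (hu : DifferentiableOn ℝ u (slab n T))
    (h0 : ∀ x, u (0, x) = 0) (h1 : ∀ x, HasDerivWithinAt (fun t : ℝ => u (t, x)) 0 (Ici 0) 0)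
    (x : EuclideanSpace ℝ (Fin n)) : fderivWithin ℝ u (slab n T) (0, x) = 0 := by
  have hp : ((0 : ℝ), x) ∈ slab n T := mem_slab.2 ⟨le_rfl, hT⟩
  have hd := (hu _ hp).hasFDerivWithinAt
  set D := fderivWithin ℝ u (slab n T) (0, x)
  refine ContinuousLinearMap.ext fun v => ?_
  have e1 : D (1, 0) = 0 := by
    have h2 : HasDerivWithinAt (fun t : ℝ => (t, x)) ((1 : ℝ), (0 : EuclideanSpace ℝ (Fin n)))
        (Ico 0 T) 0 := ((hasDerivAt_id (0 : ℝ)).prodMk (hasDerivAt_const 0 x)).hasDerivWithinAt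
    have h3 := hd.comp_hasDerivWithinAt (0 : ℝ) h2 fun t ht => mem_slab.2 ht
    have h4 := (h1 x).mono (Ico_subset_Ici_self : Ico 0 T ⊆ Ici 0)
    exact (uniqueDiffOn_Ico 0 T 0 ⟨le_rfl, hT⟩).eq_deriv _ h3 h4
  have e2 : ∀ y, D (0, y) = 0 := by
    intro y
    have h2 : HasFDerivAt (fun y : EuclideanSpace ℝ (Fin n) => ((0 : ℝ), y))
        (ContinuousLinearMap.inr ℝ ℝ _) x := hasFDerivAt_prodMk_right 0 x
    have h3 := hd.comp_hasFDerivAt x h2 (Filter.Eventually.of_forall fun y => mem_slab.2 ⟨le_rfl, hT⟩)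
    have h4 : HasFDerivAt (u ∘ fun y : EuclideanSpace ℝ (Fin n) => ((0 : ℝ), y))
        (0 : EuclideanSpace ℝ (Fin n) →L[ℝ] V) x := by
      have : (u ∘ fun y : EuclideanSpace ℝ (Fin n) => ((0 : ℝ), y)) = fun _ => 0 := funext h0
      rw [this]; exact hasFDerivAt_const 0 x
    have := congrArg (fun L => L y) (h3.unique h4)
    simpa using this
  have hv : v = v.1 • ((1 : ℝ), (0 : EuclideanSpace ℝ (Fin n))) + (0, v.2) := by ext <;> simp
  rw [hv, map_add, map_smul, e1, e2]; simp

/-- The weighted energy estimate in a backward light cone. -/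
theorem energy_estimate {T T' ρ M : ℝ} (hT0 : 0 < T') (hT' : T' < T) (hρ : T' ≤ ρ) (hM : 0 ≤ M)
    (x₀ : EuclideanSpace ℝ (Fin n)) {r : Spacetime n → H} (hr : ContDiffOn ℝ ∞ r (slab n T))
    (h0 : ∀ x, r (0, x) = 0) (h1 : ∀ x, HasDerivWithinAt (fun t : ℝ => r (t, x)) 0 (Ici 0) 0)
    {g : Spacetime n → ℝ} (hg : Continuous g)
    (hb : ∀ p : Spacetime n, 0 < p.1 → p.1 < T' → ‖p.2 - x₀‖ < ρ - p.1 →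
      ‖dalembert r p‖ ≤ M * firstOrder r p + g p) :
    MeasureTheory.IntegrableOn (fun p => coneWeight (M * (n + 3) + 3) T' ρ x₀ p * energyDensity r p)
      {p | 0 < p.1 ∧ p.1 < T'} ∧
    ∫ p in {p | 0 < p.1 ∧ p.1 < T'}, coneWeight (M * (n + 3) + 3) T' ρ x₀ p * energyDensity r p ≤
      ∫ p in {p | 0 < p.1 ∧ p.1 < T'}, coneWeight (M * (n + 3) + 3) T' ρ x₀ p * g p ^ 2 / 2 := by
  have hT : 0 < T := hT0.trans hT'
  set lam := M * (n + 3) + 3 with hlam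
  set W := coneWeight lam T' ρ x₀ with hW
  have hWs : ContDiff ℝ ∞ W := contDiff_coneWeight lam T' ρ x₀
  have hW0 : ∀ p, 0 ≤ W p := coneWeight_nonneg lam T' ρ x₀
  set S := slab n T with hS
  set O : Set (Spacetime n) := {p | 0 < p.1 ∧ p.1 < T'} with hO
  have hOo : IsOpen O := (isOpen_lt continuous_const continuous_fst).inter
    (isOpen_lt continuous_fst continuous_const)
  set D := fun p => fderivWithin ℝ r S p with hD
  have hDs : ContDiffOn ℝ ∞ D S := hr.fderivWithin uniqueDiffOn_slab (by simp)
  have hD0 : ∀ x, D (0, x) = 0 := fderivWithin_slab_zero hT (hr.differentiableOn (by simp)) h0 h1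
  let R : Fin (n + 1) → Spacetime n → H := fun j p => D p (basisVec j)
  have hRs : ∀ j, ContDiffOn ℝ ∞ (R j) S := fun j => hDs.clm_apply contDiffOn_const
  have hR0 : ∀ j x, R j (0, x) = 0 := fun j x => by simp [R, hD0]
  let e : Spacetime n → ℝ := fun p => (∑ j, inner ℝ (R j p) (R j p) + inner ℝ (r p) (r p)) / 2
  have hes : ContDiffOn ℝ 1 e S := by
    refine ContDiffOn.div_const (ContDiffOn.add (ContDiffOn.sum fun j _ => ?_) ?_) 2
    · exact ((hRs j).inner ℝ (hRs j)).of_le (by simp)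
    · exact (hr.inner ℝ hr).of_le (by simp)
  -- The weighted energy current: density `W e` in time and flux `-W ⟨∂_i r, ∂_t r⟩` in space. The
  -- part `‖r‖²` of the density controls the zero order term.
  let F : Fin (n + 1) → Spacetime n → ℝ := Fin.cons (fun p => W p * e p)
    fun i p => W p * -inner ℝ (R i.succ p) (R 0 p)
  have hFs : ∀ j, ContDiffOn ℝ 1 (F j) S := by
    refine Fin.cases ?_ fun i => ?_
    · exact (hWs.of_le (by simp)).contDiffOn.mul hes
    · exact (hWs.of_le (by simp)).contDiffOn.mul
        (((hRs i.succ).inner ℝ (hRs 0)).of_le (by simp)).neg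
  have hF0 : ∀ j x, F j (0, x) = 0 := by
    refine Fin.cases (fun x => ?_) fun i x => ?_
    · simp [F, e, hR0, h0]
    · simp [F, hR0]
  have hp0 : ∀ x, ((0 : ℝ), x) ∈ S := fun x => mem_slab.2 ⟨le_rfl, hT⟩
  -- The current is quadratic in `(r, ∂r)`, which vanishes at `t = 0`, so its differential vanishes
  -- there too, as extension by zero requires.
  have hF1 : ∀ j x, fderivWithin ℝ (F j) S (0, x) = 0 := by
    have hWd : ∀ p, DifferentiableAt ℝ W p := fun p => hWs.differentiable (by simp) p
    have hRd : ∀ j x, DifferentiableWithinAt ℝ (R j) S (0, x) := fun j x =>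
      (hRs j).differentiableOn (by simp) _ (hp0 x)
    have hrd : ∀ x, DifferentiableWithinAt ℝ r S (0, x) := fun x =>
      hr.differentiableOn (by simp) _ (hp0 x)
    refine Fin.cases (fun x => ?_) fun i x => ?_
    · have a1 := fun j => hasFDerivWithinAt_inner_zero (hRd j x) (hRd j x) (hR0 j x) (hR0 j x)
      have a2 := hasFDerivWithinAt_inner_zero (hrd x) (hrd x) (h0 x) (h0 x)
      have a3 : HasFDerivWithinAt e (0 : Spacetime n →L[ℝ] ℝ) S (0, x) := by
        have := ((HasFDerivWithinAt.fun_sum fun j (_ : j ∈ Finset.univ) => a1 j).add a2).mul_const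
          ((2 : ℝ)⁻¹)
        simpa [e, div_eq_mul_inv] using! this
      exact (hasFDerivWithinAt_mul_zero (hWd _) a3 (by simp [e, hR0, h0])).fderivWithin
        (uniqueDiffOn_slab _ (hp0 x))
    · have a1 := (hasFDerivWithinAt_inner_zero (hRd i.succ x) (hRd 0 x) (hR0 _ x) (hR0 0 x)).neg
      rw [neg_zero] at a1
      exact (hasFDerivWithinAt_mul_zero (hWd _) a1 (by simp [hR0])).fderivWithin
        (uniqueDiffOn_slab _ (hp0 x))
  have hF2 : ∀ j, ∀ p ∈ S, T' ≤ p.1 → F j p = 0 := by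
    intro j p _ hp
    have : W p = 0 := coneWeight_eq_zero_of_le hp
    refine Fin.cases ?_ (fun i => ?_) j <;> simp [F, this]
  have hK : ∀ p : Spacetime n, 0 ≤ p.1 → p.1 ≤ T' → ρ < ‖p.2 - x₀‖ → W p = 0 := by
    intro p hp1 hp2 hp3
    refine coneWeight_eq_zero_of_cone ?_
    unfold coneFun
    nlinarith [norm_nonneg (p.2 - x₀)]
  set K : Set (Spacetime n) := Icc 0 T' ×ˢ Metric.closedBall x₀ ρ with hKdef
  have hKc : IsCompact K := isCompact_Icc.prod (isCompact_closedBall x₀ ρ)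
  have hWK : ∀ p : Spacetime n, 0 ≤ p.1 → p ∉ K → W p = 0 := by
    intro p hp hpK
    rcases le_or_gt T' p.1 with h | h
    · exact coneWeight_eq_zero_of_le h
    · refine hK p hp h.le ?_
      by_contra hh
      exact hpK ⟨⟨hp, h.le⟩, by simpa [dist_eq_norm] using hh⟩
  have hglue := fun j => contDiff_extendZero hT' (hFs j) (hF0 j) (hF1 j) (hF2 j)
  have hcs : ∀ j, HasCompactSupport (extendZero T (F j)) := by
    intro j
    refine HasCompactSupport.intro hKc fun p hp => ?_
    unfold extendZero
    split_ifs with h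
    · have : W p = 0 := hWK p (mem_slab.1 h).1 hp
      refine Fin.cases ?_ (fun i => ?_) j <;> simp [F, this]
    · rfl
  have hint := fun j => integral_fderiv_apply_eq_zero (hglue j).1 (hglue j).2 (hcs j) (basisVec j)
  set dv : Spacetime n → ℝ := fun p => ∑ j, extendZero T (fun p => fderivWithin ℝ (F j) S p) p (basisVec j)
    with hdv
  have hdv_int : ∫ p, dv p = 0 := by
    rw [MeasureTheory.integral_finsetSum _ fun j _ => (hint j).1]
    exact Finset.sum_eq_zero fun j _ => (hint j).2
  have hdv_i : MeasureTheory.Integrable dv := MeasureTheory.integrable_finsetSum _ fun j _ => (hint j).1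
  -- pointwise bound
  have hpt : ∀ p ∈ O, dv p ≤ -(W p * energyDensity r p) + W p * g p ^ 2 / 2 := by
    intro p hp
    have hpT : p.1 < T := hp.2.trans hT'
    have hpS : p ∈ S := mem_slab.2 ⟨hp.1.le, hpT⟩
    have hnb : S ∈ nhds p := slab_mem_nhds hp.1 hpT
    have hDe : ∀ᶠ q in nhds p, D q = fderiv ℝ r q := by
      filter_upwards [(hOo.mem_nhds hp)] with q hq
      exact fderivWithin_of_mem_nhds (slab_mem_nhds hq.1 (hq.2.trans hT'))
    have hRe : ∀ j, R j =ᶠ[nhds p] dpart j r := fun j => by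
      filter_upwards [hDe] with q hq
      simp only [R, hq, dpart]
    have hrp : ContDiffAt ℝ ∞ r p := hr.contDiffAt hnb
    have hrd : HasFDerivAt r (fderiv ℝ r p) p := (hrp.differentiableAt (by simp)).hasFDerivAt
    have hRd : ∀ j, HasFDerivAt (R j) (fderiv ℝ (R j) p) p := fun j =>
      (((hRs j).contDiffAt hnb).differentiableAt (by simp)).hasFDerivAt
    have hDd : HasFDerivAt (fderiv ℝ r) (fderiv ℝ (fderiv ℝ r) p) p :=
      ((hrp.fderiv_right (m := 1) (by norm_cast)).differentiableAt one_ne_zero).hasFDerivAt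
    have hRp : ∀ j, fderiv ℝ (R j) p = (ContinuousLinearMap.apply ℝ H (basisVec j)).comp
        (fderiv ℝ (fderiv ℝ r) p) := fun j => by
      rw [(hRe j).fderiv_eq]
      exact ((ContinuousLinearMap.apply ℝ H (basisVec j)).hasFDerivAt.comp p hDd).fderiv
    -- Symmetry of second derivatives cancels the mixed terms `⟨∂_i r, ∂_t ∂_i r⟩` of density and
    -- flux; the undifferentiated weight then multiplies `⟨∂_t r, □r + r⟩` only.
    have hsymm : ∀ j k, fderiv ℝ (R j) p (basisVec k) = fderiv ℝ (R k) p (basisVec j) := by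
      intro j k
      have hs : IsSymmSndFDerivAt ℝ r p := hrp.isSymmSndFDerivAt (by simp; exact WithTop.coe_le_coe.2 (le_top : (2 : ℕ∞) ≤ ⊤))
      rw [hRp, hRp]
      exact hs.eq _ _
    have hRv : ∀ j, R j p = fderiv ℝ r p (basisVec j) := fun j => (hRe j).eq_of_nhds
    have hWd : HasFDerivAt W (fderiv ℝ W p) p := (hWs.differentiable (by simp) p).hasFDerivAt
    have hfd : ∀ j, fderivWithin ℝ (F j) S p = fderiv ℝ (F j) p := fun j => fderivWithin_of_mem_nhds hnb
    have hbox : dalembert r p = fderiv ℝ (R 0) p (basisVec 0) -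
        ∑ i : Fin n, fderiv ℝ (R i.succ) p (basisVec i.succ) := by
      unfold dalembert dpart
      congr 1
      · exact congrArg (fun L : Spacetime n →L[ℝ] H => L (basisVec 0)) (hRe 0).fderiv_eq.symm
      · refine Finset.sum_congr rfl fun i _ => ?_
        exact congrArg (fun L : Spacetime n →L[ℝ] H => L (basisVec i.succ)) (hRe i.succ).fderiv_eq.symm
    have hed : energyDensity r p = e p := by
      simp only [energyDensity, e, real_inner_self_eq_norm_sq]
      simp only [hRv, dpart]
    have hE0 : fderiv ℝ (F 0) p (basisVec 0) = dpart 0 W p * e p +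
        W p * (∑ j, inner ℝ (R j p) (fderiv ℝ (R j) p (basisVec 0)) + inner ℝ (r p) (R 0 p)) := by
      have a1 : HasFDerivAt e _ p := ((HasFDerivAt.fun_sum fun j (_ : j ∈ Finset.univ) =>
        (hRd j).inner ℝ (hRd j)).add (hrd.inner ℝ hrd)).mul_const ((2 : ℝ)⁻¹)
      have a2 : HasFDerivAt (F 0) _ p := hWd.mul a1
      rw [a2.fderiv]
      simp only [add_apply, smul_apply, sum_apply, ContinuousLinearMap.comp_apply,
        fderivInnerCLM_apply, ContinuousLinearMap.prod_apply, smul_eq_mul, dpart]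
      have s1 : ∀ a b : H, inner ℝ a b + inner ℝ b a = 2 * inner ℝ a b := fun a b => by
        rw [real_inner_comm a b]; ring
      rw [hRv 0]
      simp_rw [s1]
      rw [← Finset.mul_sum]
      ring
    have hEi : ∀ i : Fin n, fderiv ℝ (F i.succ) p (basisVec i.succ) =
        -(dpart i.succ W p * inner ℝ (R i.succ p) (R 0 p)) -
        W p * (inner ℝ (R 0 p) (fderiv ℝ (R i.succ) p (basisVec i.succ)) +
          inner ℝ (R i.succ p) (fderiv ℝ (R i.succ) p (basisVec 0))) := by
      intro i
      have a2 : HasFDerivAt (F i.succ) _ p := hWd.mul ((hRd i.succ).inner ℝ (hRd 0)).neg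
      rw [a2.fderiv]
      simp only [add_apply, smul_apply, ContinuousLinearMap.comp_apply, neg_apply,
        fderivInnerCLM_apply, ContinuousLinearMap.prod_apply, smul_eq_mul, dpart]
      rw [hsymm 0 i.succ, real_inner_comm (R 0 p)]
      ring
    have hdvp : dv p = dpart 0 W p * ((∑ j, ‖R j p‖ ^ 2 + ‖r p‖ ^ 2) / 2) -
        ∑ i : Fin n, dpart i.succ W p * inner ℝ (R i.succ p) (R 0 p) +
        W p * inner ℝ (R 0 p) (dalembert r p + r p) := by
      have : ∀ j, extendZero T (fun p => fderivWithin ℝ (F j) S p) p = fderiv ℝ (F j) p := fun j => by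
        rw [extendZero, if_pos hpS, hfd]
      simp only [hdv, this]
      rw [Fin.sum_univ_succ, hE0, Finset.sum_congr rfl fun i _ => hEi i, Fin.sum_univ_succ (f := fun j =>
        inner ℝ (R j p) (fderiv ℝ (R j) p (basisVec 0))), hbox]
      simp only [e, real_inner_self_eq_norm_sq, inner_add_right, inner_sub_right, inner_sum,
        Finset.sum_sub_distrib, Finset.sum_neg_distrib, ← Finset.mul_sum, Finset.sum_add_distrib]
      rw [real_inner_comm (R 0 p) (r p)]
      ring
    obtain ⟨B, hB, hBc, hBt, hBx⟩ := exists_coneWeight_deriv lam T' ρ x₀ p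
    rw [hdvp, hed]
    simp only [e, real_inner_self_eq_norm_sq]
    have hnorm : ∑ i, (p.2 i - x₀ i) ^ 2 = ‖p.2 - x₀‖ ^ 2 := by
      rw [EuclideanSpace.norm_sq_eq]; simp
    refine energy_flux_inequality (B := B) (s := ρ - p.1) (X := fun i => p.2 i - x₀ i) hM (hW0 p) hB
      (fun hB0 => ?_) hBt hBx (fun hw => ?_) hlam
    · have hc : 0 < coneFun ρ x₀ p := by
        by_contra h
        exact hB0 (hBc (not_lt.1 h))
      unfold coneFun at hc
      rw [hnorm]
      exact ⟨by linarith, by linarith [hp.2]⟩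
    · have hc : 0 < coneFun ρ x₀ p := by
        by_contra h
        exact hw (coneWeight_eq_zero_of_cone (not_lt.1 h))
      unfold coneFun at hc
      have hlt : ‖p.2 - x₀‖ < ρ - p.1 := by
        refine lt_of_pow_lt_pow_left₀ 2 (by linarith [hp.2]) (by linarith)
      refine (hb p hp.1 hp.2 hlt).trans (le_of_eq ?_)
      simp only [firstOrder, hRv, dpart]
  -- Off `O` the divergence is zero, so its integral over `O` equals the integral over all of
  -- space-time, which vanishes.
  have hdv_out : ∀ p, p ∉ O → dv p = 0 := by
    intro p hp
    refine Finset.sum_eq_zero fun j _ => ?_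
    unfold extendZero
    split_ifs with h
    · rcases (mem_slab.1 h).1.eq_or_lt with h00 | h00
      · have : p = (0, p.2) := Prod.ext h00.symm rfl
        rw [this]
        show fderivWithin ℝ (F j) S (0, p.2) (basisVec j) = 0
        rw [hF1]; simp
      · have hTp : T' ≤ p.1 := by
          by_contra hh; exact hp ⟨h00, not_le.1 hh⟩
        have hz : ∀ q ∈ S, q.1 ≥ T' → F j q = 0 := hF2 j
        have hmin : fderivWithin ℝ (F j) S p = fderiv ℝ (F j) p :=
          fderivWithin_of_mem_nhds (slab_mem_nhds h00 (mem_slab.1 h).2)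
        -- `F j` vanishes for `t ≥ T'`, so its continuous derivative vanishes there as well
        have hG := (hglue j).2
        set G := extendZero T (fun p => fderivWithin ℝ (F j) S p)
        have hGz : ∀ q : Spacetime n, T' < q.1 → G q = 0 := by
          intro q hq
          have h5 := (hglue j).1 q
          have h6 : extendZero T (F j) =ᶠ[nhds q] fun _ => 0 := by
            filter_upwards [continuous_fst.continuousAt.eventually (lt_mem_nhds hq)] with q' hq'
            unfold extendZero
            split_ifs with h7
            · exact hF2 j q' h7 (le_of_lt hq')
            · rfl
          exact h5.unique ((hasFDerivAt_const 0 q).congr_of_eventuallyEq h6)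
        have hGp : G p = 0 := by
          have hcl : p ∈ closure {q : Spacetime n | T' < q.1} := by
            rw [mem_closure_iff_seq_limit]
            refine ⟨fun k => (p.1 + 1 / ((k : ℝ) + 1), p.2), fun k => ?_, ?_⟩
            · have : (0 : ℝ) < 1 / ((k : ℝ) + 1) := Nat.one_div_pos_of_nat
              simp only [mem_ofPred_eq]; linarith
            · have h8 := tendsto_one_div_add_atTop_nhds_zero_nat (𝕜 := ℝ)
              have h9 := (h8.const_add p.1).prodMk_nhds (tendsto_const_nhds (x := p.2))
              simpa using h9
          have hcl2 : IsClosed {q | G q = 0} := isClosed_eq hG continuous_const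
          exact (closure_minimal (fun q hq => hGz q hq) hcl2) hcl
        have : G p = fderivWithin ℝ (F j) S p := if_pos h
        show fderivWithin ℝ (F j) S p (basisVec j) = 0
        rw [← this, hGp]; simp
    · simp
  have hWe : MeasureTheory.IntegrableOn (fun p => W p * energyDensity r p) O := by
    have hi : MeasureTheory.Integrable (extendZero T (F 0)) :=
      (continuous_iff_continuousAt.2 fun p => ((hglue 0).1 p).continuousAt).integrable_of_hasCompactSupport
        (hcs 0)
    refine hi.integrableOn.congr_fun (fun p hp => ?_) hOo.measurableSet
    have hpS : p ∈ S := mem_slab.2 ⟨hp.1.le, hp.2.trans hT'⟩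
    have hDp : D p = fderiv ℝ r p :=
      fderivWithin_of_mem_nhds (slab_mem_nhds hp.1 (hp.2.trans hT'))
    rw [extendZero, if_pos hpS]
    simp only [F, Fin.cons_zero, e, R, hDp, energyDensity, real_inner_self_eq_norm_sq, dpart]
  have hWg : MeasureTheory.IntegrableOn (fun p => W p * g p ^ 2 / 2) O := by
    have hc : Continuous fun p => W p * g p ^ 2 / 2 := by
      have := hWs.continuous; fun_prop
    refine MeasureTheory.IntegrableOn.of_forall_sdiff_eq_zero (hc.continuousOn.integrableOn_compact hKc)
      hOo.measurableSet fun p hp => ?_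
    rw [hWK p hp.1.1.le hp.2]; simp
  refine ⟨hWe, ?_⟩
  have h3 : 0 = ∫ p in O, dv p := by
    rw [MeasureTheory.setIntegral_eq_integral_of_forall_compl_eq_zero hdv_out, hdv_int]
  have h4 : ∫ p in O, dv p ≤ ∫ p in O, (-(W p * energyDensity r p) + W p * g p ^ 2 / 2) :=
    MeasureTheory.setIntegral_mono_on hdv_i.integrableOn (hWe.neg.add hWg) hOo.measurableSet hpt
  have h5 : ∫ p in O, -(W p * energyDensity r p) = -∫ p in O, W p * energyDensity r p :=
    MeasureTheory.integral_neg _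
  have h6 : ∫ p in O, (-(W p * energyDensity r p) + W p * g p ^ 2 / 2) =
      (∫ p in O, -(W p * energyDensity r p)) + ∫ p in O, W p * g p ^ 2 / 2 :=
    MeasureTheory.integral_add hWe.neg hWg
  linarith [h4, h5, h6, h3]

end Energy

/-! ### Domain of dependence and uniform local bounds -/

section EnergyConsequences

variable {n : ℕ} {V H : Type*} [NormedAddCommGroup V] [NormedSpace ℝ V] [NormedAddCommGroup H]
  [InnerProductSpace ℝ H]

theorem dpart_equiv (e : V ≃L[ℝ] H) (j : Fin (n + 1)) (u : Spacetime n → V) :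
    dpart j (fun p => e (u p)) = fun p => e (dpart j u p) := by
  funext p
  have : fderiv ℝ (e ∘ u) p = _ := e.comp_fderiv
  simp only [dpart]
  rw [show (fun p => e (u p)) = e ∘ u from rfl, this]; rfl

theorem dalembert_equiv (e : V ≃L[ℝ] H) (u : Spacetime n → V) :
    dalembert (fun p => e (u p)) = fun p => e (dalembert u p) := by
  funext p
  simp only [dalembert, dpart_equiv, map_sub, map_sum]

theorem firstOrder_nonneg (u : Spacetime n → V) (p : Spacetime n) : 0 ≤ firstOrder u p := by
  unfold firstOrder; positivity

theorem firstOrder_le_equiv (e : V ≃L[ℝ] H) (u : Spacetime n → V) (p : Spacetime n) :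
    firstOrder u p ≤ ‖(e.symm : H →L[ℝ] V)‖ * firstOrder (fun p => e (u p)) p := by
  have key : ∀ v : V, ‖v‖ ≤ ‖(e.symm : H →L[ℝ] V)‖ * ‖e v‖ := fun v => by
    simpa using (e.symm : H →L[ℝ] V).le_opNorm (e v)
  simp only [firstOrder, dpart_equiv, mul_add, Finset.mul_sum]
  exact add_le_add (key _) (Finset.sum_le_sum fun j _ => key _)

/-- Zero Cauchy data at `t = 0`. -/
def ZeroData (u : Spacetime n → V) : Prop :=
  (∀ x, u (0, x) = 0) ∧ ∀ x, HasDerivWithinAt (fun t : ℝ => u (t, x)) 0 (Ici 0) 0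

theorem ZeroData.equiv (e : V ≃L[ℝ] H) {u : Spacetime n → V} (h : ZeroData u) :
    ZeroData fun p => e (u p) :=
  ⟨fun x => by simp [h.1 x], fun x => by
    have := (e : V →L[ℝ] H).hasFDerivAt.comp_hasDerivWithinAt (0 : ℝ) (h.2 x)
    rw [map_zero] at this
    exact this⟩

/-- The sup norm on `ℂ^N` does not come from an inner product, so the estimate is transported along
a linear isomorphism, whose norms enter the constant `M'`. The parameter `lam` is chosen before `r`
and `g`. -/
theorem energy_estimate_equiv (e : V ≃L[ℝ] H) {T T' ρ M : ℝ} (hT0 : 0 < T') (hT' : T' < T)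
    (hρ : T' ≤ ρ) (hM : 0 ≤ M) (x₀ : EuclideanSpace ℝ (Fin n)) :
    ∃ lam : ℝ, ∀ (r : Spacetime n → V) (g : Spacetime n → ℝ), ContDiffOn ℝ ∞ r (slab n T) → ZeroData r →
      Continuous g →
      (∀ p : Spacetime n, 0 < p.1 → p.1 < T' → ‖p.2 - x₀‖ < ρ - p.1 →
        ‖dalembert r p‖ ≤ M * firstOrder r p + g p) →
      MeasureTheory.IntegrableOn
        (fun p => coneWeight lam T' ρ x₀ p * energyDensity (fun p => e (r p)) p)
        {p | 0 < p.1 ∧ p.1 < T'} ∧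
      ∫ p in {p | 0 < p.1 ∧ p.1 < T'},
        coneWeight lam T' ρ x₀ p * energyDensity (fun p => e (r p)) p ≤
        ∫ p in {p | 0 < p.1 ∧ p.1 < T'},
          coneWeight lam T' ρ x₀ p * (‖(e : V →L[ℝ] H)‖ * g p) ^ 2 / 2 := by
  set M' := ‖(e : V →L[ℝ] H)‖ * (M * ‖(e.symm : H →L[ℝ] V)‖) with hM'
  refine ⟨M' * (n + 3) + 3, fun r g hr h0 hg hb => ?_⟩
  refine energy_estimate hT0 hT' hρ (by positivity) x₀ (e.contDiff.comp_contDiffOn hr)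
    (h0.equiv e).1 (h0.equiv e).2 (by fun_prop) fun p h1 h2 h3 => ?_
  rw [show (e ∘ r : Spacetime n → H) = fun p => e (r p) from rfl, dalembert_equiv]
  calc ‖e (dalembert r p)‖ ≤ ‖(e : V →L[ℝ] H)‖ * ‖dalembert r p‖ := (e : V →L[ℝ] H).le_opNorm _
    _ ≤ ‖(e : V →L[ℝ] H)‖ * (M * (‖(e.symm : H →L[ℝ] V)‖ * firstOrder (fun p => e (r p)) p) + g p) := by
        gcongr
        refine (hb p h1 h2 h3).trans ?_
        gcongr
        exact firstOrder_le_equiv e r p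
    _ = _ := by rw [hM']; ring

theorem continuousOn_energyDensity {T : ℝ} {r : Spacetime n → H} (hr : ContDiffOn ℝ ∞ r (slab n T)) :
    ContinuousOn (energyDensity r) (Ioo 0 T ×ˢ univ) := by
  have hO : IsOpen (Ioo 0 T ×ˢ (univ : Set (EuclideanSpace ℝ (Fin n)))) := isOpen_Ioo.prod isOpen_univ
  have hr' : ContDiffOn ℝ ∞ r (Ioo 0 T ×ˢ univ) := hr.mono (prod_mono Ioo_subset_Ico_self le_rfl)
  have hf := hr'.continuousOn_fderiv_of_isOpen hO (by simp)
  unfold energyDensity dpart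
  have := hr'.continuousOn
  fun_prop

theorem continuousOn_firstOrder {T : ℝ} {r : Spacetime n → V} (hr : ContDiffOn ℝ ∞ r (slab n T)) :
    ContinuousOn (firstOrder r) (Ioo 0 T ×ˢ univ) := by
  have hO : IsOpen (Ioo 0 T ×ˢ (univ : Set (EuclideanSpace ℝ (Fin n)))) := isOpen_Ioo.prod isOpen_univ
  have hr' : ContDiffOn ℝ ∞ r (Ioo 0 T ×ˢ univ) := hr.mono (prod_mono Ioo_subset_Ico_self le_rfl)
  have hf := hr'.continuousOn_fderiv_of_isOpen hO (by simp)
  unfold firstOrder dpart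
  have := hr'.continuousOn
  fun_prop

/-- Domain of dependence: a function with zero Cauchy data satisfying a homogeneous differential
inequality in a backward light cone vanishes there. -/
theorem eq_zero_of_cone (e : V ≃L[ℝ] H) {T T' ρ M : ℝ} (hT0 : 0 < T') (hT' : T' < T)
    (hρ : T' ≤ ρ) (hM : 0 ≤ M) (x₀ : EuclideanSpace ℝ (Fin n)) {r : Spacetime n → V}
    (hr : ContDiffOn ℝ ∞ r (slab n T)) (h0 : ZeroData r)
    (hb : ∀ p : Spacetime n, 0 < p.1 → p.1 < T' → ‖p.2 - x₀‖ < ρ - p.1 →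
      ‖dalembert r p‖ ≤ M * firstOrder r p)
    {p : Spacetime n} (hp0 : 0 ≤ p.1) (hpT : p.1 < T') (hp : ‖p.2 - x₀‖ < ρ - p.1) : r p = 0 := by
  rcases hp0.eq_or_lt with h | h
  · have : p = (0, p.2) := Prod.ext h.symm rfl
    rw [this]; exact h0.1 _
  obtain ⟨lam, hlam⟩ := energy_estimate_equiv e hT0 hT' hρ hM x₀
  -- With `g = 0` the weighted energy has nonpositive integral; being nonnegative it vanishes almost
  -- everywhere, and everywhere in the open slab by continuity.
  obtain ⟨hi, hle⟩ := hlam r (fun _ => 0) hr h0 continuous_const (by simpa using hb)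
  set O : Set (Spacetime n) := {p | 0 < p.1 ∧ p.1 < T'} with hO
  have hOo : IsOpen O := (isOpen_lt continuous_const continuous_fst).inter
    (isOpen_lt continuous_fst continuous_const)
  set G := fun p => coneWeight lam T' ρ x₀ p * energyDensity (fun p => e (r p)) p with hG
  have hG0 : ∀ p, 0 ≤ G p := fun p => mul_nonneg (coneWeight_nonneg _ _ _ _ _) (energyDensity_nonneg _ _)
  have hz : ∫ p in O, G p = 0 :=
    le_antisymm (by simpa using hle) (MeasureTheory.integral_nonneg hG0)
  have hae : G =ᵐ[MeasureTheory.volume.restrict O] 0 :=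
    (MeasureTheory.integral_eq_zero_iff_of_nonneg hG0 hi).1 hz
  have hGc : ContinuousOn G O := by
    refine (contDiff_coneWeight lam T' ρ x₀).continuous.continuousOn.mul
      ((continuousOn_energyDensity (e.contDiff.comp_contDiffOn hr)).mono fun q hq => ?_)
    exact ⟨⟨hq.1, hq.2.trans hT'⟩, mem_univ _⟩
  have hGz := MeasureTheory.Measure.eqOn_open_of_ae_eq hae hOo hGc continuousOn_const
  have hp1 : G p = 0 := hGz ⟨h, hpT⟩
  have hW := coneWeight_pos (lam := lam) hpT hp
  have he : energyDensity (fun p => e (r p)) p = 0 := by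
    rcases mul_eq_zero.1 hp1 with h' | h'
    · exact absurd h' hW.ne'
    · exact h'
  have h2 : ‖e (r p)‖ ^ 2 ≤ 0 := by
    unfold energyDensity at he
    have : 0 ≤ ∑ j : Fin (n + 1), ‖dpart j (fun p => e (r p)) p‖ ^ 2 := by positivity
    linarith
  simpa using h2.antisymm (sq_nonneg _)

/-- A local bound on functions with zero Cauchy data in terms of the size of `□r`. -/
theorem exists_firstOrder_bound (e : V ≃L[ℝ] H) {T : ℝ} {K : Set (Spacetime n)}
    (hK : IsCompact K) (hKT : K ⊆ Ioo 0 T ×ˢ univ) :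
    ∃ T' ρ : ℝ, T' < T ∧ ∀ (M : ℝ) (g : Spacetime n → ℝ), 0 ≤ M → Continuous g →
      ∃ C : ℝ, ∀ r : Spacetime n → V, ContDiffOn ℝ ∞ r (slab n T) → ZeroData r →
        (∀ p : Spacetime n, 0 < p.1 → p.1 < T' → ‖p.2‖ < ρ →
          ‖dalembert r p‖ ≤ M * firstOrder r p + g p) →
        ∫ p in K, firstOrder r p ≤ C := by
  rcases K.eq_empty_or_nonempty with rfl | hne
  · exact ⟨T - 1, 0, by linarith, fun _ _ _ _ => ⟨0, fun _ _ _ _ => by simp⟩⟩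
  obtain ⟨p₁, hp₁, hmax⟩ := hK.exists_isMaxOn hne continuous_fst.continuousOn
  obtain ⟨p₂, hp₂, hmax2⟩ := hK.exists_isMaxOn hne (continuous_snd.norm).continuousOn
  have ht := (hKT hp₁).1
  -- `T'` and `ρ` depend only on `K` and `T`: the truncated cone with vertex `(ρ, 0)` contains `K`.
  -- Coefficient bounds on that region can therefore be fixed afterwards.
  set T' := (p₁.1 + T) / 2 with hT'def
  have hT'1 : p₁.1 < T' := by linarith [ht.2]
  have hT'2 : T' < T := by linarith [ht.2]
  have hT'0 : 0 < T' := ht.1.trans hT'1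
  set ρ := ‖p₂.2‖ + T' + 1 with hρ
  refine ⟨T', ρ, hT'2, fun M g hM hg => ?_⟩
  obtain ⟨lam, hlam⟩ := energy_estimate_equiv e hT'0 hT'2
    (by rw [hρ]; linarith [norm_nonneg p₂.2] : T' ≤ ρ) hM (0 : EuclideanSpace ℝ (Fin n))
  set W := coneWeight lam T' ρ (0 : EuclideanSpace ℝ (Fin n)) with hW
  have hWc : Continuous W := (contDiff_coneWeight _ _ _ _).continuous
  have hK1 : ∀ p ∈ K, p.1 < T' := fun p hp => (hmax hp).trans_lt hT'1
  have hWpos : ∀ p ∈ K, 0 < W p := fun p hp => by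
    refine coneWeight_pos (hK1 p hp) ?_
    have h1 : ‖p.2‖ ≤ ‖p₂.2‖ := hmax2 hp
    rw [sub_zero]; linarith [hK1 p hp]
  obtain ⟨p₃, hp₃, hmin⟩ := hK.exists_isMinOn hne hWc.continuousOn
  set c := W p₃ with hc
  have hc0 : 0 < c := hWpos _ hp₃
  set s := ‖(e.symm : H →L[ℝ] V)‖
  set O : Set (Spacetime n) := {p | 0 < p.1 ∧ p.1 < T'} with hO
  have hKO : K ⊆ O := fun p hp => ⟨(hKT hp).1.1, hK1 p hp⟩
  refine ⟨(∫ _ in K, s) + s * (2 * (n + 2) / c) * ∫ p in O, W p * (‖(e : V →L[ℝ] H)‖ * g p) ^ 2 / 2,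
    fun r hr h0 hb => ?_⟩
  obtain ⟨hi, hle⟩ := hlam r g hr h0 hg fun p h1 h2 h3 => hb p h1 h2 (by
    rw [sub_zero] at h3; linarith)
  set G := fun p => W p * energyDensity (fun p => e (r p)) p with hG
  have hG0 : ∀ p, 0 ≤ G p := fun p => mul_nonneg (coneWeight_nonneg _ _ _ _ _) (energyDensity_nonneg _ _)
  have hiK : MeasureTheory.IntegrableOn G K := hi.mono_set hKO
  have hs0 : 0 ≤ s := norm_nonneg _
  have hconst : MeasureTheory.IntegrableOn (fun _ : Spacetime n => s) K :=
    continuousOn_const.integrableOn_compact hK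
  -- `b ≤ 1 + b²` passes from the quadratic energy to the linear size, and on `K` the weight is at
  -- least its minimum `c > 0`.
  have hpt : ∀ p ∈ K, firstOrder r p ≤ s + s * (2 * (n + 2) / c) * G p := fun p hp => by
    set b := firstOrder (fun p => e (r p)) p with hbdef
    set E := energyDensity (fun p => e (r p)) p with hE
    have h1 : b ^ 2 ≤ (n + 2) * (2 * E) := firstOrder_sq_le _ _
    have h2 : E ≤ G p / c := by
      rw [le_div_iff₀ hc0, mul_comm]
      exact mul_le_mul_of_nonneg_right (hmin hp) (energyDensity_nonneg _ _)
    calc firstOrder r p ≤ s * b := firstOrder_le_equiv e r p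
      _ ≤ s * (1 + (n + 2) * (2 * (G p / c))) := by
          gcongr
          have : (n + 2) * (2 * E) ≤ (n + 2) * (2 * (G p / c)) := by gcongr
          nlinarith [sq_nonneg (b - 1 / 2)]
      _ = _ := by ring
  calc ∫ p in K, firstOrder r p ≤ ∫ p in K, (s + s * (2 * (n + 2) / c) * G p) :=
        MeasureTheory.setIntegral_mono_on
          (((continuousOn_firstOrder hr).mono hKT).integrableOn_compact hK)
          (hconst.add (hiK.const_mul _)) hK.measurableSet hpt
    _ = (∫ _ in K, s) + s * (2 * (n + 2) / c) * ∫ p in K, G p := by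
        rw [MeasureTheory.integral_add hconst (hiK.const_mul _), MeasureTheory.integral_const_mul]
    _ ≤ _ := by
        gcongr
        refine le_trans ?_ hle
        exact MeasureTheory.setIntegral_mono_set hi (Filter.Eventually.of_forall hG0)
          (Filter.Eventually.of_forall hKO)

end EnergyConsequences

/-! ### Finite propagation speed and existence for the Cauchy problem -/

section Existence

variable {n N : ℕ}

/-- The real linear identification of `ℂ^N` with its Euclidean version. -/
def vecEquiv (N : ℕ) : (Fin N → ℂ) ≃L[ℝ] EuclideanSpace ℂ (Fin N) :=
  (PiLp.continuousLinearEquiv 2 ℝ fun _ : Fin N => ℂ).symm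

/-- The lower order part of the wave operator. -/
def lowerOrder (A : Fin (n + 1) → Spacetime n → (Fin N → ℂ) →L[ℂ] (Fin N → ℂ))
    (Q : Spacetime n → (Fin N → ℂ) →L[ℂ] (Fin N → ℂ)) (u : Spacetime n → Fin N → ℂ)
    (p : Spacetime n) : Fin N → ℂ :=
  (2 : ℂ) • ∑ j : Fin (n + 1), A j p (dpart j u p) + Q p (u p)

theorem waveOpCLM_eq (A : Fin (n + 1) → Spacetime n → (Fin N → ℂ) →L[ℂ] (Fin N → ℂ))
    (Q : Spacetime n → (Fin N → ℂ) →L[ℂ] (Fin N → ℂ)) (u : Spacetime n → Fin N → ℂ)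
    (p : Spacetime n) : waveOpCLM A Q u p = dalembert u p + lowerOrder A Q u p := by
  unfold waveOpCLM dalembert lowerOrder
  rw [← add_assoc]; rfl

variable {A : Fin (n + 1) → Spacetime n → (Fin N → ℂ) →L[ℂ] (Fin N → ℂ)}
  {Q : Spacetime n → (Fin N → ℂ) →L[ℂ] (Fin N → ℂ)}

theorem exists_lowerOrder_bound (hA : ∀ j, Continuous (A j)) (hQ : Continuous Q)
    {B : Set (Spacetime n)} (hB : IsCompact B) :
    ∃ M : ℝ, 0 ≤ M ∧ ∀ p ∈ B, ∀ u : Spacetime n → Fin N → ℂ,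
      ‖lowerOrder A Q u p‖ ≤ M * firstOrder u p := by
  have hc : Continuous fun p => 2 * ∑ j, ‖A j p‖ + ‖Q p‖ := by fun_prop
  obtain ⟨M, hM⟩ := hB.exists_bound_of_continuousOn hc.continuousOn
  refine ⟨max M 0, le_max_right _ _, fun p hp u => ?_⟩
  have h1 : 2 * ∑ j, ‖A j p‖ + ‖Q p‖ ≤ max M 0 :=
    (le_abs_self _).trans ((hM p hp).trans (le_max_left _ _))
  have hj : ∀ j, ‖dpart j u p‖ ≤ firstOrder u p := fun j => by
    have := Finset.single_le_sum (f := fun j => ‖dpart j u p‖) (fun j _ => norm_nonneg _)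
      (Finset.mem_univ j)
    unfold firstOrder
    linarith [norm_nonneg (u p)]
  have h0 : ‖u p‖ ≤ firstOrder u p := by
    unfold firstOrder
    have : 0 ≤ ∑ j : Fin (n + 1), ‖dpart j u p‖ := by positivity
    linarith
  calc ‖lowerOrder A Q u p‖ ≤ 2 * ∑ j, ‖A j p‖ * firstOrder u p + ‖Q p‖ * firstOrder u p := by
        refine (norm_add_le _ _).trans (add_le_add ?_ ?_)
        · rw [norm_smul]
          refine mul_le_mul (by simp) (norm_sum_le_of_le _ fun j _ => ?_) (norm_nonneg _) (by simp)
          exact ((A j p).le_opNorm _).trans (by gcongr; exact hj j)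
        · exact ((Q p).le_opNorm _).trans (by gcongr)
    _ = (2 * ∑ j, ‖A j p‖ + ‖Q p‖) * firstOrder u p := by rw [add_mul, mul_assoc, Finset.sum_mul]
    _ ≤ _ := mul_le_mul_of_nonneg_right h1 (firstOrder_nonneg _ _)

theorem norm_dalembert_le {M : ℝ} {u : Spacetime n → Fin N → ℂ} {p : Spacetime n}
    (h : ‖lowerOrder A Q u p‖ ≤ M * firstOrder u p) :
    ‖dalembert u p‖ ≤ M * firstOrder u p + ‖waveOpCLM A Q u p‖ := by
  have h1 : dalembert u p = waveOpCLM A Q u p - lowerOrder A Q u p := by rw [waveOpCLM_eq]; simp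
  rw [h1]
  linarith [norm_sub_le (waveOpCLM A Q u p) (lowerOrder A Q u p)]

/-- The coefficients are bounded on a compact set containing the truncated cone, so the equation
implies the differential inequality of `eq_zero_of_cone`. Only the equation inside the cone matters:
this is finite propagation speed. -/
theorem wave_eq_zero_of_cone (hA : ∀ j, Continuous (A j)) (hQ : Continuous Q) {T ρ : ℝ}
    (hρ : T ≤ ρ) (x₀ : EuclideanSpace ℝ (Fin n)) {u : Spacetime n → Fin N → ℂ}
    (hu : ContDiffOn ℝ ∞ u (slab n T)) (h0 : ZeroData u)
    (hb : ∀ p : Spacetime n, 0 < p.1 → p.1 < T → ‖p.2 - x₀‖ < ρ - p.1 → waveOpCLM A Q u p = 0)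
    {p : Spacetime n} (hp0 : 0 ≤ p.1) (hpT : p.1 < T) (hp : ‖p.2 - x₀‖ < ρ - p.1) : u p = 0 := by
  obtain ⟨M, hM, hMb⟩ := exists_lowerOrder_bound hA hQ
    (isCompact_Icc.prod (isCompact_closedBall x₀ ρ) : IsCompact (Icc 0 T ×ˢ Metric.closedBall x₀ ρ))
  -- The energy argument needs a final time strictly before `T`; the midpoint still lies after the
  -- time of `p`.
  refine eq_zero_of_cone (vecEquiv N) (T' := (p.1 + T) / 2) (by linarith) (by linarith) (by linarith)
    hM x₀ hu h0 (fun q h1 h2 h3 => ?_) hp0 (by linarith) hp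
  have hq : q ∈ Icc 0 T ×ˢ Metric.closedBall x₀ ρ :=
    ⟨⟨h1.le, by linarith⟩, by rw [mem_closedBall_iff_norm]; linarith⟩
  have := norm_dalembert_le (hMb q hq u)
  rwa [hb q h1 (by linarith) h3, norm_zero, add_zero] at this

/-- The constant is chosen before `u`. Applied to geometric optics remainders, it therefore gives a
bound uniform in the frequency. -/
theorem exists_wave_bound (hA : ∀ j, Continuous (A j)) (hQ : Continuous Q) {T : ℝ}
    {K : Set (Spacetime n)} (hK : IsCompact K) (hKT : K ⊆ Ioo 0 T ×ˢ univ) {g : Spacetime n → ℝ}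
    (hg : Continuous g) :
    ∃ C : ℝ, ∀ u : Spacetime n → Fin N → ℂ, ContDiffOn ℝ ∞ u (slab n T) → ZeroData u →
      (∀ p ∈ Ioo 0 T ×ˢ (univ : Set (EuclideanSpace ℝ (Fin n))), ‖waveOpCLM A Q u p‖ ≤ g p) →
      ∫ p in K, firstOrder u p ≤ C := by
  obtain ⟨T', ρ, hT', h⟩ := exists_firstOrder_bound (vecEquiv N) hK hKT
  obtain ⟨M, hM, hMb⟩ := exists_lowerOrder_bound hA hQ
    (isCompact_Icc.prod (isCompact_closedBall 0 ρ) :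
      IsCompact (Icc 0 T' ×ˢ Metric.closedBall (0 : EuclideanSpace ℝ (Fin n)) ρ))
  obtain ⟨C, hC⟩ := h M g hM hg
  refine ⟨C, fun u hu h0 hb => hC u hu h0 fun p h1 h2 h3 => ?_⟩
  have hq : p ∈ Icc 0 T' ×ˢ Metric.closedBall (0 : EuclideanSpace ℝ (Fin n)) ρ :=
    ⟨⟨h1.le, h2.le⟩, by rw [mem_closedBall_zero_iff]; exact h3.le⟩
  exact (norm_dalembert_le (hMb p hq u)).trans
    (by gcongr; exact hb p ⟨⟨h1, h2.trans hT'⟩, mem_univ _⟩)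

theorem dpart_congr {V : Type*} [NormedAddCommGroup V] [NormedSpace ℝ V] {u v : Spacetime n → V}
    {p : Spacetime n} (h : u =ᶠ[nhds p] v) (j : Fin (n + 1)) : dpart j u =ᶠ[nhds p] dpart j v := by
  filter_upwards [h.eventuallyEq_nhds] with q hq
  simp only [dpart]
  rw [hq.fderiv_eq]

theorem waveOpCLM_congr {u v : Spacetime n → Fin N → ℂ} {p : Spacetime n} (h : u =ᶠ[nhds p] v) :
    waveOpCLM A Q u p = waveOpCLM A Q v p := by
  have h1 : ∀ j, dpart j u p = dpart j v p := fun j => (dpart_congr h j).eq_of_nhds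
  have h2 : ∀ j, dpart j (dpart j u) p = dpart j (dpart j v) p := fun j =>
    (dpart_congr (dpart_congr h j) j).eq_of_nhds
  simp only [waveOpCLM_eq, dalembert, lowerOrder, h1, h2, h.eq_of_nhds]

theorem dpart_const_zero {V : Type*} [NormedAddCommGroup V] [NormedSpace ℝ V] (j : Fin (n + 1)) :
    dpart j (fun _ : Spacetime n => (0 : V)) = fun _ => 0 := by
  funext p; simp [dpart]

theorem waveOpCLM_zero (p : Spacetime n) : waveOpCLM A Q (fun _ => 0) p = 0 := by
  simp [waveOpCLM_eq, dalembert, lowerOrder, dpart_const_zero]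

theorem abs_apply_le_norm {d : ℕ} (x : EuclideanSpace ℝ (Fin d)) (i : Fin d) : |x i| ≤ ‖x‖ := by
  simpa using PiLp.norm_apply_le x i

/-- Existence for the Cauchy problem with zero data and a compactly supported source. -/
theorem exists_wave_solution (hA : ∀ j, ContDiff ℝ ∞ (A j)) (hQ : ContDiff ℝ ∞ Q) {T : ℝ}
    {f : Spacetime n → Fin N → ℂ} (hf : ContDiff ℝ ∞ f) (hfc : HasCompactSupport f)
    (hfT : tsupport f ⊆ Ioo 0 T ×ˢ univ) :
    ∃ u : Spacetime n → Fin N → ℂ, ContDiffOn ℝ ∞ u (slab n T) ∧ ZeroData u ∧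
      ∀ p ∈ Ioo 0 T ×ˢ (univ : Set (EuclideanSpace ℝ (Fin n))), waveOpCLM A Q u p = f p := by
  rcases le_or_gt T 0 with hT | hT
  · refine ⟨fun _ => 0, contDiffOn_const, ⟨fun _ => rfl, fun x => hasDerivWithinAt_const _ _ _⟩,
      fun p hp => ?_⟩
    exact absurd (hp.1.1.trans hp.1.2) (not_lt.2 hT)
  obtain ⟨R0', hR0'⟩ := hfc.isCompact.isBounded.exists_norm_le
  set R0 := max R0' 0
  have hR00 : 0 ≤ R0 := le_max_right _ _
  have hfR : ∀ p, R0 < ‖p.2‖ → f p = 0 := fun p hp => by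
    by_contra h
    have h1 := hR0' p (subset_tsupport f h)
    have h2 : ‖p.2‖ ≤ ‖p‖ := norm_snd_le p
    linarith [le_max_left R0' 0]
  -- Scales: waves from the source stay in `‖x‖ ≤ R0 + T < ρ1`; the cutoff `χ` is supported in `‖x‖
  -- ≤ 2 * ρ1`; the coefficients are unchanged for `‖p‖ ≤ R1`; the period box has half-side `R`.
  set ρ1 := R0 + T + 1 with hρ1
  set R1 := 2 * ρ1 + T + 1 with hR1
  set R := 2 * R1 + 1 with hR
  have hρ10 : 0 < ρ1 := by linarith
  have hR10 : 0 < R1 := by linarith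
  obtain ⟨ζ, hζ, hζ1, hζs, -⟩ := exists_cutoff (X := Spacetime n) hR10
  obtain ⟨χ, hχ, hχ1, hχs, -⟩ := exists_cutoff (X := EuclideanSpace ℝ (Fin n)) hρ10
  have hbox : Metric.closedBall (0 : Spacetime n) (2 * R1) ⊆ {p | |p.1| < R ∧ ∀ i, |p.2 i| < R} := by
    intro p hp
    rw [mem_closedBall_zero_iff] at hp
    refine ⟨?_, fun i => ?_⟩
    · have := norm_fst_le p
      rw [Real.norm_eq_abs] at this; linarith
    · have := norm_snd_le p
      linarith [abs_apply_le_norm p.2 i]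
  have hζA : ∀ (B : Spacetime n → (Fin N → ℂ) →L[ℂ] (Fin N → ℂ)),
      tsupport (fun p => ζ p • B p) ⊆ {p | |p.1| < R ∧ ∀ i, |p.2 i| < R} := fun B =>
    (closure_mono (Function.support_smul_subset_left ζ B)).trans (hζs.trans hbox)
  obtain ⟨u, hu, hu0, hu1, hue⟩ := exists_periodic_wave (A := fun j p => ζ p • A j p)
    (Q := fun p => ζ p • Q p) (f := f) (R := R) (fun j => hζ.smul (hA j)) (hζ.smul hQ) hf (by linarith)
    (fun j => hζA _) (hζA _) (fun p hp => by
      have h1 := (hfT hp).1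
      have h2 := hR0' p hp
      have h3 := norm_snd_le p
      refine ⟨by rw [abs_lt]; constructor <;> linarith [h1.1, h1.2], fun i => ?_⟩
      linarith [abs_apply_le_norm p.2 i, le_max_left R0' 0])
  have hsub : slab n T ⊆ Ioo (-R) R ×ˢ univ := fun p hp =>
    ⟨⟨by linarith [(mem_slab.1 hp).1], by linarith [(mem_slab.1 hp).2]⟩, mem_univ _⟩
  have hus : ContDiffOn ℝ ∞ u (slab n T) := hu.mono hsub
  have hud : ZeroData u := ⟨hu0, fun x => (hu1 x).hasDerivWithinAt⟩
  -- The backward cone from `p` stays in `R0 < ‖x‖ < R`, where the source is zero and the equation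
  -- with cut off coefficients holds.
  have hzero : ∀ p : Spacetime n, 0 ≤ p.1 → p.1 < T → R0 + T < ‖p.2‖ → ‖p.2‖ < R - T → u p = 0 := by
    intro p h1 h2 h3 h4
    refine wave_eq_zero_of_cone (A := fun j p => ζ p • A j p) (Q := fun p => ζ p • Q p)
      (fun j => (hζ.smul (hA j)).continuous) (hζ.smul hQ).continuous
      (le_refl T) p.2 hus hud (fun q g1 g2 g3 => ?_) h1 h2 (by simpa using h2)
    have h5 : ‖q.2‖ ≤ ‖p.2‖ + ‖q.2 - p.2‖ := by
      have := norm_add_le p.2 (q.2 - p.2); simpa using this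
    have h6 : ‖p.2‖ ≤ ‖q.2‖ + ‖q.2 - p.2‖ := by
      have := norm_sub_le q.2 (q.2 - p.2); simpa using this
    rw [hue q (by rw [abs_lt]; constructor <;> linarith) fun i => by
      linarith [abs_apply_le_norm q.2 i]]
    exact hfR q (by linarith)
  -- Truncation discards the periodic copies and introduces no error, because `u` already vanishes
  -- in the slab where `χ` varies.
  set v : Spacetime n → Fin N → ℂ := fun p => χ p.2 • u p with hv
  have hvz : ∀ p : Spacetime n, 0 ≤ p.1 → p.1 < T → R0 + T < ‖p.2‖ → v p = 0 := by
    intro p h1 h2 h3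
    rcases lt_or_ge ‖p.2‖ (R - T) with h | h
    · simp [hv, hzero p h1 h2 h3 h]
    · have : χ p.2 = 0 := by
        by_contra hne
        have := hχs (subset_tsupport χ hne)
        rw [mem_closedBall_zero_iff] at this
        linarith
      simp [hv, this]
  refine ⟨v, (hχ.comp contDiff_snd).contDiffOn.smul hus, ⟨fun x => by simp [hv, hu0], fun x => ?_⟩,
    fun p hp => ?_⟩
  · have := ((hu1 x).const_smul (χ x)).hasDerivWithinAt (s := Ici 0)
    rw [smul_zero] at this
    exact this
  · have ht := hp.1
    rcases lt_or_ge ‖p.2‖ ρ1 with h | h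
    · have he : v =ᶠ[nhds p] u := by
        filter_upwards [(continuous_snd.norm).continuousAt.eventually (gt_mem_nhds h)] with q hq
        simp [hv, hχ1 _ (le_of_lt hq)]
      have hp1 : ‖p‖ ≤ R1 := by
        refine max_le ?_ ?_
        · rw [Real.norm_eq_abs, abs_le]; constructor <;> linarith [ht.1, ht.2]
        · linarith
      have h2 := hue p (by rw [abs_lt]; constructor <;> linarith [ht.1, ht.2]) fun i => by
        linarith [abs_apply_le_norm p.2 i]
      rw [waveOpCLM_congr he, ← h2]
      simp only [waveOpCLM, hζ1 p hp1, one_smul]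
    · have he : v =ᶠ[nhds p] fun _ => 0 := by
        filter_upwards [(continuous_snd.norm).continuousAt.eventually
          (lt_mem_nhds (show R0 + T < ‖p.2‖ by linarith)),
          continuous_fst.continuousAt.eventually (lt_mem_nhds ht.1),
          continuous_fst.continuousAt.eventually (gt_mem_nhds ht.2)] with q h1 h2 h3
        exact hvz q (le_of_lt h2) h3 h1
      rw [waveOpCLM_congr he, waveOpCLM_zero, hfR p (by linarith)]

/-- A matrix as a continuous linear operator. -/
def opCLM (m : Matrix (Fin N) (Fin N) ℂ) : (Fin N → ℂ) →L[ℂ] (Fin N → ℂ) :=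
  LinearMap.toContinuousLinearMap (Matrix.mulVecLin m)

@[simp] theorem opCLM_apply (m : Matrix (Fin N) (Fin N) ℂ) (v : Fin N → ℂ) :
    opCLM m v = m.mulVec v := rfl

theorem opCLM_mul (m m' : Matrix (Fin N) (Fin N) ℂ) : opCLM (m * m') = opCLM m * opCLM m' := by
  ext v : 1; simp

theorem opCLM_one : opCLM (1 : Matrix (Fin N) (Fin N) ℂ) = 1 := by
  ext v : 1; simp

theorem opCLM_eq_sum (m : Matrix (Fin N) (Fin N) ℂ) :
    opCLM m = ∑ a, ∑ b, m a b • opCLM (Matrix.single a b 1) := by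
  ext v c
  simp only [opCLM_apply, sum_apply, smul_apply, Matrix.mulVec, dotProduct, Finset.sum_apply,
    Pi.smul_apply, smul_eq_mul, Matrix.single_apply]
  symm
  rw [Finset.sum_eq_single c]
  · refine Finset.sum_congr rfl fun b _ => ?_
    simp
  · intro a _ ha; simp [ha]
  · simp

/-- Smoothness is hypothesised entrywise; expansion in matrix units carries it over to the operator
norm. -/
theorem contDiff_opCLM {E : Type*} [NormedAddCommGroup E] [NormedSpace ℝ E] {k : ℕ∞ω}
    {m : E → Matrix (Fin N) (Fin N) ℂ} (hm : ∀ a b, ContDiff ℝ k fun p => m p a b) :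
    ContDiff ℝ k fun p => opCLM (m p) := by
  simp_rw [fun p => opCLM_eq_sum (m p)]
  exact ContDiff.sum fun a _ => ContDiff.sum fun b _ => (hm a b).smul contDiff_const

theorem waveOp_eq (A : Fin (n + 1) → Spacetime n → Matrix (Fin N) (Fin N) ℂ)
    (Q : Spacetime n → Matrix (Fin N) (Fin N) ℂ) (u : Spacetime n → Fin N → ℂ) :
    waveOp A Q u = waveOpCLM (fun j p => opCLM (A j p)) (fun p => opCLM (Q p)) u := rfl

/-- Existence makes the choice in `waveSolution` a genuine solution. Nothing more about the choice
is needed, as the later estimates hold for every solution with zero data. -/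
theorem isWaveSolution_waveSolution {A : Fin (n + 1) → Spacetime n → Matrix (Fin N) (Fin N) ℂ}
    {Q : Spacetime n → Matrix (Fin N) (Fin N) ℂ} (hA : ∀ j a b, ContDiff ℝ ∞ fun p => A j p a b)
    (hQ : ∀ a b, ContDiff ℝ ∞ fun p => Q p a b) {T : ℝ} {Ω : Set (EuclideanSpace ℝ (Fin n))}
    (f : Source n N T Ω) : IsWaveSolution T A Q f.1 (waveSolution T A Q f.1) := by
  obtain ⟨u, h1, h2, h3⟩ := exists_wave_solution (fun j => contDiff_opCLM (hA j)) (contDiff_opCLM hQ)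
    f.2.1 f.2.2.1 (f.2.2.2.trans (prod_mono le_rfl (subset_univ _)))
  have h : ∃ u, IsWaveSolution T A Q f.1 u := ⟨u, h1, fun p hp => by rw [waveOp_eq]; exact h3 p hp, h2.1, h2.2⟩
  unfold waveSolution
  rw [dif_pos h]
  exact h.choose_spec

end Existence

/-! ### Operator-valued test functions, Green's formula, oscillating factors -/

section Pairing

variable {n N : ℕ}

/-- Operators on `ℂ^N`. -/
abbrev Op (N : ℕ) : Type := (Fin N → ℂ) →L[ℂ] (Fin N → ℂ)

/-- The evaluation pairing as a real bilinear map. -/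
def evalPairing (N : ℕ) : Op N →L[ℝ] (Fin N → ℂ) →L[ℝ] (Fin N → ℂ) :=
  ContinuousLinearMap.restrictScalarsL ℂ (Fin N → ℂ) (Fin N → ℂ) ℝ ℝ

theorem contDiffAt_clm_apply {E : Type*} [NormedAddCommGroup E] [NormedSpace ℝ E] {k : ℕ∞ω}
    {B : E → Op N} {z : E → Fin N → ℂ} {p : E} (hB : ContDiffAt ℝ k B p) (hz : ContDiffAt ℝ k z p) :
    ContDiffAt ℝ k (fun p => B p (z p)) p :=
  ((evalPairing N).contDiff.contDiffAt.comp p hB).clm_apply hz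

theorem contDiff_clm_apply {E : Type*} [NormedAddCommGroup E] [NormedSpace ℝ E] {k : ℕ∞ω}
    {B : E → Op N} {z : E → Fin N → ℂ} (hB : ContDiff ℝ k B) (hz : ContDiff ℝ k z) :
    ContDiff ℝ k (fun p => B p (z p)) :=
  contDiff_iff_contDiffAt.2 fun _ => contDiffAt_clm_apply hB.contDiffAt hz.contDiffAt

/-- Smooth functions with compact support in `U`. -/
structure IsTest {V : Type*} [NormedAddCommGroup V] [NormedSpace ℝ V] (U : Set (Spacetime n))
    (b : Spacetime n → V) : Prop where
  smooth : ContDiff ℝ ∞ b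
  compact : HasCompactSupport b
  subset : tsupport b ⊆ U

namespace IsTest

variable {V W : Type*} [NormedAddCommGroup V] [NormedSpace ℝ V] [NormedAddCommGroup W]
  [NormedSpace ℝ W] {U : Set (Spacetime n)} {b : Spacetime n → V}

theorem of_support_subset (hb : IsTest U b) {b' : Spacetime n → W} (h : ContDiff ℝ ∞ b')
    (hs : ∀ p, b p = 0 → b' p = 0) : IsTest U b' := by
  have hsub : tsupport b' ⊆ tsupport b := closure_mono fun p hp h0 => hp (hs p h0)
  exact ⟨h, hb.compact.of_isClosed_subset (isClosed_tsupport _) hsub, hsub.trans hb.subset⟩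

theorem add {b' : Spacetime n → V} (hb : IsTest U b) (hb' : IsTest U b') :
    IsTest U fun p => b p + b' p :=
  ⟨hb.smooth.add hb'.smooth, hb.compact.add hb'.compact,
    (tsupport_add b b').trans (union_subset hb.subset hb'.subset)⟩

theorem sum {ι : Type*} (s : Finset ι) {b : ι → Spacetime n → V} (hb : ∀ i, IsTest U (b i)) :
    IsTest U fun p => ∑ i ∈ s, b i p := by
  classical
  induction s using Finset.induction_on with
  | empty => simp only [Finset.sum_empty]
             exact ⟨contDiff_const, HasCompactSupport.zero, by simp [tsupport, Function.support]⟩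
  | insert i s hi ih => simp_rw [Finset.sum_insert hi]; exact (hb i).add ih

theorem neg (hb : IsTest U b) : IsTest U fun p => -b p :=
  hb.of_support_subset hb.smooth.neg fun p hp => by simp [hp]

theorem dpart (hb : IsTest U b) (j : Fin (n + 1)) : IsTest U (dpart j b) := by
  have hsub : tsupport (MinkowskiWave.dpart j b) ⊆ tsupport b :=
    (closure_mono (t := Function.support (fderiv ℝ b)) fun p (hp : MinkowskiWave.dpart j b p ≠ 0) h0 =>
      hp (by simp [MinkowskiWave.dpart, show fderiv ℝ b p = 0 from h0])).trans (tsupport_fderiv_subset ℝ)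
  exact ⟨(hb.smooth.fderiv_right (by simp)).clm_apply contDiff_const,
    hb.compact.of_isClosed_subset (isClosed_tsupport _) hsub, hsub.trans hb.subset⟩

end IsTest

theorem contDiff_dpart {V : Type*} [NormedAddCommGroup V] [NormedSpace ℝ V] {u : Spacetime n → V}
    (hu : ContDiff ℝ ∞ u) (j : Fin (n + 1)) : ContDiff ℝ ∞ (dpart j u) :=
  (hu.fderiv_right (by simp)).clm_apply contDiff_const

theorem contDiffOn_dpart {V : Type*} [NormedAddCommGroup V] [NormedSpace ℝ V] {u : Spacetime n → V}
    {U : Set (Spacetime n)} (hU : IsOpen U) (hu : ContDiffOn ℝ ∞ u U) (j : Fin (n + 1)) :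
    ContDiffOn ℝ ∞ (dpart j u) U :=
  (hu.fderiv_of_isOpen hU (by simp)).clm_apply contDiffOn_const

variable {U : Set (Spacetime n)}

/-- Continuity of `z` is known only on `U`, but the closed support of `b` lies in `U`, so the
product is continuous everywhere, being zero near every point off that support. -/
theorem integrable_test {b : Spacetime n → Op N} (hb : IsTest U b) (hU : IsOpen U)
    {z : Spacetime n → Fin N → ℂ} (hz : ContinuousOn z U) :
    MeasureTheory.Integrable fun p => b p (z p) := by
  have hc : Continuous fun p => b p (z p) := by
    refine continuous_iff_continuousAt.2 fun p => ?_
    by_cases hp : p ∈ tsupport b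
    · have h1 := hz.continuousAt (hU.mem_nhds (hb.subset hp))
      have h2 := (evalPairing N).continuous.continuousAt.comp (hb.smooth.continuous.continuousAt (x := p))
      exact h2.clm_apply h1
    · have : (fun p => b p (z p)) =ᶠ[nhds p] fun _ => 0 := by
        filter_upwards [(isClosed_tsupport b).isOpen_compl.mem_nhds hp] with q hq
        simp [image_eq_zero_of_notMem_tsupport hq]
      exact continuousAt_const.congr this.symm
  exact hc.integrable_of_hasCompactSupport (HasCompactSupport.intro hb.compact fun p hp => by
    simp [image_eq_zero_of_notMem_tsupport hp])

theorem integral_test_fderiv {b : Spacetime n → Op N} (hb : IsTest U b) (hU : IsOpen U)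
    {z : Spacetime n → Fin N → ℂ} (hz : ContDiffOn ℝ ∞ z U) (v : Spacetime n) :
    ∫ p, b p (fderiv ℝ z p v) = -∫ p, (fderiv ℝ b p v) (z p) := by
  have hbv : IsTest U fun p => fderiv ℝ b p v := by
    have hsub : tsupport (fun p => fderiv ℝ b p v) ⊆ tsupport b :=
      (closure_mono (t := Function.support (fderiv ℝ b)) fun p (hp : fderiv ℝ b p v ≠ 0) h0 =>
        hp (by simp [show fderiv ℝ b p = 0 from h0])).trans (tsupport_fderiv_subset ℝ)
    exact ⟨(hb.smooth.fderiv_right (by simp)).clm_apply contDiff_const,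
      hb.compact.of_isClosed_subset (isClosed_tsupport _) hsub, hsub.trans hb.subset⟩
  exact integral_bilinear_fderiv_right_eq_neg_left_of_integrable (B := evalPairing N)
    (integrable_test hbv hU hz.continuousOn)
    (integrable_test hb hU ((hz.continuousOn_fderiv_of_isOpen hU (by simp)).clm_apply
      continuousOn_const))
    (integrable_test hb hU hz.continuousOn) (fun p _ => hb.smooth.differentiable (by simp) p)
    (fun p hp => (hz.contDiffAt (hU.mem_nhds (hb.subset hp))).differentiableAt (by simp))

theorem integral_test_dpart {b : Spacetime n → Op N} (hb : IsTest U b) (hU : IsOpen U)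
    {z : Spacetime n → Fin N → ℂ} (hz : ContDiffOn ℝ ∞ z U) (j : Fin (n + 1)) :
    ∫ p, b p (dpart j z p) = -∫ p, (dpart j b p) (z p) :=
  integral_test_fderiv hb hU hz _

variable {A : Fin (n + 1) → Spacetime n → Op N} {Q : Spacetime n → Op N}

theorem contDiff_mul_op {E : Type*} [NormedAddCommGroup E] [NormedSpace ℝ E] {B C : E → Op N}
    (hB : ContDiff ℝ ∞ B) (hC : ContDiff ℝ ∞ C) : ContDiff ℝ ∞ fun p => B p * C p :=
  hB.mul hC

theorem integral_combine {V : Type*} [NormedAddCommGroup V] [NormedSpace ℝ V]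
    {f₁ f₂ f₃ f₄ : Spacetime n → V} (h₁ : MeasureTheory.Integrable f₁) (h₂ : MeasureTheory.Integrable f₂)
    (h₃ : MeasureTheory.Integrable f₃) (h₄ : MeasureTheory.Integrable f₄) :
    ∫ p, (f₁ p - f₂ p + (f₃ p + f₃ p) + f₄ p) =
      (∫ p, f₁ p) - (∫ p, f₂ p) + ((∫ p, f₃ p) + ∫ p, f₃ p) + ∫ p, f₄ p := by
  rw [← MeasureTheory.integral_sub h₁ h₂, ← MeasureTheory.integral_add h₃ h₃]
  refine (MeasureTheory.integral_add ((h₁.sub h₂).add (h₃.add h₃)) h₄).trans ?_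
  congr 1
  exact MeasureTheory.integral_add (h₁.sub h₂) (h₃.add h₃)

/-- Green's formula: the wave operator can be moved onto an operator-valued test function. -/
theorem exists_green (hA : ∀ j, ContDiff ℝ ∞ (A j)) (hQ : ContDiff ℝ ∞ Q) (hU : IsOpen U)
    {b : Spacetime n → Op N} (hb : IsTest U b) :
    ∃ β : Spacetime n → Op N, IsTest U β ∧ ∀ z : Spacetime n → Fin N → ℂ, ContDiffOn ℝ ∞ z U →
      ∫ p, b p (waveOpCLM A Q z p) = ∫ p, β p (z p) := by
  have hbA : ∀ j, IsTest U fun p => b p * A j p := fun j =>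
    hb.of_support_subset (contDiff_mul_op hb.smooth (hA j)) fun p hp => by simp [hp]
  have hbQ : IsTest U fun p => b p * Q p :=
    hb.of_support_subset (contDiff_mul_op hb.smooth hQ) fun p hp => by simp [hp]
  -- The formal adjoint `∂_t²b - Δb - 2 ∑ ∂_j(bA_j) + bQ`, with coefficients acting from the right;
  -- the factor `2` is written as two equal sums to match `integral_combine`.
  let β : Spacetime n → Op N := fun p => dpart 0 (dpart 0 b) p +
    ∑ i : Fin n, -dpart i.succ (dpart i.succ b) p +
    (∑ j, -(dpart j (fun p => b p * A j p) p) + ∑ j, -(dpart j (fun p => b p * A j p) p)) + b p * Q p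
  have t0 := (hb.dpart 0).dpart 0
  have t1 : ∀ i : Fin n, IsTest U fun p => -dpart i.succ (dpart i.succ b) p := fun i =>
    ((hb.dpart i.succ).dpart i.succ).neg
  have t2 : ∀ j, IsTest U fun p => -(dpart j (fun p => b p * A j p) p) := fun j => ((hbA j).dpart j).neg
  refine ⟨β, ((t0.add (IsTest.sum _ t1)).add ((IsTest.sum _ t2).add (IsTest.sum _ t2))).add hbQ,
    fun z hz => ?_⟩
  have hz1 := fun j => contDiffOn_dpart hU hz j
  have hz2 := fun j => contDiffOn_dpart hU (hz1 j) j
  have hsec : ∀ j, ∫ p, b p (dpart j (dpart j z) p) = ∫ p, dpart j (dpart j b) p (z p) := fun j => by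
    rw [integral_test_dpart hb hU (hz1 j), integral_test_dpart (hb.dpart j) hU hz, neg_neg]
  have hi2 : ∀ j, MeasureTheory.Integrable fun p => b p (dpart j (dpart j z) p) := fun j =>
    integrable_test hb hU (hz2 j).continuousOn
  have hiA : ∀ j, MeasureTheory.Integrable fun p => b p (A j p (dpart j z p)) := fun j =>
    integrable_test (hbA j) hU (hz1 j).continuousOn
  have hiQ : MeasureTheory.Integrable fun p => b p (Q p (z p)) := integrable_test hbQ hU hz.continuousOn
  have hzc := hz.continuousOn
  have hA' : ∀ j, ∫ p, b p (A j p (dpart j z p)) = ∫ p, -(dpart j (fun p => b p * A j p) p) (z p) :=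
    fun j => by rw [MeasureTheory.integral_neg]; exact integral_test_dpart (hbA j) hU hz j
  have e1 : ∀ p, b p (waveOpCLM A Q z p) = b p (dpart 0 (dpart 0 z) p) -
      ∑ i : Fin n, b p (dpart i.succ (dpart i.succ z) p) +
      (∑ j, b p (A j p (dpart j z p)) + ∑ j, b p (A j p (dpart j z p))) + b p (Q p (z p)) := fun p => by
    rw [waveOpCLM_eq, dalembert, lowerOrder, two_smul]
    simp only [map_add, map_sub, map_sum]
    abel
  have e2 : ∀ p, β p (z p) = dpart 0 (dpart 0 b) p (z p) -
      ∑ i : Fin n, dpart i.succ (dpart i.succ b) p (z p) +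
      (∑ j, -(dpart j (fun p => b p * A j p) p) (z p) + ∑ j, -(dpart j (fun p => b p * A j p) p) (z p)) +
      b p (Q p (z p)) := fun p => by
    simp only [β, add_apply, sum_apply, neg_apply, Finset.sum_neg_distrib, sub_eq_add_neg]
    rfl
  have k0 := integrable_test t0 hU hzc
  have k1 := fun i : Fin n => integrable_test ((hb.dpart i.succ).dpart i.succ) hU hzc
  have k2 := fun j => integrable_test (t2 j) hU hzc
  simp only [neg_apply] at k2
  have i1 := MeasureTheory.integrable_finsetSum Finset.univ fun (i : Fin n) _ => hi2 i.succ
  have i2 := MeasureTheory.integrable_finsetSum Finset.univ fun (j : Fin (n + 1)) _ => hiA j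
  have i3 := MeasureTheory.integrable_finsetSum Finset.univ fun (i : Fin n) _ => k1 i
  have i4 := MeasureTheory.integrable_finsetSum Finset.univ fun (j : Fin (n + 1)) _ => k2 j
  simp_rw [e1, e2]
  rw [integral_combine (hi2 0) i1 i2 hiQ, integral_combine k0 i3 i4 hiQ,
    MeasureTheory.integral_finsetSum _ fun i _ => hi2 _, MeasureTheory.integral_finsetSum _ fun i _ => hiA _,
    MeasureTheory.integral_finsetSum _ fun i _ => k1 _, MeasureTheory.integral_finsetSum _ fun i _ => k2 _,
    hsec 0, Finset.sum_congr rfl fun i _ => hsec (Fin.succ i), Finset.sum_congr rfl fun j _ => hA' j]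

/-- The phase `t - ν · x`. -/
def phase (ν : EuclideanSpace ℝ (Fin n)) (p : Spacetime n) : ℝ := p.1 - inner ℝ ν p.2

/-- The oscillating factor `exp(iτ(t - ν · x))`. -/
def wavePhase (ν : EuclideanSpace ℝ (Fin n)) (τ : ℝ) (p : Spacetime n) : ℂ :=
  Complex.exp ((τ * phase ν p : ℝ) * Complex.I)

theorem norm_wavePhase (ν : EuclideanSpace ℝ (Fin n)) (τ : ℝ) (p : Spacetime n) :
    ‖wavePhase ν τ p‖ = 1 := Complex.norm_exp_ofReal_mul_I _

theorem wavePhase_mul_neg (ν : EuclideanSpace ℝ (Fin n)) (τ : ℝ) (p : Spacetime n) :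
    wavePhase ν τ p * wavePhase ν (-τ) p = 1 := by
  rw [wavePhase, wavePhase, ← Complex.exp_add]; simp

theorem contDiff_wavePhase (ν : EuclideanSpace ℝ (Fin n)) (τ : ℝ) : ContDiff ℝ ∞ (wavePhase ν τ) := by
  have h1 : ContDiff ℝ ∞ fun p : Spacetime n => τ * phase ν p :=
    contDiff_const.mul (contDiff_fst.sub (contDiff_const.inner ℝ contDiff_snd))
  exact ((Complex.ofRealCLM.contDiff.comp h1).mul contDiff_const).cexp

/-- The components of the differential of the phase. -/
def phaseGrad (ν : EuclideanSpace ℝ (Fin n)) : Fin (n + 1) → ℝ := Fin.cons 1 fun i => -ν i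

theorem dpart_wavePhase (ν : EuclideanSpace ℝ (Fin n)) (τ : ℝ) (j : Fin (n + 1)) (p : Spacetime n) :
    dpart j (wavePhase ν τ) p = (Complex.I * τ * phaseGrad ν j) * wavePhase ν τ p := by
  have h1 : HasFDerivAt (fun p : Spacetime n => phase ν p)
      (ContinuousLinearMap.fst ℝ ℝ (EuclideanSpace ℝ (Fin n)) -
        (innerSL ℝ ν).comp (ContinuousLinearMap.snd ℝ ℝ _)) p :=
    hasFDerivAt_fst.sub ((innerSL ℝ ν).hasFDerivAt.comp p hasFDerivAt_snd)
  have h2 := ((Complex.ofRealCLM.hasFDerivAt.comp p (h1.const_mul τ)).mul_const Complex.I).cexp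
  have h3 : HasFDerivAt (wavePhase ν τ) _ p := h2
  rw [dpart, h3.fderiv]
  refine Fin.cases ?_ (fun i => ?_) j
  · simp [basisVec_zero, phaseGrad, wavePhase]; ring
  · simp [basisVec_succ, phaseGrad, wavePhase, EuclideanSpace.inner_single_right]; ring

theorem dpart_smul {V : Type*} [NormedAddCommGroup V] [NormedSpace ℝ V] [NormedSpace ℂ V]
    [IsScalarTower ℝ ℂ V] {e : Spacetime n → ℂ} {z : Spacetime n → V} {p : Spacetime n}
    (he : DifferentiableAt ℝ e p) (hz : DifferentiableAt ℝ z p) (j : Fin (n + 1)) :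
    dpart j (fun p => e p • z p) p = e p • dpart j z p + dpart j e p • z p := by
  rw [dpart, fderiv_fun_smul he hz]; rfl

theorem dpart_wavePhase_smul {V : Type*} [NormedAddCommGroup V] [NormedSpace ℝ V] [NormedSpace ℂ V]
    [IsScalarTower ℝ ℂ V] (ν : EuclideanSpace ℝ (Fin n)) (τ : ℝ) {z : Spacetime n → V}
    {p : Spacetime n} (hz : DifferentiableAt ℝ z p) (j : Fin (n + 1)) :
    dpart j (fun p => wavePhase ν τ p • z p) p =
      wavePhase ν τ p • (dpart j z p + (Complex.I * τ * phaseGrad ν j) • z p) := by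
  rw [dpart_smul ((contDiff_wavePhase ν τ).differentiable (by simp) p) hz, dpart_wavePhase, smul_add,
    smul_smul, mul_comm (wavePhase ν τ p)]

/-- The coefficient `-A_0 + ∑ ν_i A_i` of the transport equation in the direction `(1, ν)`. -/
def rayCoeff (A : Fin (n + 1) → Spacetime n → Op N) (ν : EuclideanSpace ℝ (Fin n)) (p : Spacetime n) :
    Op N :=
  -A 0 p + ∑ i : Fin n, (ν i : ℂ) • A i.succ p

theorem rayVec_eq (ν : EuclideanSpace ℝ (Fin n)) :
    ((1, ν) : Spacetime n) = basisVec 0 + ∑ i : Fin n, ν i • basisVec i.succ := by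
  refine Prod.ext ?_ ?_
  · simp [basisVec_zero, basisVec_succ, Prod.fst_sum]
  · simp only [basisVec_zero, basisVec_succ, Prod.snd_add, Prod.snd_sum, Prod.smul_snd, zero_add]
    ext k
    simp [Finset.sum_apply, Pi.single_apply]

/-- Conjugation of the wave operator by the oscillating factor. -/
theorem waveOpCLM_wavePhase {ν : EuclideanSpace ℝ (Fin n)} (hν : ‖ν‖ = 1) (τ : ℝ)
    {z : Spacetime n → Fin N → ℂ} {p : Spacetime n} (hz : ContDiffAt ℝ ∞ z p) :
    waveOpCLM A Q (fun p => wavePhase ν τ p • z p) p = wavePhase ν τ p •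
      ((2 * Complex.I * τ) • (fderiv ℝ z p (1, ν) - rayCoeff A ν p (z p)) + waveOpCLM A Q z p) := by
  have hd : ∀ᶠ q in nhds p, DifferentiableAt ℝ z q := by
    filter_upwards [(hz.of_le (m := 1) (by simp)).eventually (by simp)] with q hq
    exact hq.differentiableAt one_ne_zero
  have hz1 : ∀ j, DifferentiableAt ℝ (dpart j z) p := fun j =>
    ((hz.fderiv_right (m := 1) (by norm_cast)).differentiableAt one_ne_zero).clm_apply
      (differentiableAt_const _)
  have hzp := hd.self_of_nhds
  set c : Fin (n + 1) → ℂ := fun j => Complex.I * τ * phaseGrad ν j with hc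
  have e1 : ∀ j, dpart j (fun p => wavePhase ν τ p • z p) =ᶠ[nhds p]
      fun q => wavePhase ν τ q • (dpart j z q + c j • z q) := fun j => by
    filter_upwards [hd] with q hq
    exact dpart_wavePhase_smul ν τ hq j
  have e2 : ∀ j, dpart j (dpart j (fun p => wavePhase ν τ p • z p)) p =
      wavePhase ν τ p • (dpart j (dpart j z) p + (2 * c j) • dpart j z p + (c j) ^ 2 • z p) := fun j => by
    rw [(dpart_congr (e1 j) j).eq_of_nhds, dpart_wavePhase_smul (z := fun q => dpart j z q + c j • z q) ν τ
        ((hz1 j).add (hzp.const_smul (c j)))]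
    congr 1
    have : dpart j (fun q => dpart j z q + c j • z q) p = dpart j (dpart j z) p + c j • dpart j z p := by
      have h := ((hz1 j).hasFDerivAt.add (hzp.hasFDerivAt.const_smul (c j))).fderiv
      exact congrArg (fun L : Spacetime n →L[ℝ] (Fin N → ℂ) => L (basisVec j)) h
    rw [this]
    module
  -- The eikonal equation: since `|ν| = 1`, the `τ²` contributions of time and space cancel.
  have hν2 : ∑ i, (ν i : ℂ) ^ 2 = 1 := by
    have := EuclideanSpace.norm_sq_eq ν
    rw [hν] at this
    simp only [Real.norm_eq_abs, sq_abs, one_pow] at this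
    exact_mod_cast this.symm
  have c0 : c 0 = Complex.I * τ := by simp [hc, phaseGrad]
  have ci : ∀ i : Fin n, c i.succ = -(Complex.I * τ * ν i) := fun i => by simp [hc, phaseGrad]
  have hray : fderiv ℝ z p (1, ν) = dpart 0 z p + ∑ i : Fin n, (ν i : ℂ) • dpart i.succ z p := by
    rw [rayVec_eq, map_add, map_sum]
    simp only [map_smul, dpart]
    rfl
  rw [waveOpCLM_eq, waveOpCLM_eq, dalembert, dalembert, lowerOrder, lowerOrder, hray]
  simp only [e2, (e1 _).eq_of_nhds, map_smul, map_add, rayCoeff, add_apply, neg_apply, sum_apply, smul_apply]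
  rw [← Finset.smul_sum, ← Finset.smul_sum, smul_comm (2 : ℂ), ← smul_sub, ← smul_add, ← smul_add]
  congr 1
  rw [Fin.sum_univ_succ, Fin.sum_univ_succ]
  simp only [c0, ci, Finset.sum_add_distrib]
  have s1 : ∑ i : Fin n, (2 * -(Complex.I * τ * ν i)) • dpart i.succ z p =
      -((2 * Complex.I * τ) • ∑ i : Fin n, (ν i : ℂ) • dpart i.succ z p) := by
    rw [Finset.smul_sum, ← Finset.sum_neg_distrib]
    exact Finset.sum_congr rfl fun i _ => by module
  have s2 : ∑ i : Fin n, (-(Complex.I * τ * ν i)) ^ 2 • z p = (Complex.I * τ) ^ 2 • z p := by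
    rw [← Finset.sum_smul]
    congr 1
    calc ∑ i : Fin n, (-(Complex.I * τ * ν i)) ^ 2 = (Complex.I * τ) ^ 2 * ∑ i, (ν i : ℂ) ^ 2 := by
          rw [Finset.mul_sum]; exact Finset.sum_congr rfl fun i _ => by ring
      _ = _ := by rw [hν2, mul_one]
  have s3 : ∑ i : Fin n, (-(Complex.I * τ * ν i)) • A i.succ p (z p) =
      -((Complex.I * τ) • ∑ i : Fin n, (ν i : ℂ) • A i.succ p (z p)) := by
    rw [Finset.smul_sum, ← Finset.sum_neg_distrib]
    exact Finset.sum_congr rfl fun i _ => by module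
  rw [s1, s2, s3]
  module

/-- Non-stationary phase: one integration by parts in time gains a factor `τ⁻¹`. -/
theorem exists_oscillatory_bound (hU : IsOpen U) {β : Spacetime n → Op N} (hβ : IsTest U β)
    (ν : EuclideanSpace ℝ (Fin n)) :
    ∃ C : ℝ, 0 ≤ C ∧ ∀ (r : Spacetime n → Fin N → ℂ) (τ : ℝ), ContDiffOn ℝ ∞ r U → 0 < τ →
      ContinuousOn (firstOrder r) U →
      ‖∫ p, β p (wavePhase ν (-τ) p • r p)‖ ≤ C / τ * ∫ p in tsupport β, firstOrder r p := by
  have hβ0 := hβ.dpart 0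
  obtain ⟨C1, hC1⟩ := hβ.compact.isCompact.exists_bound_of_continuousOn hβ.smooth.continuous.continuousOn
  obtain ⟨C2, hC2⟩ := hβ.compact.isCompact.exists_bound_of_continuousOn hβ0.smooth.continuous.continuousOn
  refine ⟨max C1 0 + max C2 0, by positivity, fun r τ hr hτ hfo => ?_⟩
  set e := wavePhase ν (-τ) with he
  have hes : ContDiff ℝ ∞ e := contDiff_wavePhase ν (-τ)
  have hb : IsTest U fun p => e p • β p :=
    hβ.of_support_subset (hes.smul hβ.smooth) fun p hp => by rw [hp]; ext v : 1; simp
  have hb0 : IsTest U fun p => e p • dpart 0 β p :=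
    hβ0.of_support_subset (hes.smul hβ0.smooth) fun p hp => by rw [hp]; ext v : 1; simp
  -- As `∂_t φ = 1`, a time derivative of the oscillating factor is `-iτ` times that factor: the
  -- phase is nowhere stationary.
  have hd : ∀ p, dpart 0 (fun p => e p • β p) p =
      e p • dpart 0 β p - (Complex.I * τ) • (e p • β p) := fun p => by
    rw [he, dpart_wavePhase_smul ν (-τ) (hβ.smooth.differentiable (by simp) p)]
    simp only [phaseGrad, Fin.cons_zero]
    push_cast
    module
  have hr0 := contDiffOn_dpart hU hr 0
  have h1 := integral_test_dpart hb hU hr 0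
  have i1 := integrable_test hb hU hr.continuousOn
  have i2 := integrable_test hb0 hU hr.continuousOn
  have i3 := integrable_test hb hU hr0.continuousOn
  have h2 : (Complex.I * τ) • ∫ p, (e p • β p) (r p) =
      ∫ p, ((e p • β p) (dpart 0 r p) + (e p • dpart 0 β p) (r p)) := by
    rw [MeasureTheory.integral_add i3 i2, h1]
    simp_rw [hd, sub_apply]
    have : ∫ p, ((e p • dpart 0 β p) (r p) - ((Complex.I * τ) • (e p • β p)) (r p)) =
        (∫ p, (e p • dpart 0 β p) (r p)) - (Complex.I * τ) • ∫ p, (e p • β p) (r p) := by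
      rw [← MeasureTheory.integral_smul]
      exact MeasureTheory.integral_sub i2 (i1.smul (Complex.I * (τ : ℂ)))
    rw [this]; abel
  have h3 : ∫ p, β p (e p • r p) = ∫ p, (e p • β p) (r p) := by simp
  have h4 : ‖(Complex.I * τ) • ∫ p, (e p • β p) (r p)‖ = τ * ‖∫ p, β p (e p • r p)‖ := by
    rw [norm_smul, h3]; simp [abs_of_pos hτ]
  have h5 : ‖∫ p, ((e p • β p) (dpart 0 r p) + (e p • dpart 0 β p) (r p))‖ ≤
      (max C1 0 + max C2 0) * ∫ p in tsupport β, firstOrder r p := by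
    have hz : ∀ p, p ∉ tsupport β → (e p • β p) (dpart 0 r p) + (e p • dpart 0 β p) (r p) = 0 := by
      intro p hp
      have h6 : dpart 0 β p = 0 := by
        by_contra hne
        refine hp ((tsupport_fderiv_subset ℝ) (subset_tsupport (fderiv ℝ β) fun h7 => hne ?_))
        simp [dpart, h7]
      simp [image_eq_zero_of_notMem_tsupport hp, h6]
    rw [← MeasureTheory.setIntegral_eq_integral_of_forall_compl_eq_zero hz,
      ← MeasureTheory.integral_const_mul]
    refine MeasureTheory.norm_integral_le_of_norm_le
      (((hfo.mono hβ.subset).integrableOn_compact hβ.compact.isCompact).const_mul _) ?_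
    filter_upwards [MeasureTheory.ae_restrict_mem (isClosed_tsupport β).measurableSet] with p hp
    have hfr : ‖dpart 0 r p‖ ≤ firstOrder r p ∧ ‖r p‖ ≤ firstOrder r p := by
      have h8 := Finset.single_le_sum (f := fun j => ‖dpart j r p‖) (fun j _ => norm_nonneg _)
        (Finset.mem_univ (0 : Fin (n + 1)))
      have h9 : 0 ≤ ‖dpart 0 r p‖ := norm_nonneg _
      unfold firstOrder
      constructor <;> linarith [norm_nonneg (r p)]
    have hn : ‖e p‖ = 1 := norm_wavePhase _ _ _
    calc _ ≤ ‖(e p • β p) (dpart 0 r p)‖ + ‖(e p • dpart 0 β p) (r p)‖ := norm_add_le _ _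
      _ ≤ max C1 0 * firstOrder r p + max C2 0 * firstOrder r p := by
          simp only [smul_apply, norm_smul, hn, one_mul]
          gcongr
          · exact ((β p).le_opNorm _).trans (mul_le_mul ((hC1 p hp).trans (le_max_left _ _)) hfr.1
              (norm_nonneg _) (le_max_right _ _))
          · exact ((dpart 0 β p).le_opNorm _).trans (mul_le_mul ((hC2 p hp).trans (le_max_left _ _)) hfr.2
              (norm_nonneg _) (le_max_right _ _))
      _ = _ := by ring
  rw [div_mul_eq_mul_div, le_div_iff₀ hτ, mul_comm, ← h4, h2]
  exact h5

end Pairing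

/-! ### Parallel transport depending smoothly on parameters -/

section Transport

variable {N : ℕ} {X : Type*} [NormedAddCommGroup X] [NormedSpace ℝ X] [FiniteDimensional ℝ X]

/-- Smooth dependence on parameters for linear equations, in a form with globally smooth solutions. -/
theorem exists_parametric_solution {H : Type*} [NormedAddCommGroup H] [NormedSpace ℂ H]
    [FiniteDimensional ℂ H] {M : ℝ × X → H →L[ℂ] H} (hM : ContDiff ℝ ∞ M) (v₀ : H) {R : ℝ} (hR : 0 < R) :
    ∃ Y : ℝ × X → H, ContDiff ℝ ∞ Y ∧ (∀ x, Y (0, x) = v₀) ∧ ∀ t x, |t| < R → ‖x‖ < R →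
      HasDerivAt (fun t => Y (t, x)) (M (t, x) (Y (t, x))) t := by
  set e : X ≃L[ℝ] EuclideanSpace ℝ (Fin (Module.finrank ℝ X)) := toEuclidean
  -- `R'` exceeds `2 * R`, so the time cutoff `κ` vanishes before the domain of `Y` ends, and it
  -- exceeds the norm of every image under `e` of a point of the `R`-ball.
  set R' := 2 * R + ‖(e : X →L[ℝ] EuclideanSpace ℝ (Fin (Module.finrank ℝ X)))‖ * R + 1 with hR'
  have h0 : 0 ≤ ‖(e : X →L[ℝ] EuclideanSpace ℝ (Fin (Module.finrank ℝ X)))‖ * R := by positivity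
  obtain ⟨Y, hY, hY0, hYd⟩ := exists_smooth_parametric_ode
    (M := fun q => M (q.1, e.symm q.2)) (hM.comp (contDiff_fst.prodMk (e.symm.contDiff.comp contDiff_snd)))
    v₀ (show 0 < R' by linarith)
  obtain ⟨κ, hκ, hκ1, hκs, -⟩ := exists_cutoff (X := ℝ) hR
  have hκz : ∀ t, 2 * R < |t| → κ t = 0 := fun t ht => by
    by_contra hne
    have := hκs (subset_tsupport κ hne)
    rw [mem_closedBall_zero_iff, Real.norm_eq_abs] at this
    linarith
  refine ⟨fun q => κ q.1 • Y (q.1, e q.2), contDiff_iff_contDiffAt.2 fun q => ?_, fun x => ?_,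
    fun t x ht hx => ?_⟩
  · rcases lt_or_ge |q.1| R' with h | h
    · have h1 : ContDiffAt ℝ ∞ Y (q.1, e q.2) := hY.contDiffAt
        ((isOpen_Ioo.prod isOpen_univ).mem_nhds ⟨abs_lt.1 h, mem_univ _⟩)
      exact (hκ.comp contDiff_fst).contDiffAt.smul
        (h1.comp q (contDiff_fst.prodMk (e.contDiff.comp contDiff_snd)).contDiffAt)
    · have : (fun q : ℝ × X => κ q.1 • Y (q.1, e q.2)) =ᶠ[nhds q] fun _ => 0 := by
        filter_upwards [(continuous_fst.abs).continuousAt.eventually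
          (lt_mem_nhds (show 2 * R < |q.1| by linarith))] with q' hq'
        rw [hκz _ hq', zero_smul]
      exact contDiffAt_const.congr_of_eventuallyEq this
  · simp [hκ1 0 (by simp [hR.le]), hY0]
  · have hex : ‖e x‖ < R' := by
      have h1 := (e : X →L[ℝ] EuclideanSpace ℝ (Fin (Module.finrank ℝ X))).le_opNorm x
      have h2 : ‖(e : X →L[ℝ] EuclideanSpace ℝ (Fin (Module.finrank ℝ X)))‖ * ‖x‖ ≤
        ‖(e : X →L[ℝ] EuclideanSpace ℝ (Fin (Module.finrank ℝ X)))‖ * R := by gcongr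
      have h3 : ‖e x‖ ≤ ‖(e : X →L[ℝ] EuclideanSpace ℝ (Fin (Module.finrank ℝ X)))‖ * ‖x‖ := h1
      linarith
    have h1 := hYd t (e x) (by linarith) hex
    have h2 : (fun t => κ t • Y (t, e x)) =ᶠ[nhds t] fun t => Y (t, e x) := by
      filter_upwards [continuous_abs.continuousAt.eventually (gt_mem_nhds ht)] with s hs
      rw [hκ1 s (by rw [Real.norm_eq_abs]; exact le_of_lt hs), one_smul]
    have h3 := h1.congr_of_eventuallyEq h2
    simpa [hκ1 t (by rw [Real.norm_eq_abs]; exact ht.le)] using h3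

/-- Multiplication of operators as a bilinear map. -/
def leftMul (N : ℕ) : Op N →L[ℂ] Op N →L[ℂ] Op N :=
  ContinuousLinearMap.compL ℂ (Fin N → ℂ) (Fin N → ℂ) (Fin N → ℂ)

/-- Parallel transport and its inverse, depending smoothly on parameters. -/
theorem exists_parametric_transport {C : ℝ × X → Op N} (hC : ContDiff ℝ ∞ C) {R : ℝ} (hR : 0 < R) :
    ∃ P P' : ℝ × X → Op N, ContDiff ℝ ∞ P ∧ ContDiff ℝ ∞ P' ∧ ∀ t x, |t| < R → ‖x‖ < R →
      HasDerivAt (fun t => P (t, x)) (C (t, x) * P (t, x)) t ∧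
      HasDerivAt (fun t => P' (t, x)) (-(P' (t, x) * C (t, x))) t ∧ P' (t, x) * P (t, x) = 1 := by
  have hl : ContDiff ℝ ∞ (fun B : Op N => leftMul N B) :=
    (ContinuousLinearMap.contDiff (𝕜 := ℂ) (E := Op N) (F := Op N →L[ℂ] Op N)
      (leftMul N)).restrict_scalars ℝ
  have hr : ContDiff ℝ ∞ (fun B : Op N => (leftMul N).flip B) :=
    (ContinuousLinearMap.contDiff (𝕜 := ℂ) (E := Op N) (F := Op N →L[ℂ] Op N)
      (leftMul N).flip).restrict_scalars ℝ
  obtain ⟨P, hP, hP0, hPd⟩ := exists_parametric_solution (H := Op N) (M := fun q => leftMul N (C q))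
    (hl.comp hC) 1 hR
  obtain ⟨P', hP', hP'0, hP'd⟩ := exists_parametric_solution (H := Op N)
    (M := fun q => -((leftMul N).flip (C q))) (hr.comp hC).neg 1 hR
  refine ⟨P, P', hP, hP', fun t x ht hx => ⟨hPd t x ht hx, hP'd t x ht hx, ?_⟩⟩
  have hd : ∀ s ∈ Ioo (-R) R, HasDerivAt (fun s => P' (s, x) * P (s, x)) 0 s := fun s hs => by
    have h := (hP'd s x (abs_lt.2 hs) hx).mul (hPd s x (abs_lt.2 hs) hx)
    refine h.congr_deriv (ContinuousLinearMap.ext fun v => ?_)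
    change (-(P' (s, x) * C (s, x)) * P (s, x) + P' (s, x) * (C (s, x) * P (s, x))) v = 0
    simp
  have h := isOpen_Ioo.is_const_of_deriv_eq_zero isPreconnected_Ioo
    (fun s hs => (hd s hs).differentiableAt.differentiableWithinAt) (fun s hs => (hd s hs).deriv)
    (abs_lt.1 ht) (show (0 : ℝ) ∈ Ioo (-R) R by simp [hR])
  simpa [hP0, hP'0] using h

end Transport

/-! ### Derivatives along rays -/

section GeometricOptics

variable {n N : ℕ}

/-- The coordinate `x - tν`, constant along the rays in the direction `(1, ν)`. -/
def rayCoord (ν : EuclideanSpace ℝ (Fin n)) (p : Spacetime n) : EuclideanSpace ℝ (Fin n) :=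
  p.2 - p.1 • ν

theorem contDiff_rayCoord (ν : EuclideanSpace ℝ (Fin n)) : ContDiff ℝ ∞ (rayCoord ν) :=
  contDiff_snd.sub (contDiff_fst.smul contDiff_const)

theorem rayCoord_add (ν : EuclideanSpace ℝ (Fin n)) (p : Spacetime n) :
    rayCoord ν p + p.1 • ν = p.2 := by simp [rayCoord]

/-- The ray through `p` is `t ↦ (t, rayCoord ν p + t • ν)`, so the chain rule identifies the
derivative in the direction `(1, ν)` with an ordinary derivative at fixed ray coordinate. -/
theorem hasLineDeriv_of_ray {V : Type*} [NormedAddCommGroup V] [NormedSpace ℝ V]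
    {u : Spacetime n → V} {p : Spacetime n} (hu : DifferentiableAt ℝ u p)
    {ν : EuclideanSpace ℝ (Fin n)} {u' : V}
    (h : HasDerivAt (fun t : ℝ => u (t, rayCoord ν p + t • ν)) u' p.1) :
    fderiv ℝ u p (1, ν) = u' := by
  have h1 : HasDerivAt (fun t : ℝ => ((t, rayCoord ν p + t • ν) : Spacetime n)) (1, ν) p.1 := by
    have := ((hasDerivAt_id p.1).smul_const ν).const_add (rayCoord ν p)
    rw [one_smul] at this
    exact (hasDerivAt_id p.1).prodMk this
  have hp : ((p.1, rayCoord ν p + p.1 • ν) : Spacetime n) = p := Prod.ext rfl (rayCoord_add ν p)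
  have h2 : HasFDerivAt u (fderiv ℝ u p) (p.1, rayCoord ν p + p.1 • ν) := by
    rw [hp]; exact hu.hasFDerivAt
  exact (h2.comp_hasDerivAt p.1 h1).unique h

theorem fderiv_comp_rayCoord {V : Type*} [NormedAddCommGroup V] [NormedSpace ℝ V]
    {χ : EuclideanSpace ℝ (Fin n) → V} (hχ : ContDiff ℝ ∞ χ) (ν : EuclideanSpace ℝ (Fin n))
    (p : Spacetime n) : fderiv ℝ (fun p => χ (rayCoord ν p)) p (1, ν) = 0 := by
  refine hasLineDeriv_of_ray (((hχ.comp (contDiff_rayCoord ν)).differentiable (by simp)) p) ?_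
  have : (fun t : ℝ => χ (rayCoord ν (t, rayCoord ν p + t • ν))) = fun _ => χ (rayCoord ν p) := by
    funext t; simp [rayCoord]
  change HasDerivAt (fun t : ℝ => χ (rayCoord ν (t, rayCoord ν p + t • ν))) 0 p.1
  rw [this]
  exact hasDerivAt_const _ _

theorem fderiv_comp_time {V : Type*} [NormedAddCommGroup V] [NormedSpace ℝ V]
    {θ : ℝ → V} (hθ : ContDiff ℝ ∞ θ) (ν : EuclideanSpace ℝ (Fin n))
    (p : Spacetime n) : fderiv ℝ (fun p : Spacetime n => θ p.1) p (1, ν) = deriv θ p.1 := by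
  refine hasLineDeriv_of_ray (((hθ.comp contDiff_fst).differentiable (by simp)) p) ?_
  exact (hθ.differentiable (by simp) p.1).hasDerivAt

theorem fderiv_real_smul {V : Type*} [NormedAddCommGroup V] [NormedSpace ℝ V]
    {χ : Spacetime n → ℝ} {u : Spacetime n → V} {p : Spacetime n} (hχ : DifferentiableAt ℝ χ p)
    (hu : DifferentiableAt ℝ u p) (v : Spacetime n) :
    fderiv ℝ (fun p => χ p • u p) p v = χ p • fderiv ℝ u p v + fderiv ℝ χ p v • u p := by
  rw [fderiv_fun_smul hχ hu]; rfl

theorem fderiv_op_apply {B : Spacetime n → Op N} {p : Spacetime n} (hB : DifferentiableAt ℝ B p)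
    (c : Fin N → ℂ) (v : Spacetime n) : fderiv ℝ (fun p => B p c) p v = fderiv ℝ B p v c := by
  have h := ((evalPairing N).flip c).hasFDerivAt.comp p hB.hasFDerivAt
  have h2 : HasFDerivAt (fun p => B p c) _ p := h
  rw [h2.fderiv]; rfl

variable {A : Fin (n + 1) → Spacetime n → Op N} {Q : Spacetime n → Op N}

theorem contDiff_waveOpCLM (hA : ∀ j, ContDiff ℝ ∞ (A j)) (hQ : ContDiff ℝ ∞ Q)
    {u : Spacetime n → Fin N → ℂ} (hu : ContDiff ℝ ∞ u) : ContDiff ℝ ∞ (waveOpCLM A Q u) := by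
  have h : waveOpCLM A Q u = fun p => dalembert u p + lowerOrder A Q u p := funext (waveOpCLM_eq A Q u)
  rw [h]
  refine ContDiff.add (ContDiff.sub (contDiff_dpart (contDiff_dpart hu 0) 0)
    (ContDiff.sum fun i _ => contDiff_dpart (contDiff_dpart hu _) _)) (ContDiff.add ?_ ?_)
  · exact (ContDiff.sum fun j _ => contDiff_clm_apply (hA j) (contDiff_dpart hu j)).const_smul (2 : ℂ)
  · exact contDiff_clm_apply hQ hu

theorem waveOpCLM_add_potential (u : Spacetime n → Fin N → ℂ) (p : Spacetime n) :
    waveOpCLM A Q u p = waveOpCLM A (fun _ => 0) u p + Q p (u p) := by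
  simp only [waveOpCLM_eq, lowerOrder]
  simp [add_assoc]

theorem waveOpCLM_sub {u v : Spacetime n → Fin N → ℂ} {p : Spacetime n} (hu : ContDiffAt ℝ ∞ u p)
    (hv : ContDiffAt ℝ ∞ v p) :
    waveOpCLM A Q (fun p => u p - v p) p = waveOpCLM A Q u p - waveOpCLM A Q v p := by
  have hd : ∀ {w : Spacetime n → Fin N → ℂ}, ContDiffAt ℝ ∞ w p →
      ∀ᶠ q in nhds p, DifferentiableAt ℝ w q := fun {w} hw => by
    filter_upwards [(hw.of_le (m := 1) (by simp)).eventually (by simp)] with q hq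
    exact hq.differentiableAt one_ne_zero
  have hd1 : ∀ {w : Spacetime n → Fin N → ℂ}, ContDiffAt ℝ ∞ w p → ∀ j,
      DifferentiableAt ℝ (dpart j w) p := fun {w} hw j =>
    ((hw.fderiv_right (m := 1) (by norm_cast)).differentiableAt one_ne_zero).clm_apply
      (differentiableAt_const _)
  have e0 : ∀ {a b : Spacetime n → Fin N → ℂ} {q} (_ : DifferentiableAt ℝ a q)
      (_ : DifferentiableAt ℝ b q) (j : Fin (n + 1)), dpart j (fun p => a p - b p) q = dpart j a q - dpart j b q :=
    fun ha hb j => by simp only [dpart]; rw [fderiv_fun_sub ha hb]; rfl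
  have e1 : ∀ j, dpart j (fun p => u p - v p) =ᶠ[nhds p] fun q => dpart j u q - dpart j v q := fun j => by
    filter_upwards [hd hu, hd hv] with q h1 h2
    exact e0 h1 h2 j
  have e2 : ∀ j, dpart j (dpart j (fun p => u p - v p)) p = dpart j (dpart j u) p - dpart j (dpart j v) p :=
    fun j => by rw [(dpart_congr (e1 j) j).eq_of_nhds, e0 (hd1 hu j) (hd1 hv j)]
  simp only [waveOpCLM_eq, dalembert, lowerOrder, e2, (e1 _).eq_of_nhds, map_sub, Finset.sum_sub_distrib,
    smul_sub]
  abel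

end GeometricOptics

/-! ### Geometric optics solutions and the pairing identity -/

section Beam

variable {n N : ℕ} {A : Fin (n + 1) → Spacetime n → Op N}

/-- The amplitude of the geometric optics solution: `θ(t) χ(x - tν) P c`. -/
def amplitude (ν : EuclideanSpace ℝ (Fin n)) (P : Spacetime n → Op N)
    (χ : EuclideanSpace ℝ (Fin n) → ℝ) (c : Fin N → ℂ) (p : Spacetime n) : Fin N → ℂ :=
  χ (rayCoord ν p) • P p c

theorem contDiff_amplitude {ν : EuclideanSpace ℝ (Fin n)} {P : Spacetime n → Op N}
    {χ : EuclideanSpace ℝ (Fin n) → ℝ} (hP : ContDiff ℝ ∞ P) (hχ : ContDiff ℝ ∞ χ) (c : Fin N → ℂ) :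
    ContDiff ℝ ∞ (amplitude ν P χ c) :=
  (hχ.comp (contDiff_rayCoord ν)).smul (contDiff_clm_apply hP contDiff_const)

/-- The factor `χ (rayCoord ν p)` is constant along rays and `P` solves the transport equation where
that factor is nonzero, so only the derivative of the switch `θ` survives. -/
theorem fderiv_amplitude {ν : EuclideanSpace ℝ (Fin n)} {P : Spacetime n → Op N}
    {χ : EuclideanSpace ℝ (Fin n) → ℝ} (hP : ContDiff ℝ ∞ P) (hχ : ContDiff ℝ ∞ χ) (c : Fin N → ℂ)
    {θ : ℝ → ℝ} (hθ : ContDiff ℝ ∞ θ) {p : Spacetime n}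
    (h : χ (rayCoord ν p) ≠ 0 → fderiv ℝ P p (1, ν) = rayCoeff A ν p * P p) :
    fderiv ℝ (fun p => θ p.1 • amplitude ν P χ c p) p (1, ν) -
      rayCoeff A ν p (θ p.1 • amplitude ν P χ c p) = deriv θ p.1 • amplitude ν P χ c p := by
  have hPd := hP.differentiable (by simp) p
  have hPc : ContDiff ℝ ∞ fun p => P p c := contDiff_clm_apply hP contDiff_const
  have hχd := (hχ.comp (contDiff_rayCoord ν)).differentiable (by simp) p
  have hθd := (hθ.comp (contDiff_fst (F := EuclideanSpace ℝ (Fin n)))).differentiable (by simp) p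
  have e1 := fderiv_real_smul hθd ((contDiff_amplitude (ν := ν) hP hχ c).differentiable (by simp) p) (1, ν)
  have e2 := fderiv_real_smul hχd (hPc.differentiable (by simp) p) (1, ν)
  have e3 := fderiv_comp_rayCoord hχ ν p
  have e4 := fderiv_comp_time hθ ν p
  simp only [Function.comp_def] at e1 e2
  rw [e1, e4]
  have e5 : fderiv ℝ (amplitude ν P χ c) p (1, ν) = rayCoeff A ν p (amplitude ν P χ c p) := by
    have : amplitude ν P χ c = fun p => χ (rayCoord ν p) • P p c := rfl
    rw [this, e2, e3, fderiv_op_apply hPd]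
    by_cases h0 : χ (rayCoord ν p) = 0
    · simp [h0]
    · rw [h h0]
      simp [ContinuousLinearMap.map_smul_of_tower]
  rw [e5, ContinuousLinearMap.map_smul_of_tower]
  abel

/-- The source generating the geometric optics solution. -/
def beamSource (A : Fin (n + 1) → Spacetime n → Op N) (ν : EuclideanSpace ℝ (Fin n)) (τ : ℝ)
    (θ : ℝ → ℝ) (a : Spacetime n → Fin N → ℂ) (p : Spacetime n) : Fin N → ℂ :=
  wavePhase ν τ p • ((2 * Complex.I * τ) • (deriv θ p.1 • a p) +
    (waveOpCLM A (fun _ => 0) (fun p => θ p.1 • a p) p - θ p.1 • waveOpCLM A (fun _ => 0) a p))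

theorem contDiff_beamSource (hA : ∀ j, ContDiff ℝ ∞ (A j)) (ν : EuclideanSpace ℝ (Fin n)) (τ : ℝ)
    {θ : ℝ → ℝ} (hθ : ContDiff ℝ ∞ θ) {a : Spacetime n → Fin N → ℂ} (ha : ContDiff ℝ ∞ a) :
    ContDiff ℝ ∞ (beamSource A ν τ θ a) := by
  have hθ1 : ContDiff ℝ ∞ fun p : Spacetime n => θ p.1 := hθ.comp contDiff_fst
  have hθ' : ContDiff ℝ ∞ fun p : Spacetime n => deriv θ p.1 :=
    (hθ.iterate_deriv 1).comp contDiff_fst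
  exact (contDiff_wavePhase ν τ).smul (((hθ'.smul ha).const_smul _).add
    ((contDiff_waveOpCLM hA contDiff_const (hθ1.smul ha)).sub
      (hθ1.smul (contDiff_waveOpCLM hA contDiff_const ha))))

/-- All terms in which `θ` is differentiated go into the source. Multiplication by `Q` commutes with
`θ`, so the source is free of `Q` and serves both potentials; the rest has modulus independent of
`τ`. -/
theorem waveOpCLM_beam (Q : Spacetime n → Op N) {ν : EuclideanSpace ℝ (Fin n)}
    (hν : ‖ν‖ = 1) (τ : ℝ) {P : Spacetime n → Op N} {χ : EuclideanSpace ℝ (Fin n) → ℝ}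
    (hP : ContDiff ℝ ∞ P) (hχ : ContDiff ℝ ∞ χ) (c : Fin N → ℂ) {θ : ℝ → ℝ} (hθ : ContDiff ℝ ∞ θ)
    {p : Spacetime n} (h : χ (rayCoord ν p) ≠ 0 → fderiv ℝ P p (1, ν) = rayCoeff A ν p * P p) :
    waveOpCLM A Q (fun p => wavePhase ν τ p • θ p.1 • amplitude ν P χ c p) p =
      beamSource A ν τ θ (amplitude ν P χ c) p +
        wavePhase ν τ p • θ p.1 • waveOpCLM A Q (amplitude ν P χ c) p := by
  have hz : ContDiff ℝ ∞ fun p : Spacetime n => θ p.1 • amplitude ν P χ c p :=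
    (hθ.comp contDiff_fst).smul (contDiff_amplitude hP hχ c)
  rw [waveOpCLM_wavePhase hν τ hz.contDiffAt, fderiv_amplitude hP hχ c hθ h, beamSource,
    waveOpCLM_add_potential (Q := Q) (fun p => θ p.1 • amplitude ν P χ c p),
    waveOpCLM_add_potential (Q := Q) (amplitude ν P χ c), ← smul_add]
  congr 1
  rw [ContinuousLinearMap.map_smul_of_tower, smul_add]
  abel

/-- By locality: where `θ` is constantly `0` or `1`, both the term in `θ'` and the commutator with
`θ` vanish. The source is thus confined to the switching interval of `θ` and to the tube carrying
the amplitude. -/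
theorem beamSource_eq_zero {ν : EuclideanSpace ℝ (Fin n)} {τ : ℝ} {θ : ℝ → ℝ}
    {a : Spacetime n → Fin N → ℂ} {p : Spacetime n}
    (h : a =ᶠ[nhds p] (fun _ => 0) ∨ θ =ᶠ[nhds p.1] (fun _ => 0) ∨ θ =ᶠ[nhds p.1] fun _ => 1) :
    beamSource A ν τ θ a p = 0 := by
  have hcomp : ∀ {k : ℝ}, θ =ᶠ[nhds p.1] (fun _ => k) → ∀ᶠ q : Spacetime n in nhds p, θ q.1 = k :=
    fun h => continuous_fst.continuousAt.eventually h
  unfold beamSource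
  rcases h with h | h | h
  · have h1 : (fun q : Spacetime n => θ q.1 • a q) =ᶠ[nhds p] fun _ => 0 := by
      filter_upwards [h] with q hq; rw [hq, smul_zero]
    rw [waveOpCLM_congr h1, waveOpCLM_congr h, waveOpCLM_zero, h.eq_of_nhds]; simp
  · have h1 : (fun q : Spacetime n => θ q.1 • a q) =ᶠ[nhds p] fun _ => 0 := by
      filter_upwards [hcomp h] with q hq; rw [hq, zero_smul]
    rw [waveOpCLM_congr h1, waveOpCLM_zero, h.deriv_eq, h.eq_of_nhds]; simp
  · have h1 : (fun q : Spacetime n => θ q.1 • a q) =ᶠ[nhds p] a := by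
      filter_upwards [hcomp h] with q hq; rw [hq, one_smul]
    rw [waveOpCLM_congr h1, h.deriv_eq, h.eq_of_nhds]; simp

/-- A smooth step from `0` for `t ≤ a` to `1` for `t ≥ b`. -/
def smoothStep (a b t : ℝ) : ℝ := Real.smoothTransition ((t - a) / (b - a))

theorem contDiff_smoothStep (a b : ℝ) : ContDiff ℝ ∞ (smoothStep a b) :=
  Real.smoothTransition.contDiff.comp ((contDiff_id.sub contDiff_const).div_const _)

theorem smoothStep_of_le {a b t : ℝ} (hab : a < b) (h : t ≤ a) : smoothStep a b t = 0 :=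
  Real.smoothTransition.zero_of_nonpos (div_nonpos_of_nonpos_of_nonneg (by linarith) (by linarith))

theorem smoothStep_of_ge {a b t : ℝ} (hab : a < b) (h : b ≤ t) : smoothStep a b t = 1 :=
  Real.smoothTransition.one_of_one_le ((one_le_div (by linarith)).2 (by linarith))

theorem smoothStep_eventually_zero {a b t : ℝ} (hab : a < b) (h : t < a) :
    smoothStep a b =ᶠ[nhds t] fun _ => 0 := by
  filter_upwards [gt_mem_nhds h] with s hs using smoothStep_of_le hab (le_of_lt hs)

theorem smoothStep_eventually_one {a b t : ℝ} (hab : a < b) (h : b < t) :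
    smoothStep a b =ᶠ[nhds t] fun _ => 1 := by
  filter_upwards [lt_mem_nhds h] with s hs using smoothStep_of_ge hab (le_of_lt hs)

/-- A tube around a ray, over a compact time interval. -/
def tube (ν y₀ : EuclideanSpace ℝ (Fin n)) (a b δ : ℝ) : Set (Spacetime n) :=
  {p | p.1 ∈ Icc a b ∧ rayCoord ν p ∈ Metric.closedBall y₀ δ}

theorem isCompact_tube (ν y₀ : EuclideanSpace ℝ (Fin n)) (a b δ : ℝ) : IsCompact (tube ν y₀ a b δ) := by
  have h : tube ν y₀ a b δ ⊆ (fun q : Spacetime n => ((q.1, q.2 + q.1 • ν) : Spacetime n)) ''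
      (Icc a b ×ˢ Metric.closedBall y₀ δ) := fun p hp =>
    ⟨(p.1, rayCoord ν p), hp, Prod.ext rfl (rayCoord_add ν p)⟩
  refine ((isCompact_Icc.prod (isCompact_closedBall y₀ δ)).image (by fun_prop)).of_isClosed_subset ?_ h
  exact (isClosed_Icc.preimage continuous_fst).inter
    (Metric.isClosed_closedBall.preimage (contDiff_rayCoord ν).continuous)

/-- The pairing identity obtained from geometric optics. -/
theorem integral_beam_eq_zero (hA : ∀ j, ContDiff ℝ ∞ (A j)) {Q₁ Q₂ : Spacetime n → Op N}
    (hQ₁ : ContDiff ℝ ∞ Q₁) (hQ₂ : ContDiff ℝ ∞ Q₂) {T : ℝ} {S : Set (EuclideanSpace ℝ (Fin n))}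
    (hsol : ∀ f : Spacetime n → Fin N → ℂ, ContDiff ℝ ∞ f → HasCompactSupport f →
      tsupport f ⊆ Ioo 0 T ×ˢ S → ∃ u₁ u₂ : Spacetime n → Fin N → ℂ,
        (ContDiffOn ℝ ∞ u₁ (slab n T) ∧ ZeroData u₁ ∧
          ∀ p ∈ Ioo 0 T ×ˢ (univ : Set (EuclideanSpace ℝ (Fin n))), waveOpCLM A Q₁ u₁ p = f p) ∧
        (ContDiffOn ℝ ∞ u₂ (slab n T) ∧ ZeroData u₂ ∧
          ∀ p ∈ Ioo 0 T ×ˢ (univ : Set (EuclideanSpace ℝ (Fin n))), waveOpCLM A Q₂ u₂ p = f p) ∧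
        ∀ p ∈ Ioo 0 T ×ˢ S, u₁ p = u₂ p)
    {ν y₀ : EuclideanSpace ℝ (Fin n)} (hν : ‖ν‖ = 1) {t₀ t₁ δ : ℝ} (hδ : 0 < δ) (h0 : 0 < t₀ - δ)
    (h01 : t₀ ≤ t₁) (h1 : t₁ + δ < T)
    (hS : ∀ p ∈ tube ν y₀ (t₀ - δ) t₀ (2 * δ) ∪ tube ν y₀ t₁ (t₁ + δ) (2 * δ), p.2 ∈ S)
    {P P' : Spacetime n → Op N} (hP : ContDiff ℝ ∞ P) (hP' : ContDiff ℝ ∞ P')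
    (hPd : ∀ p ∈ tube ν y₀ 0 T (2 * δ), fderiv ℝ P p (1, ν) = rayCoeff A ν p * P p)
    (hPd' : ∀ p ∈ tube ν y₀ 0 T (2 * δ), fderiv ℝ P' p (1, ν) = -(P' p * rayCoeff A ν p))
    {χ χ₂ : EuclideanSpace ℝ (Fin n) → ℝ} (hχ : ContDiff ℝ ∞ χ)
    (hχs : tsupport χ ⊆ Metric.closedBall y₀ (2 * δ)) (hχ₂ : ContDiff ℝ ∞ χ₂)
    (hχ₂s : tsupport χ₂ ⊆ Metric.closedBall y₀ (2 * δ)) (c : Fin N → ℂ) :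
    ∫ p : Spacetime n, ((smoothStep (t₀ - δ) t₀ p.1 * (1 - smoothStep t₁ (t₁ + δ) p.1)) •
      χ₂ (rayCoord ν p) • P' p) ((Q₂ p - Q₁ p) (smoothStep (t₀ - δ) t₀ p.1 • amplitude ν P χ c p)) = 0 := by
  set θ := smoothStep (t₀ - δ) t₀ with hθdef
  have hθ : ContDiff ℝ ∞ θ := contDiff_smoothStep _ _
  set ψ : ℝ → ℝ := fun t => smoothStep (t₀ - δ) t₀ t * (1 - smoothStep t₁ (t₁ + δ) t) with hψdef
  have hψ : ContDiff ℝ ∞ ψ := hθ.mul (contDiff_const.sub (contDiff_smoothStep _ _))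
  set a := amplitude ν P χ c with ha
  have has : ContDiff ℝ ∞ a := contDiff_amplitude hP hχ c
  set z₀ : Spacetime n → Fin N → ℂ := fun p => θ p.1 • a p with hz₀
  have hz₀s : ContDiff ℝ ∞ z₀ := (hθ.comp contDiff_fst).smul has
  -- The test function carries the inverse transport `P'` along the tube; `ψ` equals `1` between
  -- `t₀` and `t₁` and falls to `0` within `δ` on either side.
  set b : Spacetime n → Op N := fun p => ψ p.1 • χ₂ (rayCoord ν p) • P' p with hb
  set U : Set (Spacetime n) := Ioo 0 T ×ˢ univ with hUdef
  have hU : IsOpen U := isOpen_Ioo.prod isOpen_univ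
  have hUs : U ⊆ slab n T := prod_mono Ioo_subset_Ico_self le_rfl
  have ht0 : t₀ - δ < t₀ := by linarith
  have ht1 : t₁ < t₁ + δ := by linarith
  have hχb : ∀ p, χ (rayCoord ν p) ≠ 0 → rayCoord ν p ∈ Metric.closedBall y₀ (2 * δ) := fun p hp =>
    hχs (subset_tsupport χ hp)
  have hχ₂b : ∀ p, χ₂ (rayCoord ν p) ≠ 0 → rayCoord ν p ∈ Metric.closedBall y₀ (2 * δ) := fun p hp =>
    hχ₂s (subset_tsupport χ₂ hp)
  have hbt : IsTest U b := by
    have hsub : tsupport b ⊆ tube ν y₀ (t₀ - δ) (t₁ + δ) (2 * δ) := by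
      refine closure_minimal (fun p hp => ?_) (isCompact_tube _ _ _ _ _).isClosed
      have hne : ψ p.1 • χ₂ (rayCoord ν p) • P' p ≠ 0 := hp
      have h2 : χ₂ (rayCoord ν p) ≠ 0 := fun h => hne (by ext v : 1; simp [h])
      have h3 : ψ p.1 ≠ 0 := fun h => hne (by ext v : 1; simp [h])
      refine ⟨⟨?_, ?_⟩, hχ₂b p h2⟩
      · by_contra h
        exact h3 (by simp only [hψdef]; rw [smoothStep_of_le ht0 (not_le.1 h).le, zero_mul])
      · by_contra h
        exact h3 (by simp only [hψdef]; rw [smoothStep_of_ge ht1 (not_le.1 h).le, sub_self, mul_zero])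
    exact ⟨(hψ.comp contDiff_fst).smul ((hχ₂.comp (contDiff_rayCoord ν)).smul hP'),
      (isCompact_tube _ _ _ _ _).of_isClosed_subset (isClosed_tsupport _) hsub,
      hsub.trans fun p hp => ⟨⟨by linarith [hp.1.1], by linarith [hp.1.2]⟩, mem_univ _⟩⟩
  set D : Spacetime n → Op N := fun p => Q₂ p - Q₁ p with hD
  have hDs : ContDiff ℝ ∞ D := hQ₂.sub hQ₁
  have hbD : IsTest U fun p => b p * D p :=
    hbt.of_support_subset (contDiff_mul_op hbt.smooth hDs) fun p hp => by simp [hp]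
  have hC : ContDiff ℝ ∞ (rayCoeff A ν) :=
    (hA 0).neg.add (ContDiff.sum fun i _ => (hA i.succ).const_smul (ν i : ℂ))
  have hbC : IsTest U fun p => b p * rayCoeff A ν p :=
    hbt.of_support_subset (contDiff_mul_op hbt.smooth hC) fun p hp => by simp [hp]
  obtain ⟨β, hβ, hgreen⟩ := exists_green hA hQ₁ hU hbt
  obtain ⟨C₁, hC₁0, hC₁⟩ := exists_oscillatory_bound hU hβ ν
  obtain ⟨C₂, hC₂0, hC₂⟩ := exists_oscillatory_bound hU hbD ν
  have hg : ∀ {Q : Spacetime n → Op N}, ContDiff ℝ ∞ Q →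
      Continuous fun p : Spacetime n => ‖θ p.1 • waveOpCLM A Q a p‖ := fun {Q} hQ =>
    ((hθ.comp contDiff_fst).smul (contDiff_waveOpCLM hA hQ has)).continuous.norm
  have hAc := fun j => (hA j).continuous
  -- These bounds are fixed before `τ`: the remainder equations have right-hand sides dominated by
  -- `‖θ □a‖`, which does not involve `τ`.
  obtain ⟨E₁, hE₁⟩ := exists_wave_bound hAc hQ₁.continuous hβ.compact.isCompact hβ.subset (hg hQ₁)
  obtain ⟨E₂, hE₂⟩ := exists_wave_bound hAc hQ₂.continuous hβ.compact.isCompact hβ.subset (hg hQ₂)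
  obtain ⟨E₃, hE₃⟩ := exists_wave_bound hAc hQ₂.continuous hbD.compact.isCompact hbD.subset (hg hQ₂)
  set I := ∫ p, b p (D p (z₀ p)) with hI
  -- `I` is independent of `τ`, so a bound of order `1 / τ` forces it to vanish.
  suffices hmain : ∀ τ : ℝ, 0 < τ → ‖I‖ * τ ≤ C₁ * E₁ + C₁ * E₂ + C₂ * E₃ by
    by_contra hne
    have hI0 : 0 < ‖I‖ := norm_pos_iff.2 hne
    set B := C₁ * E₁ + C₁ * E₂ + C₂ * E₃
    have h := hmain ((|B| + 1) / ‖I‖) (by positivity)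
    rw [mul_div_cancel₀ _ hI0.ne'] at h
    linarith [le_abs_self B]
  intro τ hτ
  set e := wavePhase ν τ with he
  set e' := wavePhase ν (-τ) with he'
  have hes : ContDiff ℝ ∞ e := contDiff_wavePhase ν τ
  have hes' : ContDiff ℝ ∞ e' := contDiff_wavePhase ν (-τ)
  have hee : ∀ p, e p * e' p = 1 := wavePhase_mul_neg ν τ
  have hee2 : ∀ p, e' p * e p = 1 := fun p => by rw [mul_comm]; exact hee p
  set f := beamSource A ν τ θ a with hf
  have hfs : ContDiff ℝ ∞ f := contDiff_beamSource hA ν τ hθ has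
  have hfsub : tsupport f ⊆ tube ν y₀ (t₀ - δ) t₀ (2 * δ) := by
    refine closure_minimal (fun p hp => ?_) (isCompact_tube _ _ _ _ _).isClosed
    by_contra hnot
    refine hp (beamSource_eq_zero ?_)
    by_cases hr : rayCoord ν p ∈ Metric.closedBall y₀ (2 * δ)
    · right
      rcases lt_or_ge p.1 (t₀ - δ) with h | h
      · exact Or.inl (smoothStep_eventually_zero ht0 h)
      · refine Or.inr (smoothStep_eventually_one ht0 ?_)
        by_contra h'
        exact hnot ⟨⟨h, not_lt.1 h'⟩, hr⟩
    · left
      filter_upwards [(contDiff_rayCoord ν).continuous.continuousAt.eventually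
        (Metric.isClosed_closedBall.isOpen_compl.mem_nhds hr)] with q hq
      have : χ (rayCoord ν q) = 0 := by
        by_contra h
        exact hq (hχb q h)
      simp [ha, amplitude, this]
  obtain ⟨u₁, u₂, ⟨hu₁, hu₁0, hu₁e⟩, ⟨hu₂, hu₂0, hu₂e⟩, hu⟩ := hsol f hfs
    ((isCompact_tube _ _ _ _ _).of_isClosed_subset (isClosed_tsupport _) hfsub)
    (hfsub.trans fun p hp => ⟨⟨by linarith [hp.1.1], by linarith [hp.1.2]⟩, hS p (Or.inl hp)⟩)
  have hez : ContDiff ℝ ∞ fun p => e p • z₀ p := hes.smul hz₀s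
  have hPU : ∀ p ∈ U, χ (rayCoord ν p) ≠ 0 → fderiv ℝ P p (1, ν) = rayCoeff A ν p * P p := fun p hp h =>
    hPd p ⟨⟨hp.1.1.le, hp.1.2.le⟩, hχb p h⟩
  have hez0 : ZeroData fun p => e p • z₀ p := by
    have h2 : ∀ x, (fun t : ℝ => e (t, x) • z₀ (t, x)) =ᶠ[nhds 0] fun _ => 0 := fun x => by
      filter_upwards [smoothStep_eventually_zero ht0 h0] with t ht
      simp only [hz₀, hθdef, ht, zero_smul, smul_zero]
    exact ⟨fun x => (h2 x).eq_of_nhds, fun x =>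
      ((hasDerivAt_const (0 : ℝ) (0 : Fin N → ℂ)).congr_of_eventuallyEq (h2 x)).hasDerivWithinAt⟩
  -- The remainder has source `-e θ □a`, and `|e| = 1`; its Cauchy data are zero because `θ`
  -- vanishes near `t = 0`.
  have hrem : ∀ {Q : Spacetime n → Op N} {u : Spacetime n → Fin N → ℂ}, ContDiffOn ℝ ∞ u (slab n T) →
      ZeroData u → (∀ p ∈ U, waveOpCLM A Q u p = f p) →
      ContDiffOn ℝ ∞ (fun p => u p - e p • z₀ p) (slab n T) ∧ ZeroData (fun p => u p - e p • z₀ p) ∧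
      ∀ p ∈ U, ‖waveOpCLM A Q (fun p => u p - e p • z₀ p) p‖ ≤ ‖θ p.1 • waveOpCLM A Q a p‖ := by
    intro Q u hu hu0 hue
    refine ⟨hu.sub hez.contDiffOn, ⟨fun x => by
      simpa [hu0.1 x] using hez0.1 x, fun x => ?_⟩, fun p hp => ?_⟩
    · have := (hu0.2 x).sub (hez0.2 x)
      rw [sub_zero] at this
      exact this
    · rw [waveOpCLM_sub (hu.contDiffAt (Filter.mem_of_superset (hU.mem_nhds hp) hUs)) hez.contDiffAt,
        hue p hp, waveOpCLM_beam Q hν τ hP hχ c hθ (hPU p hp), sub_add_cancel_left, norm_neg, norm_smul,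
        norm_wavePhase, one_mul]
  obtain ⟨hr₁, hr₁0, hr₁b⟩ := hrem hu₁ hu₁0 hu₁e
  obtain ⟨hr₂, hr₂0, hr₂b⟩ := hrem hu₂ hu₂0 hu₂e
  set r₁ := fun p => u₁ p - e p • z₀ p with hr₁def
  set r₂ := fun p => u₂ p - e p • z₀ p with hr₂def
  set w := fun p => u₁ p - u₂ p with hw
  have hwU : ContDiffOn ℝ ∞ w U := (hu₁.mono hUs).sub (hu₂.mono hUs)
  set z := fun p => e' p • w p with hz
  have hzU : ContDiffOn ℝ ∞ z U := hes'.contDiffOn.smul hwU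
  have hzr : ∀ p, z p = e' p • r₁ p - e' p • r₂ p := fun p => by
    simp only [hz, hw, hr₁def, hr₂def, ← smul_sub]
    congr 1
    abel
  have hwe : w = fun p => e p • z p := by
    funext p
    simp only [hz, smul_smul, hee, one_smul]
  have hbox : ∀ p ∈ U, waveOpCLM A Q₁ w p = D p (u₂ p) := fun p hp => by
    have h1 := hu₁e p hp
    have h2 := hu₂e p hp
    rw [waveOpCLM_add_potential] at h2
    have hs : slab n T ∈ nhds p := Filter.mem_of_superset (hU.mem_nhds hp) hUs
    rw [hw, waveOpCLM_sub (hu₁.contDiffAt hs) (hu₂.contDiffAt hs), h1,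
      waveOpCLM_add_potential (Q := Q₁) u₂, ← h2]
    simp only [hD, sub_apply]
    abel
  -- The equation `□w = D u₂`, multiplied by `e' = e⁻¹` and tested with `b`, after splitting `u₂ = e
  -- z₀ + r₂`.
  have hpt : ∀ p, b p (D p (z₀ p)) + (b p * D p) (e' p • r₂ p) =
      (2 * Complex.I * τ) • (b p (fderiv ℝ z p (1, ν)) - b p (rayCoeff A ν p (z p))) +
        b p (waveOpCLM A Q₁ z p) := by
    intro p
    by_cases hp : p ∈ tsupport b
    · have hpU := hbt.subset hp
      have h1 := hbox p hpU
      rw [hwe, waveOpCLM_wavePhase hν τ (hzU.contDiffAt (hU.mem_nhds hpU))] at h1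
      have h2 := congrArg (fun v => e' p • v) h1
      beta_reduce at h2
      rw [smul_smul, show e' p * wavePhase ν τ p = 1 from hee2 p, one_smul] at h2
      have h3 : D p (z₀ p) + D p (e' p • r₂ p) = e' p • D p (u₂ p) := by
        rw [← map_add, ← map_smul]
        congr 1
        simp only [hr₂def, smul_sub, smul_smul, hee2, one_smul]
        abel
      calc _ = b p (D p (z₀ p) + D p (e' p • r₂ p)) := by rw [map_add]; rfl
        _ = _ := by rw [h3, ← h2, map_add, map_smul, map_sub]
    · simp [image_eq_zero_of_notMem_tsupport hp]
  have hflux : ∀ p, (fderiv ℝ b p (1, ν)) (z p) + (b p * rayCoeff A ν p) (z p) = 0 := by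
    intro p
    by_cases hp : p ∈ tsupport b
    swap
    · have h1 : fderiv ℝ b p = 0 := by
        by_contra h
        exact hp (tsupport_fderiv_subset ℝ (subset_tsupport (fderiv ℝ b) h))
      simp [image_eq_zero_of_notMem_tsupport hp, h1]
    have hpU := hbt.subset hp
    have hχd := (hχ₂.comp (contDiff_rayCoord ν)).differentiable (by simp) p
    have hψd := (hψ.comp (contDiff_fst (F := EuclideanSpace ℝ (Fin n)))).differentiable (by simp) p
    have hcd : DifferentiableAt ℝ (fun p => χ₂ (rayCoord ν p) • P' p) p :=
      hχd.smul (hP'.differentiable (by simp) p)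
    have e1 := fderiv_real_smul hψd hcd (1, ν)
    have e2 := fderiv_real_smul hχd (hP'.differentiable (by simp) p) (1, ν)
    have e3 := fderiv_comp_rayCoord hχ₂ ν p
    have e4 := fderiv_comp_time hψ ν p
    simp only [Function.comp_def] at e1 e2
    rw [hb, e1, e2, e3, e4]
    by_cases hχ0 : χ₂ (rayCoord ν p) = 0
    · simp [hχ0]
    have hball := hχ₂b p hχ0
    rw [hPd' p ⟨⟨hpU.1.1.le, hpU.1.2.le⟩, hball⟩]
    -- `ψ` varies only in the two end pieces of the tube. These lie over `S`, where `w` and hence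
    -- `z` vanish, so no error of order `τ` arises there.
    have key : deriv ψ p.1 = 0 ∨ z p = 0 := by
      have hz0 : ∀ p' ∈ U, p'.2 ∈ S → z p' = 0 := fun p' hp' hps => by
        simp only [hz, hw, hu p' ⟨hp'.1, hps⟩, sub_self, smul_zero]
      rcases lt_or_ge p.1 (t₀ - δ) with h | h
      · left
        have : ψ =ᶠ[nhds p.1] fun _ => 0 := by
          filter_upwards [smoothStep_eventually_zero ht0 h] with t ht
          simp only [hψdef, ht, zero_mul]
        rw [this.deriv_eq, deriv_const]
      rcases le_or_gt p.1 t₀ with h' | h'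
      · right; exact hz0 p hpU (hS p (Or.inl ⟨⟨h, h'⟩, hball⟩))
      rcases lt_or_ge p.1 t₁ with g | g
      · left
        have : ψ =ᶠ[nhds p.1] fun _ => 1 := by
          filter_upwards [smoothStep_eventually_one ht0 h', smoothStep_eventually_zero ht1 g] with t h1 h2
          simp only [hψdef, h1, h2]; norm_num
        rw [this.deriv_eq, deriv_const]
      rcases le_or_gt p.1 (t₁ + δ) with g' | g'
      · right; exact hz0 p hpU (hS p (Or.inr ⟨⟨g, g'⟩, hball⟩))
      · left
        have : ψ =ᶠ[nhds p.1] fun _ => 0 := by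
          filter_upwards [smoothStep_eventually_one ht1 g'] with t ht
          simp only [hψdef, ht, sub_self, mul_zero]
        rw [this.deriv_eq, deriv_const]
    rcases key with h | h
    · rw [h]; simp
    · rw [h]; simp
  have hzc := hzU.continuousOn
  have i1 := integrable_test hbt hU
    ((hzU.continuousOn_fderiv_of_isOpen hU (by simp)).clm_apply (continuousOn_const (c := ((1 : ℝ), ν))))
  have i2 := integrable_test hbC hU hzc
  have hbox2 : ContinuousOn (waveOpCLM A Q₁ z) U := by
    have h : waveOpCLM A Q₁ z = fun p => dalembert z p + lowerOrder A Q₁ z p := funext (waveOpCLM_eq A Q₁ z)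
    have d1 := fun j => contDiffOn_dpart hU hzU j
    have d2 := fun j => (contDiffOn_dpart hU (d1 j) j).continuousOn
    have hap : ∀ {B : Spacetime n → Op N} {y : Spacetime n → Fin N → ℂ}, ContDiff ℝ ∞ B →
        ContinuousOn y U → ContinuousOn (fun p => B p (y p)) U := fun hB hy =>
      ((evalPairing N).continuous.comp hB.continuous).continuousOn.clm_apply hy
    rw [h]
    refine ContinuousOn.add (ContinuousOn.sub (d2 0) (continuousOn_finsetSum _ fun i _ => d2 _))
      (ContinuousOn.add ?_ (hap hQ₁ hzc))
    exact (continuousOn_finsetSum _ fun j _ => hap (hA j) (d1 j).continuousOn).const_smul (2 : ℂ)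
  have i3 := integrable_test hbt hU hbox2
  have i4 := integrable_test hbD hU hz₀s.continuous.continuousOn
  have i5 := integrable_test hbD hU (hes'.continuous.continuousOn.smul (hr₂.mono hUs).continuousOn)
  have i6 := integrable_test hβ hU (hes'.continuous.continuousOn.smul (hr₁.mono hUs).continuousOn)
  have i7 := integrable_test hβ hU (hes'.continuous.continuousOn.smul (hr₂.mono hUs).continuousOn)
  -- Moving the derivative onto `b` produces the adjoint transport equation, and `hflux` says that
  -- its defect is invisible to `z`.
  have hJ : ∫ p, (b p (fderiv ℝ z p (1, ν)) - b p (rayCoeff A ν p (z p))) = 0 := by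
    have h1 : ∫ p, (b p (fderiv ℝ z p (1, ν)) - b p (rayCoeff A ν p (z p))) =
        (∫ p, b p (fderiv ℝ z p (1, ν))) - ∫ p, (b p * rayCoeff A ν p) (z p) :=
      MeasureTheory.integral_sub i1 i2
    rw [h1, integral_test_fderiv hbt hU hzU]
    have h2 : ∀ p, (b p * rayCoeff A ν p) (z p) = -(fderiv ℝ b p (1, ν)) (z p) := fun p =>
      eq_neg_of_add_eq_zero_right (hflux p)
    simp_rw [h2]
    rw [MeasureTheory.integral_neg, sub_self]
  -- Since `z = e' r₁ - e' r₂`, every integral except `I` is a remainder times the oscillating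
  -- factor, to which the bound of order `1 / τ` applies.
  have hid : I + ∫ p, (b p * D p) (e' p • r₂ p) =
      (∫ p, β p (e' p • r₁ p)) - ∫ p, β p (e' p • r₂ p) := by
    have h1 : I + ∫ p, (b p * D p) (e' p • r₂ p) =
        ∫ p, (b p (D p (z₀ p)) + (b p * D p) (e' p • r₂ p)) := (MeasureTheory.integral_add i4 i5).symm
    have h2 : ∫ p, ((2 * Complex.I * τ) • (b p (fderiv ℝ z p (1, ν)) - b p (rayCoeff A ν p (z p))) +
        b p (waveOpCLM A Q₁ z p)) = (2 * Complex.I * τ) • (∫ p, (b p (fderiv ℝ z p (1, ν)) -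
          b p (rayCoeff A ν p (z p)))) + ∫ p, b p (waveOpCLM A Q₁ z p) := by
      rw [← MeasureTheory.integral_smul]
      exact MeasureTheory.integral_add ((i1.sub i2).smul (2 * Complex.I * (τ : ℂ))) i3
    rw [h1]
    simp_rw [hpt]
    have h3 : (∫ p, β p (e' p • r₁ p)) - ∫ p, β p (e' p • r₂ p) =
        ∫ p, (β p (e' p • r₁ p) - β p (e' p • r₂ p)) := (MeasureTheory.integral_sub i6 i7).symm
    rw [h2, hJ, smul_zero, zero_add, hgreen z hzU, h3]
    simp_rw [hzr, map_sub]
  have b1 := hC₁ r₁ τ (hr₁.mono hUs) hτ (continuousOn_firstOrder hr₁)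
  have b2 := hC₁ r₂ τ (hr₂.mono hUs) hτ (continuousOn_firstOrder hr₂)
  have b3 := hC₂ r₂ τ (hr₂.mono hUs) hτ (continuousOn_firstOrder hr₂)
  have k1 := hE₁ r₁ hr₁ hr₁0 hr₁b
  have k2 := hE₂ r₂ hr₂ hr₂0 hr₂b
  have k3 := hE₃ r₂ hr₂ hr₂0 hr₂b
  have hI2 : I = (∫ p, β p (e' p • r₁ p)) - (∫ p, β p (e' p • r₂ p)) - ∫ p, (b p * D p) (e' p • r₂ p) := by
    rw [← hid]; abel
  calc ‖I‖ * τ ≤ (C₁ / τ * E₁ + C₁ / τ * E₂ + C₂ / τ * E₃) * τ := by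
        gcongr
        rw [hI2]
        refine (norm_sub_le _ _).trans (add_le_add ((norm_sub_le _ _).trans (add_le_add ?_ ?_)) ?_)
        · exact b1.trans (by gcongr)
        · exact b2.trans (by gcongr)
        · exact b3.trans (by gcongr)
    _ = _ := by field_simp

end Beam

/-! ### From thin tubes to single rays -/

section Rays

variable {n N : ℕ} {V : Type*} [NormedAddCommGroup V] [NormedSpace ℝ V] [CompleteSpace V]

/-- If the integrals of `g` against all bumps concentrated near a ray vanish, so does the integral
along the ray. -/
theorem integral_ray_of_bump {k : ℝ → ℝ} (hk : Continuous k) {a b : ℝ} (hab : a ≤ b)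
    (hks : ∀ t, t ∉ Icc a b → k t = 0) {g : Spacetime n → V} (hg : Continuous g)
    {ν y₀ : EuclideanSpace ℝ (Fin n)} {δ : ℝ} (hδ : 0 < δ)
    (h : ∀ χ : EuclideanSpace ℝ (Fin n) → ℝ, ContDiff ℝ ∞ χ → HasCompactSupport χ →
      tsupport χ ⊆ Metric.ball y₀ δ → ∫ p : Spacetime n, k p.1 • χ (rayCoord ν p) • g p = 0) :
    ∫ t in a..b, k t • g (t, y₀ + t • ν) = 0 := by
  set G : EuclideanSpace ℝ (Fin n) → V := fun y => ∫ t in a..b, k t • g (t, y + t • ν) with hG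
  have hGc : Continuous G := by
    refine intervalIntegral.continuous_parametric_intervalIntegral_of_continuous' ?_ a b
    have : Continuous fun q : EuclideanSpace ℝ (Fin n) × ℝ => k q.2 • g (q.2, q.1 + q.2 • ν) := by
      fun_prop
    exact this
  -- The shear `y = x - tν` and Fubini rewrite the hypothesis as `∫ χ G = 0` for every bump `χ`, so
  -- `G` vanishes almost everywhere in the ball; continuity then gives its value at `y₀`.
  have hae : ∀ᵐ y ∂(MeasureTheory.volume : MeasureTheory.Measure (EuclideanSpace ℝ (Fin n))),
      y ∈ Metric.ball y₀ δ → G y = 0 := by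
    refine Metric.isOpen_ball.ae_eq_zero_of_integral_contDiff_smul_eq_zero
      (hGc.locallyIntegrable.locallyIntegrableOn _) fun χ hχ hχc hχs => ?_
    have hχcont := hχ.continuous
    set K : ℝ × EuclideanSpace ℝ (Fin n) → V := fun q => k q.1 • χ q.2 • g (q.1, q.2 + q.1 • ν) with hK
    have hKc : Continuous K := by fun_prop
    have hKi : MeasureTheory.Integrable K := by
      refine hKc.integrable_of_hasCompactSupport
        (HasCompactSupport.intro (isCompact_Icc.prod hχc.isCompact : IsCompact (Icc a b ×ˢ tsupport χ))
          fun q hq => ?_)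
      by_cases h1 : q.1 ∈ Icc a b
      · have h2 : q.2 ∉ tsupport χ := fun h2 => hq ⟨h1, h2⟩
        simp [hK, image_eq_zero_of_notMem_tsupport h2]
      · simp [hK, hks _ h1]
    have hFi : MeasureTheory.Integrable fun p : Spacetime n => k p.1 • χ (rayCoord ν p) • g p := by
      have hc : Continuous fun p : Spacetime n => k p.1 • χ (rayCoord ν p) • g p := by
        have := (contDiff_rayCoord ν).continuous
        fun_prop
      have hcpt : IsCompact ((fun q : Spacetime n => ((q.1, q.2 + q.1 • ν) : Spacetime n)) ''
          (Icc a b ×ˢ tsupport χ)) := (isCompact_Icc.prod hχc.isCompact).image (by fun_prop)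
      refine hc.integrable_of_hasCompactSupport (HasCompactSupport.intro hcpt fun p hp => ?_)
      by_cases h1 : p.1 ∈ Icc a b
      · have h2 : rayCoord ν p ∉ tsupport χ := fun h2 =>
          hp ⟨(p.1, rayCoord ν p), ⟨h1, h2⟩, Prod.ext rfl (rayCoord_add ν p)⟩
        simp [image_eq_zero_of_notMem_tsupport h2]
      · simp [hks _ h1]
    have h1 := h χ hχ hχc hχs
    have h2 : ∫ p : Spacetime n, k p.1 • χ (rayCoord ν p) • g p = ∫ t, ∫ y, K (t, y) := by
      rw [MeasureTheory.Measure.volume_eq_prod, MeasureTheory.integral_prod _ hFi]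
      refine MeasureTheory.integral_congr_ae (Filter.Eventually.of_forall fun t => ?_)
      beta_reduce
      rw [← MeasureTheory.integral_add_right_eq_self _ (t • ν)]
      simp [hK, rayCoord]
    rw [h2, MeasureTheory.integral_integral_swap hKi] at h1
    rw [← h1]
    refine MeasureTheory.integral_congr_ae (Filter.Eventually.of_forall fun y => ?_)
    simp only [hG, hK]
    have h3 : ∫ t, k t • χ y • g (t, y + t • ν) = ∫ t in Icc a b, k t • χ y • g (t, y + t • ν) :=
      (MeasureTheory.setIntegral_eq_integral_of_forall_compl_eq_zero fun t ht => by
        rw [hks t ht, zero_smul]).symm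
    rw [h3, intervalIntegral.integral_of_le hab, MeasureTheory.integral_Icc_eq_integral_Ioc,
      ← MeasureTheory.integral_smul]
    simp_rw [smul_comm (χ y)]
  have hae2 : G =ᵐ[MeasureTheory.volume.restrict (Metric.ball y₀ δ)] fun _ => 0 :=
    (MeasureTheory.ae_restrict_iff' Metric.isOpen_ball.measurableSet).2 hae
  exact MeasureTheory.Measure.eqOn_open_of_ae_eq hae2 Metric.isOpen_ball hGc.continuousOn
    continuousOn_const (Metric.mem_ball_self hδ)

variable {A : Fin (n + 1) → Spacetime n → Op N}

/-- The weighted ray transform of `Q₂ - Q₁` vanishes along rays with endpoints in the interior of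
the observation region. -/
theorem integral_ray_eq_zero (hA : ∀ j, ContDiff ℝ ∞ (A j)) {Q₁ Q₂ : Spacetime n → Op N}
    (hQ₁ : ContDiff ℝ ∞ Q₁) (hQ₂ : ContDiff ℝ ∞ Q₂) {T : ℝ} {S : Set (EuclideanSpace ℝ (Fin n))}
    (hQS : ∀ p : Spacetime n, p.2 ∈ S → Q₁ p = 0 ∧ Q₂ p = 0)
    (hsol : ∀ f : Spacetime n → Fin N → ℂ, ContDiff ℝ ∞ f → HasCompactSupport f →
      tsupport f ⊆ Ioo 0 T ×ˢ S → ∃ u₁ u₂ : Spacetime n → Fin N → ℂ,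
        (ContDiffOn ℝ ∞ u₁ (slab n T) ∧ ZeroData u₁ ∧
          ∀ p ∈ Ioo 0 T ×ˢ (univ : Set (EuclideanSpace ℝ (Fin n))), waveOpCLM A Q₁ u₁ p = f p) ∧
        (ContDiffOn ℝ ∞ u₂ (slab n T) ∧ ZeroData u₂ ∧
          ∀ p ∈ Ioo 0 T ×ˢ (univ : Set (EuclideanSpace ℝ (Fin n))), waveOpCLM A Q₂ u₂ p = f p) ∧
        ∀ p ∈ Ioo 0 T ×ˢ S, u₁ p = u₂ p)
    {ν y₀ : EuclideanSpace ℝ (Fin n)} (hν : ‖ν‖ = 1) {t₀ t₁ : ℝ} (h0 : 0 < t₀)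
    (h01 : t₀ ≤ t₁) (h1 : t₁ < T) (hS₀ : y₀ + t₀ • ν ∈ interior S) (hS₁ : y₀ + t₁ • ν ∈ interior S)
    {P P' : Spacetime n → Op N} (hP : ContDiff ℝ ∞ P) (hP' : ContDiff ℝ ∞ P')
    {W : Set (EuclideanSpace ℝ (Fin n))} (hW : W ∈ nhds y₀)
    (hPd : ∀ p : Spacetime n, p.1 ∈ Icc 0 T → rayCoord ν p ∈ W →
      fderiv ℝ P p (1, ν) = rayCoeff A ν p * P p)
    (hPd' : ∀ p : Spacetime n, p.1 ∈ Icc 0 T → rayCoord ν p ∈ W →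
      fderiv ℝ P' p (1, ν) = -(P' p * rayCoeff A ν p)) (c : Fin N → ℂ) :
    ∫ t in t₀..t₁, P' (t, y₀ + t • ν) ((Q₂ (t, y₀ + t • ν) - Q₁ (t, y₀ + t • ν))
      (P (t, y₀ + t • ν) c)) = 0 := by
  have hev : ∀ {s : ℝ}, y₀ + s • ν ∈ interior S → ∃ ε > 0, ∀ p : Spacetime n, |p.1 - s| ≤ ε →
      rayCoord ν p ∈ Metric.closedBall y₀ (2 * ε) → p.2 ∈ S := by
    intro s hs
    have hc : Continuous fun q : ℝ × EuclideanSpace ℝ (Fin n) => q.2 + q.1 • ν := by fun_prop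
    have hn : (fun q : ℝ × EuclideanSpace ℝ (Fin n) => q.2 + q.1 • ν) ⁻¹' interior S ∈ nhds (s, y₀) :=
      (isOpen_interior.preimage hc).mem_nhds hs
    obtain ⟨ε, hε, hb⟩ := Metric.mem_nhds_iff.1 hn
    refine ⟨ε / 3, by positivity, fun p hp1 hp2 => ?_⟩
    have : ((p.1, rayCoord ν p) : ℝ × EuclideanSpace ℝ (Fin n)) ∈ Metric.ball (s, y₀) ε := by
      rw [Metric.mem_closedBall] at hp2
      rw [Metric.mem_ball, Prod.dist_eq, Real.dist_eq]
      exact max_lt (by linarith) (by linarith)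
    have h2 := interior_subset (hb this)
    simpa only [rayCoord_add] using h2
  obtain ⟨ε₀, hε₀, hs₀⟩ := hev hS₀
  obtain ⟨ε₁, hε₁, hs₁⟩ := hev hS₁
  obtain ⟨ε₂, hε₂, hs₂⟩ := Metric.mem_nhds_iff.1 hW
  obtain ⟨δ, hδ, hδ0, hδ1, hδ2, hδ3, hδ4⟩ : ∃ δ : ℝ, 0 < δ ∧ δ ≤ ε₀ ∧ δ ≤ ε₁ ∧ 2 * δ < ε₂ ∧ δ < t₀ ∧
      t₁ + δ < T := by
    have hm : 0 < min (min ε₀ ε₁) (min ε₂ (min t₀ (T - t₁))) :=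
      lt_min (lt_min hε₀ hε₁) (lt_min hε₂ (lt_min h0 (by linarith)))
    refine ⟨min (min ε₀ ε₁) (min ε₂ (min t₀ (T - t₁))) / 3, by positivity, ?_, ?_, ?_, ?_, ?_⟩
    · linarith [min_le_left (min ε₀ ε₁) (min ε₂ (min t₀ (T - t₁))), min_le_left ε₀ ε₁]
    · linarith [min_le_left (min ε₀ ε₁) (min ε₂ (min t₀ (T - t₁))), min_le_right ε₀ ε₁]
    · linarith [min_le_right (min ε₀ ε₁) (min ε₂ (min t₀ (T - t₁))), min_le_left ε₂ (min t₀ (T - t₁))]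
    · linarith [min_le_right (min ε₀ ε₁) (min ε₂ (min t₀ (T - t₁))), min_le_right ε₂ (min t₀ (T - t₁)),
        min_le_left t₀ (T - t₁)]
    · linarith [min_le_right (min ε₀ ε₁) (min ε₂ (min t₀ (T - t₁))), min_le_right ε₂ (min t₀ (T - t₁)),
        min_le_right t₀ (T - t₁)]
  have hball : Metric.closedBall y₀ (2 * δ) ⊆ W :=
    (Metric.closedBall_subset_ball hδ2).trans hs₂
  have hballle : ∀ {ε}, δ ≤ ε → Metric.closedBall y₀ (2 * δ) ⊆ Metric.closedBall y₀ (2 * ε) := fun h =>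
    Metric.closedBall_subset_closedBall (by linarith)
  have hSt : ∀ p ∈ tube ν y₀ (t₀ - δ) t₀ (2 * δ) ∪ tube ν y₀ t₁ (t₁ + δ) (2 * δ), p.2 ∈ S := by
    rintro p (hp | hp)
    · exact hs₀ p (by rw [abs_le]; constructor <;> linarith [hp.1.1, hp.1.2]) (hballle hδ0 hp.2)
    · exact hs₁ p (by rw [abs_le]; constructor <;> linarith [hp.1.1, hp.1.2]) (hballle hδ1 hp.2)
  -- The translate `χ₂` of `ζ` equals `1` on the ball carrying `χ`, so `χ₂ χ = χ` and the pairing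
  -- becomes linear in `χ`.
  obtain ⟨ζ, hζ, hζ1, hζs, -⟩ := exists_cutoff (X := EuclideanSpace ℝ (Fin n)) hδ
  set χ₂ : EuclideanSpace ℝ (Fin n) → ℝ := fun y => ζ (y - y₀) with hχ₂def
  have hχ₂ : ContDiff ℝ ∞ χ₂ := hζ.comp (contDiff_id.sub contDiff_const)
  have hχ₂s : tsupport χ₂ ⊆ Metric.closedBall y₀ (2 * δ) := by
    refine closure_minimal (fun y hy => ?_) Metric.isClosed_closedBall
    have := hζs (subset_tsupport ζ hy)
    rwa [mem_closedBall_zero_iff, ← mem_closedBall_iff_norm] at this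
  set D : Spacetime n → Op N := fun p => Q₂ p - Q₁ p with hD
  have hDs : ContDiff ℝ ∞ D := hQ₂.sub hQ₁
  set g : Spacetime n → Fin N → ℂ := fun p => P' p (D p (P p c)) with hg
  have hgc : Continuous g :=
    (contDiff_clm_apply hP' (contDiff_clm_apply hDs (contDiff_clm_apply hP contDiff_const))).continuous
  set k : ℝ → ℝ := fun t => (smoothStep (t₀ - δ) t₀ t * (1 - smoothStep t₁ (t₁ + δ) t)) *
    smoothStep (t₀ - δ) t₀ t with hk
  have hkc : Continuous k := by
    have h1 := (contDiff_smoothStep (t₀ - δ) t₀).continuous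
    have h2 := (contDiff_smoothStep t₁ (t₁ + δ)).continuous
    fun_prop
  have ht0 : t₀ - δ < t₀ := by linarith
  have ht1 : t₁ < t₁ + δ := by linarith
  have hks : ∀ t, t ∉ Icc (t₀ - δ) (t₁ + δ) → k t = 0 := by
    intro t ht
    rcases lt_or_ge t (t₀ - δ) with h | h
    · simp only [hk]; rw [smoothStep_of_le ht0 h.le, mul_zero]
    · have : t₁ + δ < t := by
        by_contra h'; exact ht ⟨h, not_lt.1 h'⟩
      simp only [hk]; rw [smoothStep_of_ge ht1 this.le, sub_self, mul_zero, zero_mul]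
  have hmain := integral_ray_of_bump hkc (by linarith : t₀ - δ ≤ t₁ + δ) hks hgc (ν := ν) (y₀ := y₀) hδ
    fun χ hχ _ hχs => by
      rw [← integral_beam_eq_zero hA hQ₁ hQ₂ hsol hν hδ (by linarith) h01 hδ4 hSt hP hP'
        (fun p hp => hPd p hp.1 (hball hp.2)) (fun p hp => hPd' p hp.1 (hball hp.2)) hχ
        (hχs.trans (Metric.ball_subset_closedBall.trans
          (Metric.closedBall_subset_closedBall (by linarith)))) hχ₂ hχ₂s c]
      refine MeasureTheory.integral_congr_ae (Filter.Eventually.of_forall fun p => ?_)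
      have h2 : χ₂ (rayCoord ν p) * χ (rayCoord ν p) = χ (rayCoord ν p) := by
        by_cases h0 : χ (rayCoord ν p) = 0
        · rw [h0, mul_zero]
        · have := hχs (subset_tsupport χ h0)
          rw [mem_ball_iff_norm] at this
          simp only [hχ₂def, hζ1 _ this.le, one_mul]
      simp only [hk, hg, hD, amplitude, ContinuousLinearMap.map_smul_of_tower, smul_apply, smul_smul]
      congr 1
      linear_combination (-(smoothStep (t₀ - δ) t₀ p.1 ^ 2 * (1 - smoothStep t₁ (t₁ + δ) p.1))) * h2
  -- On the two short end pieces the ray runs over `S`, where both potentials vanish, so the profile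
  -- of the switching functions does not matter; between `t₀` and `t₁` one has `k = 1`.
  have hsub : ∀ t ∈ Icc (t₀ - δ) (t₁ + δ), t ∉ Icc t₀ t₁ → k t • g (t, y₀ + t • ν) = 0 := by
    intro t ht hnot
    have hDz : D (t, y₀ + t • ν) = 0 := by
      have hr : rayCoord ν ((t, y₀ + t • ν) : Spacetime n) ∈ Metric.closedBall y₀ (2 * δ) := by
        have : rayCoord ν ((t, y₀ + t • ν) : Spacetime n) = y₀ := by simp [rayCoord]
        rw [this]; exact Metric.mem_closedBall_self (by linarith)
      have hm : ((t, y₀ + t • ν) : Spacetime n).2 ∈ S := by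
        refine hSt _ ?_
        rcases lt_or_ge t t₀ with h | h
        · exact Or.inl ⟨⟨ht.1, h.le⟩, hr⟩
        · refine Or.inr ⟨⟨?_, ht.2⟩, hr⟩
          by_contra h'
          exact hnot ⟨h, (not_le.1 h').le⟩
      obtain ⟨q1, q2⟩ := hQS _ hm
      simp only [hD, q1, q2, sub_self]
    simp [hg, hDz]
  have hset : ∫ t in Icc (t₀ - δ) (t₁ + δ), k t • g (t, y₀ + t • ν) = ∫ t in Icc t₀ t₁, k t • g (t, y₀ + t • ν) :=
    MeasureTheory.setIntegral_eq_of_subset_of_forall_sdiff_eq_zero measurableSet_Icc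
      (Icc_subset_Icc (by linarith) (by linarith)) fun t ht => hsub t ht.1 ht.2
  rw [intervalIntegral.integral_of_le (by linarith), ← MeasureTheory.integral_Icc_eq_integral_Ioc,
    hset] at hmain
  rw [intervalIntegral.integral_of_le h01, ← MeasureTheory.integral_Icc_eq_integral_Ioc, ← hmain]
  refine MeasureTheory.setIntegral_congr_fun measurableSet_Icc fun t ht => ?_
  have : k t = 1 := by
    simp only [hk]
    rw [smoothStep_of_ge ht0 ht.1, smoothStep_of_le ht1 ht.2]; norm_num
  simp only [this, one_smul, hg, hD]

end Rays

/-! ### Rays with endpoints on the boundary, by continuity -/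

section Limit

variable {n N : ℕ} {A : Fin (n + 1) → Spacetime n → Op N}

/-- The direction from one point to another. -/
def rayDir (q : EuclideanSpace ℝ (Fin n) × EuclideanSpace ℝ (Fin n)) : EuclideanSpace ℝ (Fin n) :=
  ‖q.2 - q.1‖⁻¹ • (q.2 - q.1)

/-- The null ray through two points starting at time `t₀`: its base point and direction, and the
final time. -/
def rayParam (t₀ : ℝ) (q : EuclideanSpace ℝ (Fin n) × EuclideanSpace ℝ (Fin n)) :
    (EuclideanSpace ℝ (Fin n) × EuclideanSpace ℝ (Fin n)) × ℝ :=
  ((q.1 - t₀ • rayDir q, rayDir q), t₀ + ‖q.2 - q.1‖)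

theorem continuousAt_rayParam (t₀ : ℝ) {q : EuclideanSpace ℝ (Fin n) × EuclideanSpace ℝ (Fin n)}
    (hq : ‖q.2 - q.1‖ ≠ 0) : ContinuousAt (rayParam t₀) q := by
  have a : ContinuousAt (fun q : EuclideanSpace ℝ (Fin n) × EuclideanSpace ℝ (Fin n) => ‖q.2 - q.1‖) q := by
    fun_prop
  have b : ContinuousAt (fun q : EuclideanSpace ℝ (Fin n) × EuclideanSpace ℝ (Fin n) => q.2 - q.1) q := by
    fun_prop
  have c : ContinuousAt (rayDir (n := n)) q := (a.inv₀ hq).smul b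
  have d : ContinuousAt (fun q : EuclideanSpace ℝ (Fin n) × EuclideanSpace ℝ (Fin n) =>
    q.1 - t₀ • rayDir q) q := continuousAt_fst.sub (c.const_smul t₀)
  exact (d.prodMk c).prodMk (continuousAt_const.add a)

theorem norm_rayDir {q : EuclideanSpace ℝ (Fin n) × EuclideanSpace ℝ (Fin n)}
    (hq : ‖q.2 - q.1‖ ≠ 0) : ‖rayDir q‖ = 1 := by
  rw [rayDir, norm_smul, norm_inv, norm_norm, inv_mul_cancel₀ hq]

theorem rayParam_end (t₀ : ℝ) {q : EuclideanSpace ℝ (Fin n) × EuclideanSpace ℝ (Fin n)}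
    (hq : ‖q.2 - q.1‖ ≠ 0) :
    (rayParam t₀ q).1.1 + (rayParam t₀ q).2 • (rayParam t₀ q).1.2 = q.2 := by
  have : ‖q.2 - q.1‖ • rayDir q = q.2 - q.1 := by rw [rayDir, smul_smul, mul_inv_cancel₀ hq, one_smul]
  simp only [rayParam]
  rw [add_smul, this]; abel

theorem rayParam_start (t₀ : ℝ) (q : EuclideanSpace ℝ (Fin n) × EuclideanSpace ℝ (Fin n)) :
    (rayParam t₀ q).1.1 + t₀ • (rayParam t₀ q).1.2 = q.1 := by simp [rayParam]

theorem rayParam_ray {ν y₀ : EuclideanSpace ℝ (Fin n)} (hν : ‖ν‖ = 1) {t₀ t₁ : ℝ} (h01 : t₀ < t₁) :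
    ‖(y₀ + t₁ • ν) - (y₀ + t₀ • ν)‖ = t₁ - t₀ ∧
      rayParam t₀ (y₀ + t₀ • ν, y₀ + t₁ • ν) = ((y₀, ν), t₁) := by
  have e : (y₀ + t₁ • ν) - (y₀ + t₀ • ν) = (t₁ - t₀) • ν := by rw [sub_smul]; abel
  have en : ‖(y₀ + t₁ • ν) - (y₀ + t₀ • ν)‖ = t₁ - t₀ := by
    rw [e, norm_smul, hν, mul_one, Real.norm_eq_abs, abs_of_pos (by linarith)]
  have ed : rayDir (y₀ + t₀ • ν, y₀ + t₁ • ν) = ν := by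
    rw [rayDir]
    simp only
    rw [en, e, smul_smul, inv_mul_cancel₀ (by linarith), one_smul]
  refine ⟨en, ?_⟩
  rw [rayParam, ed]
  simp only
  rw [en]
  simp

/-- The coefficient of the transport equation with the ray as a parameter. -/
def rayFamily (A : Fin (n + 1) → Spacetime n → Op N)
    (q : ℝ × (EuclideanSpace ℝ (Fin n) × EuclideanSpace ℝ (Fin n))) : Op N :=
  rayCoeff A q.2.2 (q.1, q.2.1 + q.1 • q.2.2)

theorem contDiff_rayFamily (hA : ∀ j, ContDiff ℝ ∞ (A j)) : ContDiff ℝ ∞ (rayFamily A) := by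
  have hp : ContDiff ℝ ∞ fun q : ℝ × (EuclideanSpace ℝ (Fin n) × EuclideanSpace ℝ (Fin n)) =>
      ((q.1, q.2.1 + q.1 • q.2.2) : Spacetime n) := by fun_prop
  refine ((hA 0).comp hp).neg.add (ContDiff.sum fun i _ => ?_)
  have hi : ContDiff ℝ ∞ fun q : ℝ × (EuclideanSpace ℝ (Fin n) × EuclideanSpace ℝ (Fin n)) =>
      q.2.2 i := by fun_prop
  have h3 : ContDiff ℝ ∞ fun q : ℝ × (EuclideanSpace ℝ (Fin n) × EuclideanSpace ℝ (Fin n)) =>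
    ((q.2.2 i : ℝ) : ℂ) := Complex.ofRealCLM.contDiff.comp hi
  have h4 : ContDiff ℝ ∞ fun q : ℝ × (EuclideanSpace ℝ (Fin n) × EuclideanSpace ℝ (Fin n)) =>
    A i.succ (q.1, q.2.1 + q.1 • q.2.2) := (hA i.succ).comp hp
  exact h3.smul h4

/-- The integrand of the weighted ray transform. -/
def rayIntegrand (P P' : ℝ × (EuclideanSpace ℝ (Fin n) × EuclideanSpace ℝ (Fin n)) → Op N)
    (D : Spacetime n → Op N) (c : Fin N → ℂ) (x : EuclideanSpace ℝ (Fin n) × EuclideanSpace ℝ (Fin n))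
    (t : ℝ) : Fin N → ℂ :=
  P' (t, x) (D (t, x.1 + t • x.2) (P (t, x) c))

theorem continuous_rayIntegrand
    {P P' : ℝ × (EuclideanSpace ℝ (Fin n) × EuclideanSpace ℝ (Fin n)) → Op N} (hP : ContDiff ℝ ∞ P)
    (hP' : ContDiff ℝ ∞ P') {D : Spacetime n → Op N} (hD : ContDiff ℝ ∞ D) (c : Fin N → ℂ) :
    Continuous (Function.uncurry (rayIntegrand P P' D c)) := by
  have hp : ContDiff ℝ ∞ fun q : (EuclideanSpace ℝ (Fin n) × EuclideanSpace ℝ (Fin n)) × ℝ =>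
      ((q.2, q.1.1 + q.2 • q.1.2) : Spacetime n) := by fun_prop
  have hs : ContDiff ℝ ∞ fun q : (EuclideanSpace ℝ (Fin n) × EuclideanSpace ℝ (Fin n)) × ℝ =>
      (q.2, q.1) := by fun_prop
  exact (contDiff_clm_apply (hP'.comp hs) (contDiff_clm_apply (hD.comp hp)
    (contDiff_clm_apply (hP.comp hs) contDiff_const))).continuous

/-- The two solution operators agree on the observation region `S`. -/
def SameObservation (T : ℝ) (S : Set (EuclideanSpace ℝ (Fin n))) (A : Fin (n + 1) → Spacetime n → Op N)
    (Q₁ Q₂ : Spacetime n → Op N) : Prop :=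
  ∀ f : Spacetime n → Fin N → ℂ, ContDiff ℝ ∞ f → HasCompactSupport f →
    tsupport f ⊆ Ioo 0 T ×ˢ S → ∃ u₁ u₂ : Spacetime n → Fin N → ℂ,
      (ContDiffOn ℝ ∞ u₁ (slab n T) ∧ ZeroData u₁ ∧
        ∀ p ∈ Ioo 0 T ×ˢ (univ : Set (EuclideanSpace ℝ (Fin n))), waveOpCLM A Q₁ u₁ p = f p) ∧
      (ContDiffOn ℝ ∞ u₂ (slab n T) ∧ ZeroData u₂ ∧
        ∀ p ∈ Ioo 0 T ×ˢ (univ : Set (EuclideanSpace ℝ (Fin n))), waveOpCLM A Q₂ u₂ p = f p) ∧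
      ∀ p ∈ Ioo 0 T ×ˢ S, u₁ p = u₂ p

/-- Freezing the direction `μ` turns the family of transports into functions on space-time,
evaluated at `p` with parameter `(rayCoord μ p, μ)`. The condition `1 < R` admits unit directions.
-/
theorem integral_rayIntegrand_eq_zero (hA : ∀ j, ContDiff ℝ ∞ (A j)) {Q₁ Q₂ : Spacetime n → Op N}
    (hQ₁ : ContDiff ℝ ∞ Q₁) (hQ₂ : ContDiff ℝ ∞ Q₂) {T : ℝ} {S : Set (EuclideanSpace ℝ (Fin n))}
    (hQS : ∀ p : Spacetime n, p.2 ∈ S → Q₁ p = 0 ∧ Q₂ p = 0) (hsol : SameObservation T S A Q₁ Q₂)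
    {P P' : ℝ × (EuclideanSpace ℝ (Fin n) × EuclideanSpace ℝ (Fin n)) → Op N}
    (hP : ContDiff ℝ ∞ P) (hP' : ContDiff ℝ ∞ P') {R : ℝ} (hTR : T < R) (hR1 : 1 < R)
    (hPP : ∀ t x, |t| < R → ‖x‖ < R →
      HasDerivAt (fun t => P (t, x)) (rayFamily A (t, x) * P (t, x)) t ∧
      HasDerivAt (fun t => P' (t, x)) (-(P' (t, x) * rayFamily A (t, x))) t ∧ P' (t, x) * P (t, x) = 1)
    {μ y : EuclideanSpace ℝ (Fin n)} (hμ : ‖μ‖ = 1) (hy : ‖y‖ < R) {t₀ t₁ : ℝ} (h0 : 0 < t₀)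
    (h01 : t₀ ≤ t₁) (h1 : t₁ < T) (hS₀ : y + t₀ • μ ∈ interior S) (hS₁ : y + t₁ • μ ∈ interior S)
    (c : Fin N → ℂ) :
    ∫ t in t₀..t₁, rayIntegrand P P' (fun p => Q₂ p - Q₁ p) c (y, μ) t = 0 := by
  have hmem : ∀ p : Spacetime n, p.1 ∈ Icc 0 T → rayCoord μ p ∈ Metric.ball 0 R →
      |p.1| < R ∧ ‖((rayCoord μ p, μ) : EuclideanSpace ℝ (Fin n) × EuclideanSpace ℝ (Fin n))‖ < R := by
    intro p hp1 hp2
    rw [mem_ball_zero_iff] at hp2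
    refine ⟨by rw [abs_of_nonneg hp1.1]; linarith [hp1.2], max_lt hp2 ?_⟩
    show ‖μ‖ < R
    rwa [hμ]
  have hmap : ContDiff ℝ ∞ fun p : Spacetime n => ((p.1, (rayCoord μ p, μ)) :
      ℝ × (EuclideanSpace ℝ (Fin n) × EuclideanSpace ℝ (Fin n))) :=
    contDiff_fst.prodMk ((contDiff_rayCoord μ).prodMk contDiff_const)
  have hrc : ∀ (x : EuclideanSpace ℝ (Fin n)) (t : ℝ), rayCoord μ (t, x + t • μ) = x :=
    fun p t => by simp [rayCoord]
  have hCp : ∀ p : Spacetime n, rayFamily A (p.1, (rayCoord μ p, μ)) = rayCoeff A μ p := fun p => by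
    simp only [rayFamily, rayCoord_add]
  rw [← integral_ray_eq_zero hA hQ₁ hQ₂ hQS hsol hμ h0 h01 h1 hS₀ hS₁ (hP.comp hmap) (hP'.comp hmap)
    (Metric.isOpen_ball.mem_nhds (show y ∈ Metric.ball 0 R by rwa [mem_ball_zero_iff]))
    (fun p hp1 hp2 => by
      refine hasLineDeriv_of_ray ((hP.comp hmap).differentiable (by simp) p) ?_
      simp only [Function.comp_def, hrc, ← hCp]
      exact (hPP _ _ (hmem p hp1 hp2).1 (hmem p hp1 hp2).2).1)
    (fun p hp1 hp2 => by
      refine hasLineDeriv_of_ray ((hP'.comp hmap).differentiable (by simp) p) ?_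
      simp only [Function.comp_def, hrc, ← hCp]
      exact (hPP _ _ (hmem p hp1 hp2).1 (hmem p hp1 hp2).2).2.1) c]
  refine intervalIntegral.integral_congr fun t _ => ?_
  simp only [rayIntegrand, Function.comp_def, hrc]

/-- The ray transform vanishes for rays with endpoints in the closure of the interior of the
observation region. -/
theorem exists_transport_integral_eq_zero (hA : ∀ j, ContDiff ℝ ∞ (A j)) {Q₁ Q₂ : Spacetime n → Op N}
    (hQ₁ : ContDiff ℝ ∞ Q₁) (hQ₂ : ContDiff ℝ ∞ Q₂) {T : ℝ} {S : Set (EuclideanSpace ℝ (Fin n))}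
    (hQS : ∀ p : Spacetime n, p.2 ∈ S → Q₁ p = 0 ∧ Q₂ p = 0) (hsol : SameObservation T S A Q₁ Q₂)
    {ν y₀ : EuclideanSpace ℝ (Fin n)} (hν : ‖ν‖ = 1) {t₀ t₁ : ℝ} (h0 : 0 < t₀)
    (h01 : t₀ < t₁) (h1 : t₁ < T) (hS₀ : y₀ + t₀ • ν ∈ closure (interior S))
    (hS₁ : y₀ + t₁ • ν ∈ closure (interior S)) :
    ∃ P P' : ℝ → Op N, Continuous P ∧ Continuous P' ∧
      (∀ t ∈ Icc 0 T, HasDerivAt P (rayCoeff A ν (t, y₀ + t • ν) * P t) t ∧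
        HasDerivAt P' (-(P' t * rayCoeff A ν (t, y₀ + t • ν))) t ∧ P' t * P t = 1) ∧
      ∀ c, ∫ t in t₀..t₁, P' t ((Q₂ (t, y₀ + t • ν) - Q₁ (t, y₀ + t • ν)) (P t c)) = 0 := by
  have hT : 0 < T := by linarith
  set R := T + ‖y₀‖ + 3 with hR
  have hR0 : 0 < R := by positivity
  obtain ⟨P, P', hP, hP', hPP⟩ := exists_parametric_transport (contDiff_rayFamily hA) hR0
  have hy0 := norm_nonneg y₀
  have hyR : ‖((y₀, ν) : EuclideanSpace ℝ (Fin n) × EuclideanSpace ℝ (Fin n))‖ < R := by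
    refine max_lt ?_ ?_
    · show ‖y₀‖ < R
      linarith
    · show ‖ν‖ < R
      linarith
  have htR : ∀ t ∈ Icc 0 T, |t| < R := fun t ht => by
    rw [abs_of_nonneg ht.1]; linarith [ht.2]
  refine ⟨fun t => P (t, (y₀, ν)), fun t => P' (t, (y₀, ν)), hP.continuous.comp (by fun_prop),
    hP'.continuous.comp (by fun_prop), fun t ht => hPP t _ (htR t ht) hyR, fun c => ?_⟩
  -- Joint continuity in the ray and in the upper limit is needed: with a fixed starting time,
  -- moving the spatial endpoints changes the final time.
  have hΦ := intervalIntegral.continuous_parametric_primitive_of_continuous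
    (μ := MeasureTheory.volume) (a₀ := t₀)
    (continuous_rayIntegrand hP hP' (hQ₂.sub hQ₁) c)
  obtain ⟨hn, hpar⟩ := rayParam_ray (y₀ := y₀) hν h01
  set q₀ : EuclideanSpace ℝ (Fin n) × EuclideanSpace ℝ (Fin n) := (y₀ + t₀ • ν, y₀ + t₁ • ν) with hq₀
  have hn' : ‖q₀.2 - q₀.1‖ = t₁ - t₀ := hn
  have hparc : ContinuousAt (rayParam t₀) q₀ := continuousAt_rayParam t₀ (by rw [hn']; linarith)
  set G := fun q => ∫ t in t₀..(rayParam t₀ q).2,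
    rayIntegrand P P' (fun p => Q₂ p - Q₁ p) c (rayParam t₀ q).1 t with hG
  have hGc : ContinuousAt G q₀ := hΦ.continuousAt.comp hparc
  -- Pairs of interior points of `S` close to `q₀` determine rays covered by the interior case, and
  -- `q₀` is a limit of such pairs.
  have hz : ∀ᶠ q in nhdsWithin q₀ (interior S ×ˢ interior S), G q = 0 := by
    have e1 : ∀ᶠ q in nhds q₀, 0 < ‖q.2 - q.1‖ := by
      have : ContinuousAt (fun q : EuclideanSpace ℝ (Fin n) × EuclideanSpace ℝ (Fin n) =>
        ‖q.2 - q.1‖) q₀ := by fun_prop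
      exact this.eventually (lt_mem_nhds (by show 0 < ‖q₀.2 - q₀.1‖; rw [hn']; linarith))
    have e2 : ∀ᶠ x in nhds (rayParam t₀ q₀), x.2 < T ∧ ‖x.1.1‖ < R := by
      rw [hpar]
      refine Filter.Eventually.and (continuous_snd.continuousAt.eventually (gt_mem_nhds h1))
        ((continuous_fst.comp continuous_fst).norm.continuousAt.eventually (gt_mem_nhds ?_))
      show ‖y₀‖ < R
      linarith
    filter_upwards [mem_nhdsWithin_of_mem_nhds e1, mem_nhdsWithin_of_mem_nhds (hparc.eventually e2),
      self_mem_nhdsWithin] with q g1 g2 g4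
    refine integral_rayIntegrand_eq_zero hA hQ₁ hQ₂ hQS hsol hP hP' (R := R) (by linarith) (by linarith)
      hPP (norm_rayDir g1.ne') g2.2 h0 ?_ g2.1 ?_ ?_ c
    · simp only [rayParam]; linarith
    · rw [show (rayParam t₀ q).1.1 + t₀ • rayDir q = q.1 from rayParam_start t₀ q]
      exact g4.1
    · rw [show (rayParam t₀ q).1.1 + (rayParam t₀ q).2 • rayDir q = q.2 from rayParam_end t₀ g1.ne']
      exact g4.2
  have hcl : q₀ ∈ closure (interior S ×ˢ interior S) := by
    rw [closure_prod_eq]; exact ⟨hS₀, hS₁⟩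
  have hne : (nhdsWithin q₀ (interior S ×ˢ interior S)).NeBot := mem_closure_iff_nhdsWithin_neBot.1 hcl
  have hlim : Filter.Tendsto G (nhdsWithin q₀ (interior S ×ˢ interior S)) (nhds (G q₀)) :=
    hGc.tendsto.mono_left nhdsWithin_le_nhds
  have hG0 : G q₀ = 0 := tendsto_nhds_unique hlim
    ((tendsto_const_nhds (x := (0 : Fin N → ℂ))).congr' (hz.mono fun q hq => hq.symm))
  simp only [hG, hpar] at hG0
  exact hG0

end Limit

/-! ### The transport matrix and the light ray transform -/

section Transport

variable {n N : ℕ}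

/-- The matrix of an operator on `ℂ^N`. -/
def matCLM (L : Op N) : Matrix (Fin N) (Fin N) ℂ := Matrix.of fun a b => L (Pi.single b 1) a

theorem opCLM_matCLM (L : Op N) : opCLM (matCLM L) = L := by
  have h : matCLM L = LinearMap.toMatrix' (L : (Fin N → ℂ) →ₗ[ℂ] Fin N → ℂ) := by
    ext a b
    simp [matCLM, LinearMap.toMatrix'_apply]
  ext1 v
  rw [opCLM_apply, h, ← Matrix.toLin'_apply, Matrix.toLin'_toMatrix']
  rfl

theorem matCLM_opCLM (m : Matrix (Fin N) (Fin N) ℂ) : matCLM (opCLM m) = m := by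
  ext a b
  simp [matCLM]

theorem opCLM_injective : Function.Injective (opCLM : Matrix (Fin N) (Fin N) ℂ → Op N) :=
  Function.LeftInverse.injective matCLM_opCLM

theorem entry_eq_opCLM (m : Matrix (Fin N) (Fin N) ℂ) (a b : Fin N) :
    m a b = opCLM m (Pi.single b 1) a := by
  simp

theorem op_mul_eq_one_comm {L L' : Op N} (h : L * L' = 1) : L' * L = 1 := by
  rw [← opCLM_matCLM L, ← opCLM_matCLM L', ← opCLM_mul, ← opCLM_one] at h ⊢
  rw [mul_eq_one_comm.1 (opCLM_injective h)]

theorem hasDerivWithinAt_opCLM {P : ℝ → Matrix (Fin N) (Fin N) ℂ}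
    {D : Matrix (Fin N) (Fin N) ℂ} {s : Set ℝ} {r : ℝ}
    (h : ∀ a b, HasDerivWithinAt (fun x => P x a b) (D a b) s r) :
    HasDerivWithinAt (fun x => opCLM (P x)) (opCLM D) s r := by
  rw [opCLM_eq_sum D]
  simp_rw [fun x => opCLM_eq_sum (P x)]
  exact HasDerivWithinAt.fun_sum fun a _ => HasDerivWithinAt.fun_sum fun b _ =>
    ((ContinuousLinearMap.toSpanSingleton ℂ (opCLM (Matrix.single a b 1))).restrictScalars
      ℝ).hasFDerivAt.comp_hasDerivWithinAt r (h a b)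

/-- The transport matrix expressed through any invertible operator solution of the transport
equation. -/
theorem opCLM_transport {A : Fin (n + 1) → Spacetime n → Matrix (Fin N) (Fin N) ℂ} {ℓ : ℝ}
    (hℓ : 0 < ℓ) {γ : ℝ → Spacetime n} {U U' : ℝ → Op N}
    (hU : ∀ s ∈ Icc 0 ℓ, HasDerivWithinAt U
      (opCLM (contract A (γ s) (velocity ℓ γ s)) * U s) (Icc 0 ℓ) s)
    (hU' : ∀ s ∈ Icc 0 ℓ, HasDerivWithinAt U'
      (-(U' s * opCLM (contract A (γ s) (velocity ℓ γ s)))) (Icc 0 ℓ) s)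
    (hUU : ∀ s ∈ Icc 0 ℓ, U' s * U s = 1) {s : ℝ} (hs : s ∈ Icc 0 ℓ) :
    opCLM (transport ℓ A γ s) = U s * U' 0 := by
  have h0 : (0 : ℝ) ∈ Icc 0 ℓ := ⟨le_rfl, hℓ.le⟩
  -- `U` corrected on the right by `U' 0` is normalised at `0`, so the definition of `transport`
  -- takes its first branch.
  have hex : ∃ P, IsFundamentalSolution ℓ A γ P := by
    refine ⟨fun s => matCLM (U s * U' 0), ?_, fun s hs a b => ?_⟩
    · apply opCLM_injective
      rw [opCLM_matCLM, op_mul_eq_one_comm (hUU 0 h0), opCLM_one]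
    · rw [entry_eq_opCLM (contract A (γ s) (velocity ℓ γ s) * matCLM (U s * U' 0)), opCLM_mul, opCLM_matCLM, ← mul_assoc]
      let e : Op N →L[ℝ] ℂ := ((ContinuousLinearMap.proj (R := ℂ) (φ := fun _ : Fin N => ℂ) a).comp
        (ContinuousLinearMap.apply ℂ (Fin N → ℂ) (Pi.single b 1))).restrictScalars ℝ
      exact e.hasFDerivAt.comp_hasDerivWithinAt s ((hU s hs).mul_const (U' 0))
  have hP : IsFundamentalSolution ℓ A γ (transport ℓ A γ) := by
    rw [transport, dif_pos hex]
    exact hex.choose_spec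
  -- Uniqueness: `U'` times the chosen fundamental solution has zero derivative, so it keeps its
  -- initial value `U' 0`.
  have hZ : ∀ r ∈ Icc 0 ℓ, HasDerivWithinAt (fun x => U' x * opCLM (transport ℓ A γ x)) 0
      (Icc 0 ℓ) r := by
    intro r hr
    have := (hU' r hr).mul (hasDerivWithinAt_opCLM (hP.2 r hr))
    refine this.congr_deriv ?_
    rw [opCLM_mul]
    ext v : 1
    simp
  have hc := constant_of_derivWithin_zero (fun r hr => (hZ r hr).differentiableWithinAt)
    (fun r hr => (hZ r (Ico_subset_Icc_self hr)).derivWithin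
      (uniqueDiffOn_Icc hℓ r (Ico_subset_Icc_self hr))) s hs
  simp only [hP.1, opCLM_one, mul_one] at hc
  rw [← hc, ← mul_assoc, op_mul_eq_one_comm (hUU s hs), one_mul]

/-- The light ray transform expressed through any invertible operator solution of the transport
equation. -/
theorem lightRayTransform_apply {A : Fin (n + 1) → Spacetime n → Matrix (Fin N) (Fin N) ℂ} {ℓ : ℝ}
    (hℓ : 0 < ℓ) {γ : ℝ → Spacetime n} {U U' : ℝ → Op N}
    (hU : ∀ s ∈ Icc 0 ℓ, HasDerivWithinAt U
      (opCLM (contract A (γ s) (velocity ℓ γ s)) * U s) (Icc 0 ℓ) s)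
    (hU' : ∀ s ∈ Icc 0 ℓ, HasDerivWithinAt U'
      (-(U' s * opCLM (contract A (γ s) (velocity ℓ γ s)))) (Icc 0 ℓ) s)
    (hUU : ∀ s ∈ Icc 0 ℓ, U' s * U s = 1) {Q : Spacetime n → Matrix (Fin N) (Fin N) ℂ}
    (a b : Fin N)
    (hint : IntervalIntegrable (fun s => U' s (opCLM (Q (γ s)) (U s (U' 0 (Pi.single b 1)))))
      MeasureTheory.volume 0 ℓ) :
    lightRayTransform ℓ A γ Q a b =
      U 0 (∫ s in (0 : ℝ)..ℓ, U' s (opCLM (Q (γ s)) (U s (U' 0 (Pi.single b 1))))) a := by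
  have h0 : (0 : ℝ) ∈ Icc 0 ℓ := ⟨le_rfl, hℓ.le⟩
  let e : (Fin N → ℂ) →L[ℂ] ℂ :=
    (ContinuousLinearMap.proj (R := ℂ) (φ := fun _ : Fin N => ℂ) a).comp (U 0)
  have he : U 0 (∫ s in (0 : ℝ)..ℓ, U' s (opCLM (Q (γ s)) (U s (U' 0 (Pi.single b 1))))) a
      = e (∫ s in (0 : ℝ)..ℓ, U' s (opCLM (Q (γ s)) (U s (U' 0 (Pi.single b 1))))) := rfl
  rw [he, ← e.intervalIntegral_comp_comm hint]
  refine intervalIntegral.integral_congr fun s hs => ?_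
  rw [uIcc_of_le hℓ.le] at hs
  have ht := opCLM_transport hℓ hU hU' hUU hs
  -- From `P = U U'(0)` follows `P⁻¹ = U(0) U'`, so `U(0)` comes out of the integral and `U'(0)`
  -- acts on the basis vector.
  have hinv : (transport ℓ A γ s)⁻¹ = matCLM (U 0 * U' s) := by
    refine Matrix.inv_eq_left_inv (opCLM_injective ?_)
    rw [opCLM_mul, opCLM_matCLM, ht, mul_assoc, ← mul_assoc (U' s), hUU s hs, one_mul,
      op_mul_eq_one_comm (hUU 0 h0), opCLM_one]
  show ((transport ℓ A γ s)⁻¹ * Q (γ s) * transport ℓ A γ s) a b = _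
  rw [entry_eq_opCLM ((transport ℓ A γ s)⁻¹ * Q (γ s) * transport ℓ A γ s), opCLM_mul, opCLM_mul, ht, hinv, opCLM_matCLM]
  rfl

end Transport

/-! ### Null geodesics are straight lines -/

section Geodesic

variable {n : ℕ}

theorem minkowski_self (v : Spacetime n) : minkowski v v = ‖v.2‖ ^ 2 - v.1 ^ 2 := by
  rw [minkowski, EuclideanSpace.norm_sq_eq]
  simp only [Real.norm_eq_abs, sq_abs]
  rw [Finset.sum_congr rfl fun i _ => (pow_two (v.2 i)).symm]
  ring

/-- A null geodesic of the Minkowski metric is a straight line in a null direction. -/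
theorem IsNullGeodesic.exists_line {ℓ : ℝ} (hℓ : 0 < ℓ) {γ : ℝ → Spacetime n}
    (hγ : IsNullGeodesic ℓ γ) :
    ∃ (τ v : ℝ) (y ν : EuclideanSpace ℝ (Fin n)), v ≠ 0 ∧ ‖ν‖ = 1 ∧ ∀ s ∈ Icc 0 ℓ,
      γ s = (τ + v * s, y + (τ + v * s) • ν) ∧ velocity ℓ γ s = (v, v • ν) := by
  have hu := uniqueDiffOn_Icc hℓ
  have h0 : (0 : ℝ) ∈ Icc 0 ℓ := ⟨le_rfl, hℓ.le⟩
  have hvd : ContDiffOn ℝ 1 (velocity ℓ γ) (Icc 0 ℓ) :=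
    hγ.smooth.derivWithin hu (by norm_num; exact WithTop.coe_le_coe.2 (le_top (a := (2 : ℕ∞))))
  have hv : ∀ s ∈ Icc 0 ℓ, velocity ℓ γ s = velocity ℓ γ 0 := fun s hs =>
    constant_of_derivWithin_zero (hvd.differentiableOn one_ne_zero)
      (fun r hr => hγ.geodesic r (Ico_subset_Icc_self hr)) s hs
  set V := velocity ℓ γ 0 with hV
  have hd : ∀ s ∈ Icc 0 ℓ, HasDerivWithinAt (fun s => γ s - s • V) 0 (Icc 0 ℓ) s := by
    intro s hs
    have h1 : HasDerivWithinAt γ V (Icc 0 ℓ) s := by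
      rw [← hv s hs]
      exact ((hγ.smooth.differentiableOn (by simp)) s hs).hasDerivWithinAt
    have h2 := h1.sub ((hasDerivWithinAt_id s (Icc 0 ℓ)).smul_const V)
    refine h2.congr_deriv ?_
    simp
  have hline : ∀ s ∈ Icc 0 ℓ, γ s = γ 0 + s • V := by
    intro s hs
    have := constant_of_derivWithin_zero (fun r hr => (hd r hr).differentiableWithinAt)
      (fun r hr => (hd r (Ico_subset_Icc_self hr)).derivWithin
        (hu r (Ico_subset_Icc_self hr))) s hs
    simp only [zero_smul, sub_zero] at this
    rw [← this, sub_add_cancel]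
  have hnull : ‖V.2‖ ^ 2 = V.1 ^ 2 := by
    have := hγ.null 0 h0
    rw [minkowski_self] at this
    linarith
  -- A null vector with zero time component is zero, so time can serve as parameter, possibly
  -- reversed.
  have hV1 : V.1 ≠ 0 := by
    intro h
    rw [h] at hnull
    refine hγ.velocity_ne_zero 0 h0 (Prod.ext h ?_)
    exact norm_eq_zero.1 (pow_eq_zero_iff two_ne_zero |>.1 (hnull.trans (by ring)))
  have habs : ‖V.2‖ = |V.1| := by rw [← abs_norm]; exact (sq_eq_sq_iff_abs_eq_abs _ _).1 hnull
  have hVν : V.1 • V.1⁻¹ • V.2 = V.2 := by rw [smul_smul, mul_inv_cancel₀ hV1, one_smul]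
  -- The base point is where the extended line meets `t = 0`, so that the position at time `t` is `y
  -- + tν`.
  refine ⟨(γ 0).1, V.1, (γ 0).2 - (γ 0).1 • V.1⁻¹ • V.2, V.1⁻¹ • V.2, hV1, ?_, fun s hs => ⟨?_, ?_⟩⟩
  · rw [norm_smul, habs, norm_inv, Real.norm_eq_abs, inv_mul_cancel₀ (abs_ne_zero.2 hV1)]
  · rw [hline s hs]
    refine Prod.ext ?_ ?_
    · simp [mul_comm]
    · show (γ 0).2 + s • V.2 = _
      rw [add_smul, mul_comm V.1 s, mul_smul, hVν]
      rw [← add_assoc, sub_add_cancel]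
  · rw [hv s hs, hVν]

end Geodesic

/-! ### Assembling the theorem -/

section Conclusion

variable {n N : ℕ} {A : Fin (n + 1) → Spacetime n → Matrix (Fin N) (Fin N) ℂ}
  {Q₁ Q₂ : Spacetime n → Matrix (Fin N) (Fin N) ℂ} {T : ℝ} {Ω : Set (EuclideanSpace ℝ (Fin n))}

/-- The contraction is linear in the velocity; the factor `v` accounts for parametrising by `s`
instead of by time. -/
theorem opCLM_contract (p : Spacetime n) (v : ℝ) (ν : EuclideanSpace ℝ (Fin n)) :
    opCLM (contract A p (v, v • ν)) = v • rayCoeff (fun j p => opCLM (A j p)) ν p := by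
  ext w : 1
  simp only [contract, rayCoeff, opCLM_apply, Matrix.add_mulVec, Matrix.neg_mulVec, smul_apply,
    Matrix.smul_mulVec, Matrix.sum_mulVec, add_apply, neg_apply, sum_apply, smul_add, smul_neg,
    Finset.smul_sum, PiLp.smul_apply]
  simp only [smul_eq_mul, Complex.ofReal_mul, mul_smul, Complex.coe_smul]


theorem sameObservation_of_sourceToSolution_eq (hA : ∀ j a b, ContDiff ℝ ∞ fun p => A j p a b)
    (hQ₁ : ∀ a b, ContDiff ℝ ∞ fun p => Q₁ p a b) (hQ₂ : ∀ a b, ContDiff ℝ ∞ fun p => Q₂ p a b)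
    (hR : sourceToSolution T Ω A Q₁ = sourceToSolution T Ω A Q₂) :
    SameObservation T Ωᶜ (fun j p => opCLM (A j p)) (fun p => opCLM (Q₁ p))
      (fun p => opCLM (Q₂ p)) := by
  intro f hf hfc hfs
  have h1 := isWaveSolution_waveSolution hA hQ₁ (⟨f, hf, hfc, hfs⟩ : Source n N T Ω)
  have h2 := isWaveSolution_waveSolution hA hQ₂ (⟨f, hf, hfc, hfs⟩ : Source n N T Ω)
  refine ⟨waveSolution T A Q₁ f, waveSolution T A Q₂ f,
    ⟨h1.smooth, ⟨h1.initial_value, h1.initial_velocity⟩, h1.eqn⟩,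
    ⟨h2.smooth, ⟨h2.initial_value, h2.initial_velocity⟩, h2.eqn⟩, fun p hp => ?_⟩
  exact congrFun (congrFun hR ⟨f, hf, hfc, hfs⟩) ⟨p, hp⟩

theorem opCLM_eq_zero_of_tsupport {Q : Spacetime n → Matrix (Fin N) (Fin N) ℂ}
    (hQ : tsupport Q ⊆ univ ×ˢ Ω) {p : Spacetime n} (hp : p.2 ∈ Ωᶜ) : opCLM (Q p) = 0 := by
  rw [image_eq_zero_of_notMem_tsupport fun h => hp (hQ h).2]
  ext v : 1
  simp

/-- The complement of `interior (closure Ω)` is `closure (interior Ωᶜ)`. This is where the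
regularity of `Ω` enters. -/
theorem mem_closure_interior_compl (hΩ : interior (closure Ω) ⊆ Ω) {x : EuclideanSpace ℝ (Fin n)}
    (hx : x ∉ Ω) : x ∈ closure (interior Ωᶜ) := by
  rw [interior_compl, closure_compl]
  exact fun h => hx (hΩ h)

theorem lightRayTransform_eq_of_sourceToSolution_eq {ℓ : ℝ} (hℓ : 0 < ℓ)
    (hΩ : interior (closure Ω) ⊆ Ω) (hA : ∀ j a b, ContDiff ℝ ∞ fun p => A j p a b)
    {γ : ℝ → Spacetime n} (hγ : IsNullGeodesic ℓ γ) (hγT : ∀ s ∈ Icc 0 ℓ, (γ s).1 ∈ Ioo 0 T)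
    (hγ0 : (γ 0).2 ∉ Ω) (hγℓ : (γ ℓ).2 ∉ Ω)
    (hQ₁ : ∀ a b, ContDiff ℝ ∞ fun p => Q₁ p a b) (hQ₂ : ∀ a b, ContDiff ℝ ∞ fun p => Q₂ p a b)
    (hQ₁Ω : tsupport Q₁ ⊆ univ ×ˢ Ω) (hQ₂Ω : tsupport Q₂ ⊆ univ ×ˢ Ω)
    (hR : sourceToSolution T Ω A Q₁ = sourceToSolution T Ω A Q₂) :
    lightRayTransform ℓ A γ Q₁ = lightRayTransform ℓ A γ Q₂ := by
  have h0 : (0 : ℝ) ∈ Icc 0 ℓ := ⟨le_rfl, hℓ.le⟩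
  have hl : ℓ ∈ Icc 0 ℓ := ⟨hℓ.le, le_rfl⟩
  obtain ⟨τ, v, y, ν, hv, hν, hline⟩ := hγ.exists_line hℓ
  have hA' : ∀ j, ContDiff ℝ ∞ fun p => opCLM (A j p) := fun j => contDiff_opCLM (hA j)
  have hQ₁' : ContDiff ℝ ∞ fun p => opCLM (Q₁ p) := contDiff_opCLM hQ₁
  have hQ₂' : ContDiff ℝ ∞ fun p => opCLM (Q₂ p) := contDiff_opCLM hQ₂
  have hsol := sameObservation_of_sourceToSolution_eq hA hQ₁ hQ₂ hR
  have hQS : ∀ p : Spacetime n, p.2 ∈ Ωᶜ → opCLM (Q₁ p) = 0 ∧ opCLM (Q₂ p) = 0 := fun p hp =>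
    ⟨opCLM_eq_zero_of_tsupport hQ₁Ω hp, opCLM_eq_zero_of_tsupport hQ₂Ω hp⟩
  have hS : ∀ s ∈ Icc 0 ℓ, (γ s).2 ∉ Ω → y + (τ + v * s) • ν ∈ closure (interior Ωᶜ) := by
    intro s hs h
    rw [(hline s hs).1] at h
    exact mem_closure_interior_compl hΩ h
  have hT : ∀ s ∈ Icc 0 ℓ, τ + v * s ∈ Ioo 0 T := by
    intro s hs
    have := hγT s hs
    rwa [(hline s hs).1] at this
  -- If `v < 0` the geodesic runs backwards in time: the result is applied with the endpoints
  -- exchanged, and the integral changes sign.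
  obtain ⟨P, P', hPc, hPc', hP, hz⟩ : ∃ P P' : ℝ → Op N, Continuous P ∧ Continuous P' ∧
      (∀ t ∈ Icc 0 T,
        HasDerivAt P (rayCoeff (fun j p => opCLM (A j p)) ν (t, y + t • ν) * P t) t ∧
        HasDerivAt P' (-(P' t * rayCoeff (fun j p => opCLM (A j p)) ν (t, y + t • ν))) t ∧
        P' t * P t = 1) ∧
      ∀ c, ∫ t in (τ + v * 0)..(τ + v * ℓ),
        P' t ((opCLM (Q₂ (t, y + t • ν)) - opCLM (Q₁ (t, y + t • ν))) (P t c)) = 0 := by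
    rcases lt_or_gt_of_ne hv with hneg | hpos
    · obtain ⟨P, P', h1, h2, h3, h4⟩ := exists_transport_integral_eq_zero hA' hQ₁' hQ₂' hQS hsol hν
        (hT ℓ hl).1 (by nlinarith : τ + v * ℓ < τ + v * 0) (hT 0 h0).2 (hS ℓ hl hγℓ) (hS 0 h0 hγ0)
      exact ⟨P, P', h1, h2, h3, fun c => by rw [intervalIntegral.integral_symm, h4 c, neg_zero]⟩
    · exact exists_transport_integral_eq_zero hA' hQ₁' hQ₂' hQS hsol hν
        (hT 0 h0).1 (by nlinarith) (hT ℓ hl).2 (hS 0 h0 hγ0) (hS ℓ hl hγℓ)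
  have hlin : ∀ s, HasDerivWithinAt (fun s : ℝ => τ + v * s) v (Icc 0 ℓ) s := fun s => by
    simpa using ((hasDerivWithinAt_id s (Icc 0 ℓ)).const_mul v).const_add τ
  have hco : ∀ s ∈ Icc 0 ℓ, opCLM (contract A (γ s) (velocity ℓ γ s)) =
      v • rayCoeff (fun j p => opCLM (A j p)) ν (τ + v * s, y + (τ + v * s) • ν) := by
    intro s hs
    rw [(hline s hs).2, opCLM_contract, (hline s hs).1]
  have hU : ∀ s ∈ Icc 0 ℓ, HasDerivWithinAt (fun s => P (τ + v * s))
      (opCLM (contract A (γ s) (velocity ℓ γ s)) * P (τ + v * s)) (Icc 0 ℓ) s := by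
    intro s hs
    refine ((hP _ (Ioo_subset_Icc_self (hT s hs))).1.scomp_hasDerivWithinAt s (hlin s)).congr_deriv
      ?_
    rw [hco s hs]
    ext w : 1
    simp
  have hU' : ∀ s ∈ Icc 0 ℓ, HasDerivWithinAt (fun s => P' (τ + v * s))
      (-(P' (τ + v * s) * opCLM (contract A (γ s) (velocity ℓ γ s)))) (Icc 0 ℓ) s := by
    intro s hs
    refine ((hP _ (Ioo_subset_Icc_self (hT s hs))).2.1.scomp_hasDerivWithinAt s
      (hlin s)).congr_deriv ?_
    rw [hco s hs]
    ext w : 1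
    simp [ContinuousLinearMap.map_smul_of_tower]
  have hUU : ∀ s ∈ Icc 0 ℓ, P' (τ + v * s) * P (τ + v * s) = 1 := fun s hs =>
    (hP _ (Ioo_subset_Icc_self (hT s hs))).2.2
  have hcont : ∀ Q : Spacetime n → Matrix (Fin N) (Fin N) ℂ,
      (∀ a b, ContDiff ℝ ∞ fun p => Q p a b) → ∀ c : Fin N → ℂ, ContinuousOn (fun s : ℝ =>
        P' (τ + v * s) (opCLM (Q (γ s)) (P (τ + v * s) c))) (uIcc 0 ℓ) := by
    intro Q hQ c
    rw [uIcc_of_le hℓ.le]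
    have hQc : ContinuousOn (fun s => opCLM (Q (γ s))) (Icc 0 ℓ) :=
      (contDiff_opCLM hQ).continuous.comp_continuousOn hγ.smooth.continuousOn
    have h1 : Continuous fun s : ℝ => P (τ + v * s) := hPc.comp (by fun_prop)
    have h2 : Continuous fun s : ℝ => P' (τ + v * s) := hPc'.comp (by fun_prop)
    exact h2.continuousOn.clm_apply (hQc.clm_apply (h1.continuousOn.clm_apply continuousOn_const))
  ext a b
  rw [lightRayTransform_apply hℓ hU hU' hUU a b (hcont Q₁ hQ₁ _).intervalIntegrable,
    lightRayTransform_apply hℓ hU hU' hUU a b (hcont Q₂ hQ₂ _).intervalIntegrable]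
  refine congrFun (congrArg (P (τ + v * 0)) ?_) a
  rw [eq_comm, ← sub_eq_zero, ← intervalIntegral.integral_sub
    (hcont Q₂ hQ₂ _).intervalIntegrable (hcont Q₁ hQ₁ _).intervalIntegrable]
  set c := P' (τ + v * 0) (Pi.single b 1) with hc
  -- Change of variable `t = τ + v s`; the Jacobian factor is harmless since the integral in `t` is
  -- zero.
  have hsub := intervalIntegral.integral_comp_add_mul (a := 0) (b := ℓ) (fun t =>
    P' t ((opCLM (Q₂ (t, y + t • ν)) - opCLM (Q₁ (t, y + t • ν))) (P t c))) hv τ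
  rw [hz c, smul_zero] at hsub
  rw [← hsub]
  refine intervalIntegral.integral_congr fun s hs => ?_
  rw [uIcc_of_le hℓ.le] at hs
  simp only [(hline s hs).1, sub_apply, map_sub]

end Conclusion

end MinkowskiWave

end

theorem mainTheorem6 (n N : ℕ) (T ℓ : ℝ) (hℓ : 0 < ℓ)
    (Ω : Set (EuclideanSpace ℝ (Fin n))) (hΩ : Bornology.IsBounded Ω)
    (hΩreg : interior (closure Ω) ⊆ Ω)
    (A : Fin (n + 1) → MinkowskiWave.Spacetime n → Matrix (Fin N) (Fin N) ℂ)
    (hA : ∀ j a b, ContDiff ℝ ∞ (fun p => A j p a b))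
    (γ : ℝ → MinkowskiWave.Spacetime n) (hγ : MinkowskiWave.IsNullGeodesic ℓ γ)
    (hγT : ∀ s ∈ Set.Icc 0 ℓ, (γ s).1 ∈ Set.Ioo 0 T)
    (hγ0 : (γ 0).2 ∉ Ω) (hγℓ : (γ ℓ).2 ∉ Ω)
    (Q₁ Q₂ : MinkowskiWave.Spacetime n → Matrix (Fin N) (Fin N) ℂ)
    (hQ₁ : ∀ a b, ContDiff ℝ ∞ (fun p => Q₁ p a b))
    (hQ₂ : ∀ a b, ContDiff ℝ ∞ (fun p => Q₂ p a b))
    (hQ₁supp : tsupport Q₁ ⊆ Set.univ ×ˢ Ω) (hQ₂supp : tsupport Q₂ ⊆ Set.univ ×ˢ Ω)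
    (hR : MinkowskiWave.sourceToSolution T Ω A Q₁ = MinkowskiWave.sourceToSolution T Ω A Q₂) :
    MinkowskiWave.lightRayTransform ℓ A γ Q₁ = MinkowskiWave.lightRayTransform ℓ A γ Q₂ := by
  exact MinkowskiWave.lightRayTransform_eq_of_sourceToSolution_eq hℓ hΩreg hA hγ hγT hγ0 hγℓ hQ₁ hQ₂
    hQ₁supp hQ₂supp hR
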